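/- Let $1\le b\le d$ be integers and $\rho\in\mathbb R$. Consider on $\mathbb T^d=(\mathbb R/2\pi\mathbb Z)^d$ the quasi-linear Schrödinger equation $$ iu_t-\Delta u+\rho u+\Delta\Big(\frac{\partial H}{\partial\bar u}(u,\bar u)\Big)=0,\qquad H(u,\bar u)=|u|^4+\sum_{l,l'\ge 0,\ l+l'\ge5}\alpha_{l,l'}u^l\bar u^{l'}, \tag{1}$$ where $H$ is analytic near $0$, $\alpha_{l,l'}\in\mathbb R$ and $\alpha_{l,l'}=\alpha_{l',l}$. **Notation.** Let $n_1,\dots,n_b\in\mathbb Z^d$ be linearly independent; $|\cdot|$ is the Euclidean norm and $e_1,\dots,e_b$ is the standard basis of $\mathbb Z^b$. Let $$\mathcal K=\Big\{k\in\mathbb Z^b:\ \sum_{j}k_j=1,\ \sum_{j}k_j|n_j|^2=\Big|\sum_{j}k_jn_j\Big|^2\Big\},\qquad \mathcal K_2=\mathcal K\setminus\{e_1,\dots,e_b\}.$$ The set $\mathcal K$ is finite. Let $A=A(a_1,\dots,a_b)$ be the matrix indexed by $\mathcal K_2$, with entries in $\mathbb Z[a_1,\dots,a_b]$, given by $$A_{kk}=\sum_{j=1}^b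 k_j|n_j|^2a_j^2,\qquad A_{kk'}=2\sum_{\substack{(i,j):\\ k+e_i-e_j=k'}}a_ia_j+\sum_{\substack{(i,j):\\ e_i+e_j-k=k'}}a_ia_j\quad(k\ne k'),$$ the sums being over ordered pairs $(i,j)\in\{1,\dots,b\}^2$ ($\det A=1$ if $\mathcal K_2=\emptyset$). **Persistence.** Put $\omega_0=(|n_1|^2+\rho,\dots,|n_b|^2+\rho)$ and let $s,\sigma,\kappa,C>0$, $a\in\mathbb R^b$, $\omega\in\mathbb R^b$. We say that $u_0(x,t)=\sum_{j=1}^b a_je^{in_j\cdot x+i(|n_j|^2+\rho)t}$ *persists with frequency $\omega$* (with constants $s,\sigma,\kappa,C$) if (1) has a classical solution of the form $u(x,t)=\sum_{n\in\mathbb Z^d,\,k\in\mathbb Z^b}\hat u(n,k)e^{in\cdot x+i(k\cdot\omega) t}$, with values in the disc of convergence of the series of $H$, such that $$\hat u(n_j,e_j)=a_j\ (1\le j\le b),\qquad \Big(\sum_{(n,k)\notin\{(n_j,e_j)\}}|\hat u(n,k)|^2|(n,k)|^{2s}e^{2\sigma|(n,k)|}\Big)^{1/2}<|a|^{1+\kappa},\qquad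 |\omega-\omega_0|\le C|a|^2 .$$ **Theorem.** Suppose that 1. $(n_i-n_j)\not\perp(n_i-n_l)$ for all distinct $i,j,l\in\{1,\dots,b\}$; 2. $\det A\not\equiv0$ as a polynomial in $a_1,\dots,a_b$. Then there are $c>0$ and $\kappa>0$, depending only on $n_1,\dots,n_b$, such that the following holds. Let $\rho$ be Diophantine, that is, for some $\gamma>0$ and $\tau>1$, $|m\rho-l|\ge\gamma/|m|^\tau$ for all $m\in\mathbb Z\setminus\{0\}$ and $l\in\mathbb Z$; let $H$ be as in (1), and let $s>b/2$ and $\sigma>0$. Then there are $C>0$ and $\varepsilon_0>0$ such that for every $0<\varepsilon<\varepsilon_0$ there is a measurable set $I_\varepsilon\subset[\varepsilon,2\varepsilon]^b$ with $$\operatorname{mes} I_\varepsilon<\varepsilon^{b+c},$$ and for every $a=(a_1,\dots,a_b)\in[\varepsilon,2\varepsilon]^b\setminus I_\varepsilon$ the solution $u_0$ persists with a frequency $\omega$ (with the constants $s,\sigma,\kappa,C$) satisfying $$\Big|\,\omega_j-\Big(|n_j|^2+\rho-|n_j|^2\big(4\textstyle\sum_{l=1}^ba_l^2-2a_j^2\big)\Big)\Big|\le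 C|a|^3,\qquad j=1,\dots,b.$$ -/

import Mathlib

namespace QLS

/-! ### Resonant modes -/

/-- The squared Euclidean length `|v|²` of an integer vector. -/
def sqLen {d : ℕ} (v : Fin d → ℤ) : ℤ := ∑ i, v i ^ 2

/-- The standard basis vector `e_j` of `ℤ^b`. -/
def basisVec {b : ℕ} (j : Fin b) : Fin b → ℤ := Pi.single j 1

/-- The integer vectors `n_j` as vectors of `ℝ^d`. -/
def realVec {b d : ℕ} (n : Fin b → Fin d → ℤ) : Fin b → Fin d → ℝ :=
  fun j i => (n j i : ℝ)

/-- The resonant modes: `k ∈ ℤ^b` with `∑ k_j = 1` and `∑ k_j |n_j|² = |∑ k_j n_j|²`. -/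
def resonantModes {b d : ℕ} (n : Fin b → Fin d → ℤ) : Set (Fin b → ℤ) :=
  {k | ∑ j, k j = 1 ∧ ∑ j, k j * sqLen (n j) = sqLen (∑ j, k j • n j)}

/-- The nontrivial resonant modes: the resonant modes other than `e_1, …, e_b`. -/
def resonantModes₂ {b d : ℕ} (n : Fin b → Fin d → ℤ) : Set (Fin b → ℤ) :=
  resonantModes n \ Set.range basisVec

/-- There are only finitely many resonant modes, so that the determinant below makes sense. -/
theorem resonantModes_finite {b d : ℕ} {n : Fin b → Fin d → ℤ}
    (hn : LinearIndependent ℝ (realVec n)) : (resonantModes n).Finite := by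
  classical
  -- a linear functional `g` with `g (n_j) = |n_j|²`
  obtain ⟨g, hg⟩ : ∃ g : (Fin d → ℝ) →ₗ[ℝ] ℝ, ∀ j, g (realVec n j) = (sqLen (n j) : ℝ) := by
    let B := Module.Basis.span hn
    let f := B.constr ℝ (fun j => (sqLen (n j) : ℝ))
    obtain ⟨g, hg⟩ := LinearMap.exists_extend f
    refine ⟨g, fun j => ?_⟩
    have h1 : f (B j) = (sqLen (n j) : ℝ) := by simp [f]
    have h2 : ((B j : Submodule.span ℝ (Set.range (realVec n))) : Fin d → ℝ) = realVec n j :=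
      congrArg Subtype.val (Module.Basis.span_apply hn j)
    rw [← h1, ← hg, ← h2]; rfl
  let R : (Fin b → ℤ) → (Fin d → ℤ) := fun k => ∑ j, k j • n j
  have hcast : ∀ k : Fin b → ℤ,
      (fun i => ((R k i : ℤ) : ℝ)) = ∑ j, (k j : ℝ) • realVec n j := by
    intro k; ext i; simp [R, realVec, Finset.sum_apply]
  have hinj : Function.Injective R := by
    intro k k' h
    have h0 : ∑ j, ((k j : ℝ) - k' j) • realVec n j = 0 := by
      simp only [sub_smul, Finset.sum_sub_distrib, ← hcast, h, sub_self]
    ext j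
    have := Fintype.linearIndependent_iff.1 hn _ h0 j
    exact_mod_cast sub_eq_zero.1 this
  -- the vectors `∑ k_j n_j` of resonant modes are bounded
  let M : ℝ := ∑ i, |g (Pi.single i 1)|
  have hM : ∀ k ∈ resonantModes n, ∀ i, |((R k i : ℤ) : ℝ)| ≤ M := by
    intro k hk i
    have hsq : g (fun i => ((R k i : ℤ) : ℝ)) = ∑ i, ((R k i : ℤ) : ℝ) ^ 2 := by
      rw [hcast, map_sum]
      simp only [map_smul, hg, smul_eq_mul]
      have := hk.2
      have h3 : ((∑ j, k j * sqLen (n j) : ℤ) : ℝ) = ((sqLen (R k) : ℤ) : ℝ) := by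
        rw [this]
      simpa [sqLen] using h3
    have hlin : g (fun i => ((R k i : ℤ) : ℝ)) = ∑ i, ((R k i : ℤ) : ℝ) * g (Pi.single i 1) := by
      conv_lhs => rw [pi_eq_sum_univ' (fun i => ((R k i : ℤ) : ℝ))]
      simp [map_sum]
    obtain ⟨i₀, -, hi₀⟩ := Finset.exists_max_image Finset.univ
      (fun i => |((R k i : ℤ) : ℝ)|) ⟨i, Finset.mem_univ i⟩
    have hle := hi₀ i (Finset.mem_univ i)
    refine hle.trans ?_
    set T := |((R k i₀ : ℤ) : ℝ)| with hT
    have hT0 : 0 ≤ T := abs_nonneg _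
    have hup : T ^ 2 ≤ T * M := by
      calc T ^ 2 = ((R k i₀ : ℤ) : ℝ) ^ 2 := by rw [hT, sq_abs]
        _ ≤ ∑ i, ((R k i : ℤ) : ℝ) ^ 2 :=
          Finset.single_le_sum (f := fun i => ((R k i : ℤ) : ℝ) ^ 2)
            (fun i _ => sq_nonneg _) (Finset.mem_univ i₀)
        _ = ∑ i, ((R k i : ℤ) : ℝ) * g (Pi.single i 1) := by rw [← hsq, hlin]
        _ ≤ ∑ i, T * |g (Pi.single i 1)| := by
          refine Finset.sum_le_sum fun i _ => (le_abs_self _).trans ?_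
          rw [abs_mul]
          exact mul_le_mul_of_nonneg_right (hi₀ i (Finset.mem_univ i)) (abs_nonneg _)
        _ = T * M := by rw [Finset.mul_sum]
    rcases hT0.eq_or_lt with h | h
    · rw [← h]; exact Finset.sum_nonneg fun i _ => abs_nonneg _
    · nlinarith
  refine Set.Finite.of_finite_image (f := R) ?_ hinj.injOn
  refine (Set.finite_Icc (fun _ : Fin d => -⌈M⌉) (fun _ => ⌈M⌉)).subset ?_
  rintro _ ⟨k, hk, rfl⟩
  refine ⟨fun i => ?_, fun i => ?_⟩
  · have h1 := (abs_le.1 (hM k hk i)).1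
    have h2 := Int.le_ceil M
    have : (-(⌈M⌉ : ℝ)) ≤ ((R k i : ℤ) : ℝ) := by linarith
    exact_mod_cast this
  · have h1 := (abs_le.1 (hM k hk i)).2
    have h2 := Int.le_ceil M
    have : ((R k i : ℤ) : ℝ) ≤ (⌈M⌉ : ℝ) := by linarith
    exact_mod_cast this

theorem resonantModes₂_finite {b d : ℕ} {n : Fin b → Fin d → ℤ}
    (hn : LinearIndependent ℝ (realVec n)) : (resonantModes₂ n).Finite :=
  (resonantModes_finite hn).subset Set.sdiff_subset

/-! ### The matrix `A(a_1, …, a_b)` -/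

/-- The matrix `A`, indexed by the nontrivial resonant modes, with entries in `ℤ[a_1, …, a_b]`:
`A_{kk} = ∑_j k_j |n_j|² a_j²`, and for `k ≠ k'`
`A_{kk'} = 2 ∑_{(i,j) : k + e_i - e_j = k'} a_i a_j + ∑_{(i,j) : e_i + e_j - k = k'} a_i a_j`. -/
noncomputable def resonanceMatrix {b d : ℕ} (n : Fin b → Fin d → ℤ) :
    Matrix (resonantModes₂ n) (resonantModes₂ n) (MvPolynomial (Fin b) ℤ) :=
  fun k k' =>
    if k = k' then
      ∑ j, MvPolynomial.C (k.1 j * sqLen (n j)) * MvPolynomial.X j ^ 2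
    else
      2 * (∑ p : Fin b × Fin b with k.1 + basisVec p.1 - basisVec p.2 = k'.1,
            MvPolynomial.X p.1 * MvPolynomial.X p.2)
        + ∑ p : Fin b × Fin b with basisVec p.1 + basisVec p.2 - k.1 = k'.1,
            MvPolynomial.X p.1 * MvPolynomial.X p.2

open Classical in
/-- The polynomial `det A`. (It is `1` if there is no nontrivial resonant mode.) -/
noncomputable def resonanceDet {b d : ℕ} (n : Fin b → Fin d → ℤ)
    (hn : LinearIndependent ℝ (realVec n)) : MvPolynomial (Fin b) ℤ :=
  letI : Fintype (resonantModes₂ n) := (resonantModes₂_finite hn).fintype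
  (resonanceMatrix n).det

/-! ### The equation -/

/-- The Diophantine condition: `|mρ - l| ≥ γ / |m|^τ` for all integers `m ≠ 0` and `l`,
for some `γ > 0` and `τ > 1`. -/
def IsDiophantine (ρ : ℝ) : Prop :=
  ∃ γ τ : ℝ, 0 < γ ∧ 1 < τ ∧
    ∀ m : ℤ, m ≠ 0 → ∀ l : ℤ, γ / |(m : ℝ)| ^ τ ≤ |(m : ℝ) * ρ - l|

/-- The power series `∑ α_{l,l'} z^l w^{l'}` converges absolutely on a polydisc of radius `r`. -/
def ConvergesAt (α : ℕ → ℕ → ℝ) (r : ℝ) : Prop :=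
  Summable fun p : ℕ × ℕ => |α p.1 p.2| * r ^ (p.1 + p.2)

/-- The admissible coefficients of the higher order part `∑_{l+l' ≥ 5} α_{l,l'} u^l ū^{l'}` of the
Hamiltonian: real, symmetric, with only terms of order at least `5`, analytic near `0`. -/
structure Admissible (α : ℕ → ℕ → ℝ) : Prop where
  symm : ∀ l l', α l l' = α l' l
  order : ∀ l l', l + l' < 5 → α l l' = 0
  analytic : ∃ r : ℝ, 0 < r ∧ ConvergesAt α r

/-- `H(z, w) = z² w² + ∑ α_{l,l'} z^l w^{l'}`, so that `H(u, ū) = |u|⁴ + ∑ α_{l,l'} u^l ū^{l'}`. -/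
noncomputable def hamiltonian (α : ℕ → ℕ → ℝ) (z w : ℂ) : ℂ :=
  z ^ 2 * w ^ 2 + ∑' p : ℕ × ℕ, (α p.1 p.2 : ℂ) * z ^ p.1 * w ^ p.2

/-- `∂H/∂ū (u, ū)`: the derivative of `H(z, w)` in `w`, taken at `z = u`, `w = ū`. -/
noncomputable def dbarH (α : ℕ → ℕ → ℝ) (u : ℂ) : ℂ :=
  deriv (fun w : ℂ => hamiltonian α u w) (starRingEnd ℂ u)

/-- `u` is a classical solution of `i u_t - Δu + ρu + Δ(∂H/∂ū(u, ū)) = 0` on `𝕋^d × ℝ`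
(functions on `𝕋^d = (ℝ/2πℤ)^d` being the `2πℤ^d`-periodic functions on `ℝ^d`), with values in the
open disc where the series of `H` converges. -/
structure IsSolution {d : ℕ} (ρ : ℝ) (α : ℕ → ℕ → ℝ)
    (u : EuclideanSpace ℝ (Fin d) → ℝ → ℂ) : Prop where
  contDiff : ContDiff ℝ 2 fun p : EuclideanSpace ℝ (Fin d) × ℝ => u p.1 p.2
  periodic : ∀ (x : EuclideanSpace ℝ (Fin d)) (t : ℝ) (m : Fin d → ℤ),
    u (x + WithLp.toLp 2 fun i => 2 * Real.pi * (m i : ℝ)) t = u x t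
  mem_disc : ∀ x t, ∃ r : ℝ, ‖u x t‖ < r ∧ ConvergesAt α r
  equation : ∀ x t,
    Complex.I * deriv (fun τ => u x τ) t - Laplacian.laplacian (fun y => u y t) x
      + (ρ : ℂ) * u x t + Laplacian.laplacian (fun y => dbarH α (u y t)) x = 0

/-! ### Persistence -/

/-- The Euclidean norm of a real vector. -/
noncomputable def euclNorm {b : ℕ} (a : Fin b → ℝ) : ℝ := Real.sqrt (∑ j, a j ^ 2)

/-- The Euclidean norm `|(n, k)|` of `(n, k) ∈ ℤ^d × ℤ^b`. -/
noncomputable def freqNorm {b d : ℕ} (p : (Fin d → ℤ) × (Fin b → ℤ)) : ℝ :=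
  Real.sqrt ((sqLen p.1 + sqLen p.2 : ℤ) : ℝ)

/-- The unperturbed frequencies `|n_j|² + ρ`. -/
def baseFreq {b d : ℕ} (n : Fin b → Fin d → ℤ) (ρ : ℝ) (j : Fin b) : ℝ := (sqLen (n j) : ℝ) + ρ

/-- The term `|û(n,k)|² |(n,k)|^{2s} e^{2σ|(n,k)|}` of the weighted norm. -/
noncomputable def weightedTerm {b d : ℕ} (s σ : ℝ) (uhat : (Fin d → ℤ) × (Fin b → ℤ) → ℂ)
    (p : (Fin d → ℤ) × (Fin b → ℤ)) : ℝ :=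
  ‖uhat p‖ ^ 2 * freqNorm p ^ (2 * s) * Real.exp (2 * σ * freqNorm p)

/-- The solution `∑_j a_j e^{i n_j·x + i(|n_j|²+ρ)t}` of the linear equation persists with frequency
`ω`: the equation has a solution `u(x,t) = ∑_{n,k} û(n,k) e^{i n·x + i (k·ω) t}` such that
`û(n_j, e_j) = a_j`, the weighted `ℓ²` norm of the other coefficients is less than `|a|^{1+κ}`, and
`|ω - ω₀| ≤ C |a|²`. -/
def Persists {b d : ℕ} (n : Fin b → Fin d → ℤ) (ρ : ℝ) (α : ℕ → ℕ → ℝ) (s σ κ C : ℝ)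
    (a ω : Fin b → ℝ) : Prop :=
  ∃ (u : EuclideanSpace ℝ (Fin d) → ℝ → ℂ) (uhat : (Fin d → ℤ) × (Fin b → ℤ) → ℂ),
    IsSolution ρ α u ∧
    (∀ x t, HasSum
      (fun p : (Fin d → ℤ) × (Fin b → ℤ) => uhat p *
        Complex.exp (Complex.I *
          (((∑ i, (p.1 i : ℝ) * x i) + (∑ j, (p.2 j : ℝ) * ω j) * t : ℝ) : ℂ)))
      (u x t)) ∧
    (∀ j, uhat (n j, basisVec j) = (a j : ℂ)) ∧
    Summable (fun p : {p : (Fin d → ℤ) × (Fin b → ℤ) // ∀ j, p ≠ (n j, basisVec j)} =>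
      weightedTerm s σ uhat p.1) ∧
    Real.sqrt (∑' p : {p : (Fin d → ℤ) × (Fin b → ℤ) // ∀ j, p ≠ (n j, basisVec j)},
      weightedTerm s σ uhat p.1) < euclNorm a ^ (1 + κ) ∧
    euclNorm (fun j => ω j - baseFreq n ρ j) ≤ C * euclNorm a ^ 2

end QLS

namespace QLS

/-! ### The weighted Wiener algebra -/

/-! The solution is sought with real Fourier coefficients `x_k` supported on the graph `n = ∑ k_j
n_j`, so that the unknown lives on `ℤ^b` only. With `S_k = |∑ k_j n_j|²` and `F = ∂H/∂ū`, the
equation becomes `(k·ω - S_k - ρ) x_k + S_k F_k(x) = 0` for all `k`. Linear independence gives `S_k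
≥ c|k|²`, which beats `k·ω`. Hence there are no small divisors: off the finite set of resonant modes
the divisor is at least `c(1 + S_k)` (`exists_le_abs_divisor`), the Diophantine condition excluding
zeros among the finitely many modes below the range of ellipticity. The quotient `S_k / (k·ω - S_k -
ρ)` is therefore bounded and Lipschitz in `ω` (`exists_invSymbol_bound`); it absorbs the two
derivatives of the nonlinearity. A Lyapunov-Schmidt reduction and a contraction in a weighted Wiener
algebra suffice.

On the resonant modes the unperturbed operator vanishes. The equation at `e_j` defines `ω_j`. On the
nontrivial resonant modes the leading operator is the matrix `linMatrix`, quadratic in the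
amplitudes, which combines the frequency shift with the linearized cubic term. Nonperpendicularity
ensures that the torus does not force these modes at cubic order (`coeff_cubic_of_mem`) and that
they do not act on the frequencies at first order (`coeff_cubicLin_basisVec`). The determinant of
`linMatrix` is a nonzero polynomial by a parity argument (`det_linMatrix_ne_zero`), so by
`exists_volume_sublevel_le` its inverse is of size `ε^{-9/4}` outside a small set of amplitudes.

The scales, with `η = ε^{1/4}`: the torus has size `η^4`; the increment has size at most `η^6` on
the nontrivial resonant modes and `η^10` on the nonresonant ones; the inverse matrix has size
`η^{-9}`; the perturbative remainder has size `η^16` and Lipschitz constant `η^10`. The fixed point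
map then sends the ball of radius `η^6` into itself with a gain of a factor `η`, and its Lipschitz
constant is `O(η)`. The frequency error is `η^16 / η^4 = ε³`. -/

/-- A submultiplicative symmetric weight on an abelian group, normalized at `0`. -/
structure Weight (G : Type*) [AddCommGroup G] where
  /-- the weight function -/
  toFun : G → ℝ
  one_le : ∀ k, 1 ≤ toFun k
  map_zero : toFun 0 = 1
  map_neg : ∀ k, toFun (-k) = toFun k
  map_add_le : ∀ j k, toFun (j + k) ≤ toFun j * toFun k

namespace Weight

variable {G : Type*} [AddCommGroup G]

instance : CoeFun (Weight G) fun _ => G → ℝ := ⟨Weight.toFun⟩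

theorem pos (w : Weight G) (k : G) : 0 < w k := lt_of_lt_of_le one_pos (w.one_le k)

theorem ne_zero (w : Weight G) (k : G) : w k ≠ 0 := (w.pos k).ne'

end Weight

/-- The weighted Wiener algebra. The element `x` represents the formal series with coefficients
`x k / w k`, so that the weighted `ℓ¹` norm of the coefficients is the `ℓ¹` norm of `x`. -/
def Wiener {G : Type*} [AddCommGroup G] (_w : Weight G) : Type _ := lp (fun _ : G => ℝ) 1

namespace Wiener

noncomputable section

variable {G : Type*} [AddCommGroup G] {w : Weight G}
variable {E : Type*} [NormedAddCommGroup E] [NormedSpace ℝ E]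

instance : NormedAddCommGroup (Wiener w) :=
  inferInstanceAs (NormedAddCommGroup (lp (fun _ : G => ℝ) 1))

instance : NormedSpace ℝ (Wiener w) :=
  inferInstanceAs (NormedSpace ℝ (lp (fun _ : G => ℝ) 1))

instance : CompleteSpace (Wiener w) :=
  inferInstanceAs (CompleteSpace (lp (fun _ : G => ℝ) 1))

/-- The `k`-th coefficient, multiplied by the weight. -/
def raw (k : G) : Wiener w →L[ℝ] ℝ :=
  lp.evalCLM ℝ (fun _ : G => ℝ) (p := 1) k

theorem hasSum_raw (x : Wiener w) : HasSum (fun k => |raw k x|) ‖x‖ := by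
  have := lp.hasSum_norm (p := 1) (E := fun _ : G => ℝ) (by norm_num) x
  simp only [ENNReal.toReal_one, Real.rpow_one] at this
  exact this

theorem summable_raw (x : Wiener w) : Summable (fun k => |raw k x|) := (hasSum_raw x).summable

theorem ext_raw {x y : Wiener w} (h : ∀ k, raw k x = raw k y) : x = y := by
  apply lp.ext
  funext k
  exact h k

open Classical in
/-- The basis element `δ_k`. -/
def delta (w : Weight G) (k : G) : Wiener w :=
  (lp.single 1 k (w k) : lp (fun _ : G => ℝ) 1)

open Classical in
theorem raw_delta (j k : G) : raw j (delta w k) = if j = k then w k else 0 := by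
  show (lp.single 1 k (w k) : lp (fun _ : G => ℝ) 1) j = _
  rw [lp.single_apply]
  by_cases h : j = k
  · subst h; simp
  · simp [h]

open Classical in
theorem norm_delta (k : G) : ‖delta w k‖ = w k := by
  have : ‖delta w k‖ = ‖w k‖ := lp.norm_single (E := fun _ : G => ℝ) (p := 1) (by norm_num) k (w k)
  rw [this, Real.norm_of_nonneg (w.pos k).le]

open Classical in
/-- Continuous linear maps agreeing on the basis elements agree. -/
theorem clm_ext {f g : Wiener w →L[ℝ] E} (h : ∀ k, f (delta w k) = g (delta w k)) : f = g := by
  refine lp.ext_continuousLinearMap (E := fun _ : G => ℝ) (p := 1) (by norm_num) ?_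
  intro k
  ext
  -- `δ_k` has raw coordinate `w k`, so the unit vector of `ℓ¹` is `δ_k / w k`.
  have h1 : (lp.single 1 k (1 : ℝ) : lp (fun _ : G => ℝ) 1) = ((w k)⁻¹ • delta w k : Wiener w) := by
    apply lp.ext
    funext j
    have h2 : raw j ((w k)⁻¹ • delta w k : Wiener w) = (w k)⁻¹ * (if j = k then w k else 0) := by
      rw [map_smul, raw_delta, smul_eq_mul]
    refine Eq.trans ?_ h2.symm
    by_cases hj : j = k
    · subst hj; simp [w.ne_zero]
    · simp [hj]
  show f (lp.single 1 k (1 : ℝ) : lp (fun _ : G => ℝ) 1) = g (lp.single 1 k (1 : ℝ) : lp (fun _ : G => ℝ) 1)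
  rw [h1]
  exact (map_smul f _ _).trans ((congrArg _ (h k)).trans (map_smul g _ _).symm)

theorem C_nonneg {E : Type*} [NormedAddCommGroup E] {φ : G → E} {C : ℝ}
    (h : ∀ k, ‖φ k‖ ≤ C * w k) : 0 ≤ C := by
  have := (norm_nonneg _).trans (h 0)
  rwa [w.map_zero, mul_one] at this

variable [CompleteSpace E]

theorem summable_raw_smul {φ : G → E} {C : ℝ} (h : ∀ k, ‖φ k‖ ≤ C * w k) (x : Wiener w) :
    Summable fun k => (raw k x / w k) • φ k := by
  refine Summable.of_norm_bounded ((summable_raw x).mul_left C) fun k => ?_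
  rw [norm_smul, norm_div, Real.norm_eq_abs, Real.norm_of_nonneg (w.pos k).le, div_mul_eq_mul_div,
    div_le_iff₀ (w.pos k)]
  nlinarith [h k, abs_nonneg (raw k x)]

/-- The continuous linear map with prescribed values `φ k` on the basis elements. -/
def lift (φ : G → E) (C : ℝ) (h : ∀ k, ‖φ k‖ ≤ C * w k) : Wiener w →L[ℝ] E :=
  LinearMap.mkContinuous
    { toFun := fun x => ∑' k, (raw k x / w k) • φ k
      map_add' := fun x y => by
        rw [← (summable_raw_smul h x).tsum_add (summable_raw_smul h y)]
        refine tsum_congr fun k => ?_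
        rw [map_add, add_div, add_smul]
      map_smul' := fun c x => by
        rw [RingHom.id_apply, ← (summable_raw_smul h x).tsum_const_smul]
        refine tsum_congr fun k => ?_
        rw [map_smul, smul_eq_mul, mul_div_assoc, mul_smul] } C
    fun x => by
      refine tsum_of_norm_bounded ((hasSum_raw x).mul_left C) fun k => ?_
      rw [norm_smul, norm_div, Real.norm_eq_abs, Real.norm_of_nonneg (w.pos k).le,
        div_mul_eq_mul_div, div_le_iff₀ (w.pos k)]
      nlinarith [h k, abs_nonneg (raw k x)]

theorem lift_hasSum {φ : G → E} {C : ℝ} (h : ∀ k, ‖φ k‖ ≤ C * w k) (x : Wiener w) :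
    HasSum (fun k => (raw k x / w k) • φ k) (lift φ C h x) :=
  (summable_raw_smul h x).hasSum

@[simp] theorem lift_delta {φ : G → E} {C : ℝ} (h : ∀ k, ‖φ k‖ ≤ C * w k) (k : G) :
    lift φ C h (delta w k) = φ k := by
  refine (lift_hasSum h (delta w k)).unique ?_
  have : HasSum (fun j => (raw j (delta w k) / w j) • φ j) ((raw k (delta w k) / w k) • φ k) := by
    refine hasSum_single k fun j hj => ?_
    rw [raw_delta, if_neg hj]; simp
  convert this using 1
  rw [raw_delta, if_pos rfl, div_self (w.ne_zero k), one_smul]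

theorem norm_lift_le {φ : G → E} {C : ℝ} (h : ∀ k, ‖φ k‖ ≤ C * w k) : ‖lift φ C h‖ ≤ C :=
  LinearMap.mkContinuous_norm_le _ (C_nonneg h) _

theorem norm_lift_apply_le {φ : G → E} {C : ℝ} (h : ∀ k, ‖φ k‖ ≤ C * w k) (x : Wiener w) :
    ‖lift φ C h x‖ ≤ C * ‖x‖ :=
  (ContinuousLinearMap.le_opNorm _ _).trans
    (mul_le_mul_of_nonneg_right (norm_lift_le h) (norm_nonneg _))

/-! #### Convolution -/

/-- The shift by `j`. -/
def shift (j : G) : Wiener w →L[ℝ] Wiener w :=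
  lift (fun k => delta w (j + k)) (w j) fun k => by
    rw [norm_delta]; exact w.map_add_le j k

/-- The convolution product. -/
def conv : Wiener w →L[ℝ] Wiener w →L[ℝ] Wiener w :=
  lift (fun j => shift j) 1 fun j => by
    rw [one_mul]; exact norm_lift_le _

theorem conv_delta (j k : G) : conv (delta w j) (delta w k) = delta w (j + k) := by
  simp [conv, shift]

theorem norm_conv_le (x y : Wiener w) : ‖conv x y‖ ≤ ‖x‖ * ‖y‖ := by
  refine (ContinuousLinearMap.le_opNorm₂ _ _ _).trans ?_
  have : ‖(conv : Wiener w →L[ℝ] _)‖ ≤ 1 := norm_lift_le _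
  have h2 := mul_nonneg (norm_nonneg x) (norm_nonneg y)
  nlinarith

theorem conv_comm (x y : Wiener w) : conv x y = conv y x := by
  have : (conv : Wiener w →L[ℝ] _) = conv.flip := by
    refine clm_ext fun j => clm_ext fun k => ?_
    rw [ContinuousLinearMap.flip_apply, conv_delta, conv_delta, add_comm]
  conv_lhs => rw [this]
  rfl

/-- Both sides are continuous and trilinear, so it is enough to compare them on basis elements,
where the identity is associativity of addition in `G`. -/
theorem conv_assoc (x y z : Wiener w) : conv (conv x y) z = conv x (conv y z) := by
  let f : Wiener w →L[ℝ] Wiener w →L[ℝ] Wiener w →L[ℝ] Wiener w :=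
    (ContinuousLinearMap.compL ℝ (Wiener w) (Wiener w) (Wiener w →L[ℝ] Wiener w) conv).comp conv
  let g : Wiener w →L[ℝ] Wiener w →L[ℝ] Wiener w →L[ℝ] Wiener w :=
    (((ContinuousLinearMap.compL ℝ (Wiener w) (Wiener w →L[ℝ] Wiener w)
      (Wiener w →L[ℝ] Wiener w)).flip conv).comp
      ((ContinuousLinearMap.compL ℝ (Wiener w) (Wiener w) (Wiener w)).comp conv))
  have hf : ∀ x y z, f x y z = conv (conv x y) z := fun _ _ _ => rfl
  have hg : ∀ x y z, g x y z = conv x (conv y z) := fun _ _ _ => rfl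
  have : f = g := by
    refine clm_ext fun j => clm_ext fun k => clm_ext fun l => ?_
    rw [hf, hg, conv_delta, conv_delta, conv_delta, conv_delta, add_assoc]
  rw [← hf, ← hg, this]

theorem delta_zero_conv (x : Wiener w) : conv (delta w 0) x = x := by
  have : conv (delta w 0) = ContinuousLinearMap.id ℝ (Wiener w) := by
    refine clm_ext fun k => ?_
    rw [conv_delta, zero_add]; rfl
  rw [this]; rfl

instance : NormedCommRing (Wiener w) :=
  { (inferInstance : NormedAddCommGroup (Wiener w)) with
    mul := fun x y => conv x y
    one := delta w 0
    left_distrib := fun x y z => map_add (conv x) y z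
    right_distrib := fun x y z => by
      show conv (x + y) z = conv x z + conv y z
      rw [map_add]; rfl
    zero_mul := fun x => by show conv 0 x = 0; rw [map_zero]; rfl
    mul_zero := fun x => map_zero (conv x)
    mul_assoc := conv_assoc
    one_mul := delta_zero_conv
    mul_one := fun x => (conv_comm x _).trans (delta_zero_conv x)
    mul_comm := conv_comm
    norm_mul_le := norm_conv_le }

theorem mul_def (x y : Wiener w) : x * y = conv x y := rfl

theorem one_def : (1 : Wiener w) = delta w 0 := rfl

instance : NormOneClass (Wiener w) := ⟨by rw [one_def, norm_delta, w.map_zero]⟩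

instance : NormedAlgebra ℝ (Wiener w) :=
  { Algebra.ofModule (R := ℝ) (A := Wiener w)
      (fun c x y => by rw [mul_def, mul_def, map_smul]; rfl)
      (fun c x y => by rw [mul_def, mul_def, map_smul]) with
    norm_smul_le := norm_smul_le }

/-! #### Coefficients, evaluation and multipliers -/

/-- The `k`-th coefficient. -/
def coeff (k : G) : Wiener w →L[ℝ] ℝ := (w k)⁻¹ • raw k

theorem coeff_apply (k : G) (x : Wiener w) : coeff k x = raw k x / w k := by
  simp [coeff, div_eq_inv_mul]

open Classical in
theorem coeff_delta (j k : G) : coeff j (delta w k) = if j = k then 1 else 0 := by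
  rw [coeff_apply, raw_delta]
  split_ifs with h
  · rw [h, div_self (w.ne_zero k)]
  · simp

theorem ext_coeff {x y : Wiener w} (h : ∀ k, coeff k x = coeff k y) : x = y := by
  refine ext_raw fun k => ?_
  have := h k
  rw [coeff_apply, coeff_apply] at this
  exact (div_left_inj' (w.ne_zero k)).1 this

theorem hasSum_norm (x : Wiener w) : HasSum (fun k => |coeff k x| * w k) ‖x‖ := by
  convert hasSum_raw x using 2 with k
  rw [coeff_apply, abs_div, abs_of_pos (w.pos k), div_mul_cancel₀ _ (w.ne_zero k)]

theorem abs_coeff_mul_le (k : G) (x : Wiener w) : |coeff k x| * w k ≤ ‖x‖ :=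
  le_hasSum (hasSum_norm x) k fun j _ => mul_nonneg (abs_nonneg _) (w.pos j).le

theorem abs_coeff_le (k : G) (x : Wiener w) : |coeff k x| ≤ ‖x‖ :=
  (le_mul_of_one_le_right (abs_nonneg _) (w.one_le k)).trans (abs_coeff_mul_le k x)

theorem lift_hasSum_coeff {φ : G → E} {C : ℝ} (h : ∀ k, ‖φ k‖ ≤ C * w k) (x : Wiener w) :
    HasSum (fun k => coeff k x • φ k) (lift φ C h x) := by
  simpa only [coeff_apply] using lift_hasSum h x

theorem coeff_delta_mul (m k : G) (x : Wiener w) :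
    coeff k (delta w m * x) = coeff (k - m) x := by
  classical
  have : (coeff k).comp (conv (delta w m)) = (coeff (k - m) : Wiener w →L[ℝ] ℝ) := by
    refine clm_ext fun j => ?_
    rw [ContinuousLinearMap.comp_apply, conv_delta, coeff_delta, coeff_delta]
    exact if_congr (by rw [sub_eq_iff_eq_add, add_comm]) rfl rfl
  exact DFunLike.congr_fun this x

/-- The reflection `k ↦ -k` of coefficients. -/
def reflect : Wiener w →L[ℝ] Wiener w :=
  lift (fun k => delta w (-k)) 1 fun k => by rw [norm_delta, w.map_neg, one_mul]

@[simp] theorem reflect_delta (k : G) : reflect (delta w k) = delta w (-k) := by simp [reflect]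

theorem norm_reflect_le (x : Wiener w) : ‖reflect x‖ ≤ ‖x‖ := by
  exact (norm_lift_apply_le _ x).trans_eq (one_mul _)

theorem coeff_reflect (k : G) (x : Wiener w) : coeff k (reflect x) = coeff (-k) x := by
  classical
  have : (coeff k).comp reflect = (coeff (-k) : Wiener w →L[ℝ] ℝ) := by
    refine clm_ext fun j => ?_
    rw [ContinuousLinearMap.comp_apply, reflect_delta, coeff_delta, coeff_delta]
    exact if_congr (by rw [neg_eq_iff_eq_neg]) rfl rfl
  exact DFunLike.congr_fun this x

/-- The Fourier multiplier with bounded symbol `m`. -/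
def multiplier (m : G → ℝ) (C : ℝ) (h : ∀ k, |m k| ≤ C) : Wiener w →L[ℝ] Wiener w :=
  lift (fun k => m k • delta w k) C fun k => by
    rw [norm_smul, norm_delta, Real.norm_eq_abs]
    exact mul_le_mul_of_nonneg_right (h k) (w.pos k).le

theorem norm_multiplier_apply_le {m : G → ℝ} {C : ℝ} (h : ∀ k, |m k| ≤ C) (x : Wiener w) :
    ‖multiplier m C h x‖ ≤ C * ‖x‖ := norm_lift_apply_le _ x

theorem coeff_multiplier {m : G → ℝ} {C : ℝ} (h : ∀ k, |m k| ≤ C) (k : G) (x : Wiener w) :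
    coeff k (multiplier m C h x) = m k * coeff k x := by
  classical
  have : (coeff k).comp (multiplier m C h) = m k • (coeff k : Wiener w →L[ℝ] ℝ) := by
    refine clm_ext fun j => ?_
    rw [ContinuousLinearMap.comp_apply, multiplier, lift_delta, map_smul,
      smul_apply, coeff_delta]
    by_cases hkj : k = j
    · rw [hkj]
    · simp [hkj]
  exact DFunLike.congr_fun this x

/-- Evaluation at a unitary character. -/
def evalChar (χ : G → ℂ) (h : ∀ k, ‖χ k‖ = 1) : Wiener w →L[ℝ] ℂ :=
  lift χ 1 fun k => by rw [h, one_mul]; exact w.one_le k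

theorem evalChar_hasSum {χ : G → ℂ} (h : ∀ k, ‖χ k‖ = 1) (x : Wiener w) :
    HasSum (fun k => (coeff k x : ℂ) * χ k) (evalChar χ h x) := by
  exact (lift_hasSum_coeff _ x).congr_fun fun k => by rw [Complex.real_smul]

theorem norm_evalChar_le {χ : G → ℂ} (h : ∀ k, ‖χ k‖ = 1) (x : Wiener w) :
    ‖evalChar χ h x‖ ≤ ‖x‖ := by
  exact (norm_lift_apply_le _ x).trans_eq (one_mul _)

/-- Evaluation at a multiplicative character is an algebra homomorphism. Identities between
coefficients thereby become pointwise identities between functions. -/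
theorem evalChar_mul {χ : G → ℂ} (h : ∀ k, ‖χ k‖ = 1) (hadd : ∀ j k, χ (j + k) = χ j * χ k)
    (x y : Wiener w) : evalChar χ h (x * y) = evalChar χ h x * evalChar χ h y := by
  have : (ContinuousLinearMap.compL ℝ (Wiener w) (Wiener w) ℂ (evalChar χ h)).comp conv =
      ((ContinuousLinearMap.mul ℝ ℂ).bilinearComp (evalChar χ h) (evalChar χ h) :
        Wiener w →L[ℝ] Wiener w →L[ℝ] ℂ) := by
    refine clm_ext fun j => clm_ext fun k => ?_
    show evalChar χ h (conv (delta w j) (delta w k)) =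
      evalChar χ h (delta w j) * evalChar χ h (delta w k)
    rw [conv_delta]
    simp [evalChar, hadd]
  exact DFunLike.congr_fun (DFunLike.congr_fun this x) y

theorem evalChar_one {χ : G → ℂ} (h : ∀ k, ‖χ k‖ = 1) (h0 : χ 0 = 1) :
    evalChar χ h (1 : Wiener w) = 1 := by
  rw [one_def]; simp [evalChar, h0]

/-- The coefficients are real, so conjugating the sum only conjugates the characters, which amounts
to replacing `k` by `-k`. This is how `ū` is represented inside a real algebra. -/
theorem evalChar_reflect {χ : G → ℂ} (h : ∀ k, ‖χ k‖ = 1)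
    (hneg : ∀ k, χ (-k) = starRingEnd ℂ (χ k)) (x : Wiener w) :
    evalChar χ h (reflect x) = starRingEnd ℂ (evalChar χ h x) := by
  have : (evalChar χ h).comp reflect =
      ((Complex.conjCLE : ℂ →L[ℝ] ℂ).comp (evalChar χ h) : Wiener w →L[ℝ] ℂ) := by
    refine clm_ext fun k => ?_
    simp [evalChar, hneg]
  exact DFunLike.congr_fun this x

end

end Wiener

/-! ### The higher order part of the nonlinearity -/

section HigherOrder

variable {A : Type*} [NormedCommRing A] [NormedAlgebra ℝ A] [NormOneClass A]

/-- The series `∑ α_{l,l'} l' x^l y^{l'-1}`. -/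
noncomputable def higherOrder (α : ℕ → ℕ → ℝ) (x y : A) : A :=
  -- The truncated exponent at `p.2 = 0` is harmless, because the factor `p.2` kills that term.
  ∑' p : ℕ × ℕ, (α p.1 p.2 * p.2) • (x ^ p.1 * y ^ (p.2 - 1))

omit [NormedAlgebra ℝ A] in
theorem norm_pow_le_of_le {x : A} {r : ℝ} (hx : ‖x‖ ≤ r) (n : ℕ) : ‖x ^ n‖ ≤ r ^ n :=
  (norm_pow_le x n).trans (pow_le_pow_left₀ (norm_nonneg _) hx n)

omit [NormedAlgebra ℝ A] in
theorem norm_pow_mul_pow_le {x y : A} {r : ℝ} (hx : ‖x‖ ≤ r) (hy : ‖y‖ ≤ r) (l m : ℕ) :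
    ‖x ^ l * y ^ m‖ ≤ r ^ (l + m) := by
  have hr : 0 ≤ r := (norm_nonneg _).trans hx
  rw [pow_add]
  exact (norm_mul_le _ _).trans (mul_le_mul (norm_pow_le_of_le hx l) (norm_pow_le_of_le hy m)
    (norm_nonneg _) (by positivity))

omit [NormedAlgebra ℝ A] in
theorem norm_pow_sub_pow_le {x x' : A} {r : ℝ} (hx : ‖x‖ ≤ r) (hx' : ‖x'‖ ≤ r) (n : ℕ) :
    ‖x ^ n - x' ^ n‖ ≤ n * r ^ (n - 1) * ‖x - x'‖ := by
  have hr : 0 ≤ r := (norm_nonneg _).trans hx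
  rw [← (Commute.all x x').mul_geom_sum₂ n]
  refine (norm_mul_le _ _).trans ?_
  rw [mul_comm]
  refine mul_le_mul_of_nonneg_right ?_ (norm_nonneg _)
  refine (norm_sum_le _ _).trans ?_
  refine (Finset.sum_le_sum (g := fun _ => r ^ (n - 1)) fun i hi => ?_).trans_eq (by simp)
  have hi' := Finset.mem_range.1 hi
  refine (norm_pow_mul_pow_le hx hx' i (n - 1 - i)).trans_eq ?_
  congr 1
  omega

-- One factor is changed at a time. The cases `l = 0` and `m = 0` are separated because of the
-- truncated exponents.
omit [NormedAlgebra ℝ A] in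
theorem norm_monomial_sub_le {x y x' y' : A} {r δ : ℝ} (hx : ‖x‖ ≤ r) (hx' : ‖x'‖ ≤ r)
    (hy : ‖y‖ ≤ r) (hy' : ‖y'‖ ≤ r) (hxδ : ‖x - x'‖ ≤ δ) (hyδ : ‖y - y'‖ ≤ δ) (l m : ℕ) :
    ‖x ^ l * y ^ m - x' ^ l * y' ^ m‖ ≤ (l + m : ℕ) * r ^ (l + m - 1) * δ := by
  have hr : 0 ≤ r := (norm_nonneg _).trans hx
  have hδ : 0 ≤ δ := (norm_nonneg _).trans hxδ
  have h1 : x ^ l * y ^ m - x' ^ l * y' ^ m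
      = (x ^ l - x' ^ l) * y ^ m + x' ^ l * (y ^ m - y' ^ m) := by ring
  have e1 : (l : ℝ) * r ^ (l - 1) * r ^ m = l * r ^ (l + m - 1) := by
    rcases Nat.eq_zero_or_pos l with h | h
    · simp [h]
    · rw [mul_assoc, ← pow_add]; congr 2; omega
  have e2 : r ^ l * ((m : ℝ) * r ^ (m - 1)) = m * r ^ (l + m - 1) := by
    rcases Nat.eq_zero_or_pos m with h | h
    · simp [h]
    · rw [mul_left_comm, ← pow_add]; congr 2; omega
  have b1 : ‖(x ^ l - x' ^ l) * y ^ m‖ ≤ (l * r ^ (l - 1) * δ) * r ^ m :=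
    (norm_mul_le _ _).trans (mul_le_mul
      ((norm_pow_sub_pow_le hx hx' l).trans (mul_le_mul_of_nonneg_left hxδ (by positivity)))
      (norm_pow_le_of_le hy m) (norm_nonneg _) (by positivity))
  have b2 : ‖x' ^ l * (y ^ m - y' ^ m)‖ ≤ r ^ l * (m * r ^ (m - 1) * δ) :=
    (norm_mul_le _ _).trans (mul_le_mul (norm_pow_le_of_le hx' l)
      ((norm_pow_sub_pow_le hy hy' m).trans (mul_le_mul_of_nonneg_left hyδ (by positivity)))
      (norm_nonneg _) (by positivity))
  rw [h1]
  refine (norm_add_le _ _).trans ((add_le_add b1 b2).trans_eq ?_)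
  push_cast
  linear_combination δ * e1 + δ * e2

/-- The constant in the bounds for the higher order part. -/
noncomputable def hoConst (α : ℕ → ℕ → ℝ) (R : ℝ) : ℝ :=
  (4 ^ 5 / R ^ 5) * ∑' p : ℕ × ℕ, |α p.1 p.2| * R ^ (p.1 + p.2)

/-- Differentiation and the Lipschitz estimate together cost at most the square of the total degree
`m + 5`. Since `N² ≤ 4^N`, shrinking the radius from `R` to `R/4` pays for this. -/
theorem sq_mul_pow_le {R r : ℝ} (hR : 0 < R) (hr0 : 0 ≤ r) (hr : r ≤ R / 4) (m : ℕ) :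
    ((m + 5 : ℕ) : ℝ) ^ 2 * r ^ m ≤ 4 ^ 5 / R ^ 5 * R ^ (m + 5) := by
  have h1 : ((m + 5 : ℕ) : ℝ) ^ 2 ≤ 4 ^ (m + 5) := by
    have : (m + 5) < 2 ^ (m + 5) := Nat.lt_two_pow_self
    have h2 : (m + 5) ^ 2 ≤ (2 ^ (m + 5)) ^ 2 := Nat.pow_le_pow_left this.le 2
    rw [← pow_mul, mul_comm, pow_mul] at h2
    exact_mod_cast h2
  calc ((m + 5 : ℕ) : ℝ) ^ 2 * r ^ m ≤ 4 ^ (m + 5) * (R / 4) ^ m :=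
        mul_le_mul h1 (pow_le_pow_left₀ hr0 hr m) (by positivity) (by positivity)
    _ = 4 ^ 5 / R ^ 5 * R ^ (m + 5) := by
        rw [div_pow, pow_add, pow_add]; field_simp

/-- The Hamiltonian terms have degree at least `5`; one derivative leaves at least four powers of
`r`, and all further powers are traded for powers of `R`. -/
theorem term_bound {α : ℕ → ℕ → ℝ} (hα : ∀ l l', l + l' < 5 → α l l' = 0) {R r : ℝ} (hR : 0 < R)
    (hr0 : 0 ≤ r) (hr : r ≤ R / 4) (p : ℕ × ℕ) :
    |α p.1 p.2 * p.2| * r ^ (p.1 + (p.2 - 1))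
      ≤ 4 ^ 5 / R ^ 5 * r ^ 4 * (|α p.1 p.2| * R ^ (p.1 + p.2)) := by
  obtain ⟨l, m⟩ := p
  dsimp only
  rcases lt_or_ge (l + m) 5 with h | h
  · simp [hα l m h]
  rcases m with _ | m
  · simp only [Nat.cast_zero, mul_zero, abs_zero, zero_mul]; positivity
  obtain ⟨j, hj⟩ := Nat.exists_eq_add_of_le h
  have hb := sq_mul_pow_le hR hr0 hr j
  have e : l + (m + 1) = j + 5 := by omega
  have e' : l + (m + 1 - 1) = j + 4 := by omega
  rw [e, e', abs_mul, Nat.abs_cast]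
  have hm : ((m + 1 : ℕ) : ℝ) ≤ ((j + 5 : ℕ) : ℝ) ^ 2 := by
    have : m + 1 ≤ (j + 5) ^ 2 := by nlinarith
    exact_mod_cast this
  calc |α l (m + 1)| * ((m + 1 : ℕ) : ℝ) * r ^ (j + 4)
      = |α l (m + 1)| * r ^ 4 * (((m + 1 : ℕ) : ℝ) * r ^ j) := by ring
    _ ≤ |α l (m + 1)| * r ^ 4 * (4 ^ 5 / R ^ 5 * R ^ (j + 5)) := by
        refine mul_le_mul_of_nonneg_left (le_trans ?_ hb) (by positivity)
        exact mul_le_mul_of_nonneg_right hm (by positivity)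
    _ = _ := by ring

/-- As in `term_bound`, with one more derivative: only `r ^ 3` is left outside. -/
theorem term_lipschitz_bound {α : ℕ → ℕ → ℝ} (hα : ∀ l l', l + l' < 5 → α l l' = 0) {R r : ℝ}
    (hR : 0 < R) (hr0 : 0 ≤ r) (hr : r ≤ R / 4) (p : ℕ × ℕ) :
    |α p.1 p.2 * p.2| * ((p.1 + (p.2 - 1) : ℕ) * r ^ (p.1 + (p.2 - 1) - 1))
      ≤ 4 ^ 5 / R ^ 5 * r ^ 3 * (|α p.1 p.2| * R ^ (p.1 + p.2)) := by
  obtain ⟨l, m⟩ := p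
  dsimp only
  rcases lt_or_ge (l + m) 5 with h | h
  · simp [hα l m h]
  rcases m with _ | m
  · simp only [Nat.cast_zero, mul_zero, abs_zero, zero_mul]; positivity
  obtain ⟨j, hj⟩ := Nat.exists_eq_add_of_le h
  have hb := sq_mul_pow_le hR hr0 hr j
  have e : l + (m + 1) = j + 5 := by omega
  have e' : l + (m + 1 - 1) = j + 4 := by omega
  have e'' : l + (m + 1 - 1) - 1 = j + 3 := by omega
  rw [e, e'', e', abs_mul, Nat.abs_cast]
  have hm : ((m + 1 : ℕ) : ℝ) * ((j + 4 : ℕ) : ℝ) ≤ ((j + 5 : ℕ) : ℝ) ^ 2 := by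
    have : (m + 1) * (j + 4) ≤ (j + 5) ^ 2 := by
      rw [sq]; exact Nat.mul_le_mul (by omega) (by omega)
    exact_mod_cast this
  calc |α l (m + 1)| * ((m + 1 : ℕ) : ℝ) * (((j + 4 : ℕ) : ℝ) * r ^ (j + 3))
      = |α l (m + 1)| * r ^ 3 * (((m + 1 : ℕ) : ℝ) * ((j + 4 : ℕ) : ℝ) * r ^ j) := by ring
    _ ≤ |α l (m + 1)| * r ^ 3 * (4 ^ 5 / R ^ 5 * R ^ (j + 5)) := by
        refine mul_le_mul_of_nonneg_left (le_trans ?_ hb) (by positivity)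
        exact mul_le_mul_of_nonneg_right hm (by positivity)
    _ = _ := by ring

theorem norm_higherOrder_term_le {α : ℕ → ℕ → ℝ} (hα : ∀ l l', l + l' < 5 → α l l' = 0) {R r : ℝ}
    (hR : 0 < R) (hr : r ≤ R / 4) {x y : A} (hx : ‖x‖ ≤ r) (hy : ‖y‖ ≤ r) (p : ℕ × ℕ) :
    ‖(α p.1 p.2 * p.2) • (x ^ p.1 * y ^ (p.2 - 1))‖
      ≤ 4 ^ 5 / R ^ 5 * r ^ 4 * (|α p.1 p.2| * R ^ (p.1 + p.2)) := by
  refine le_trans ?_ (term_bound hα hR ((norm_nonneg _).trans hx) hr p)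
  rw [norm_smul, Real.norm_eq_abs]
  exact mul_le_mul_of_nonneg_left (norm_pow_mul_pow_le hx hy _ _) (abs_nonneg _)

variable [CompleteSpace A]

theorem summable_higherOrder {α : ℕ → ℕ → ℝ} (hα : ∀ l l', l + l' < 5 → α l l' = 0) {R : ℝ}
    (hR : 0 < R) (hc : ConvergesAt α R) {x y : A} (hx : ‖x‖ ≤ R / 4) (hy : ‖y‖ ≤ R / 4) :
    Summable fun p : ℕ × ℕ => (α p.1 p.2 * p.2) • (x ^ p.1 * y ^ (p.2 - 1)) :=
  Summable.of_norm_bounded (Summable.mul_left _ hc)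
    (norm_higherOrder_term_le hα hR le_rfl hx hy)

omit [CompleteSpace A] in
theorem norm_higherOrder_le {α : ℕ → ℕ → ℝ} (hα : ∀ l l', l + l' < 5 → α l l' = 0) {R r : ℝ}
    (hR : 0 < R) (hc : ConvergesAt α R) (hr : r ≤ R / 4) {x y : A} (hx : ‖x‖ ≤ r) (hy : ‖y‖ ≤ r) :
    ‖higherOrder α x y‖ ≤ hoConst α R * r ^ 4 := by
  refine (tsum_of_norm_bounded (HasSum.mul_left _ hc.hasSum)
    (norm_higherOrder_term_le hα hR hr hx hy)).trans_eq ?_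
  rw [hoConst]; ring

theorem norm_higherOrder_sub_le {α : ℕ → ℕ → ℝ} (hα : ∀ l l', l + l' < 5 → α l l' = 0) {R r δ : ℝ}
    (hR : 0 < R) (hc : ConvergesAt α R) (hr : r ≤ R / 4) {x y x' y' : A} (hx : ‖x‖ ≤ r)
    (hx' : ‖x'‖ ≤ r) (hy : ‖y‖ ≤ r) (hy' : ‖y'‖ ≤ r) (hxδ : ‖x - x'‖ ≤ δ) (hyδ : ‖y - y'‖ ≤ δ) :
    ‖higherOrder α x y - higherOrder α x' y'‖ ≤ hoConst α R * r ^ 3 * δ := by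
  have hr0 : 0 ≤ r := (norm_nonneg _).trans hx
  have hδ : 0 ≤ δ := (norm_nonneg _).trans hxδ
  rw [higherOrder, higherOrder, ← (summable_higherOrder hα hR hc (hx.trans hr)
    (hy.trans hr)).tsum_sub (summable_higherOrder hα hR hc (hx'.trans hr) (hy'.trans hr))]
  refine (tsum_of_norm_bounded (HasSum.mul_left (4 ^ 5 / R ^ 5 * r ^ 3 * δ) hc.hasSum)
    fun p => ?_).trans_eq (by rw [hoConst]; ring)
  rw [← smul_sub, norm_smul, Real.norm_eq_abs]
  calc _ ≤ |α p.1 p.2 * p.2| *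
          ((p.1 + (p.2 - 1) : ℕ) * r ^ (p.1 + (p.2 - 1) - 1) * δ) :=
        mul_le_mul_of_nonneg_left (norm_monomial_sub_le hx hx' hy hy' hxδ hyδ _ _) (abs_nonneg _)
    _ = |α p.1 p.2 * p.2| *
          ((p.1 + (p.2 - 1) : ℕ) * r ^ (p.1 + (p.2 - 1) - 1)) * δ := by ring
    _ ≤ _ := by
        refine (mul_le_mul_of_nonneg_right (term_lipschitz_bound hα hR hr0 hr p) hδ).trans_eq ?_
        ring

/-- To be applied to evaluation at a character: continuity moves it through the series and
multiplicativity through the monomials. -/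
theorem map_higherOrder {α : ℕ → ℕ → ℝ} (hα : ∀ l l', l + l' < 5 → α l l' = 0) {R : ℝ}
    (hR : 0 < R) (hc : ConvergesAt α R) {x y : A} (hx : ‖x‖ ≤ R / 4) (hy : ‖y‖ ≤ R / 4)
    (φ : A →L[ℝ] ℂ) (hone : φ 1 = 1) (hmul : ∀ x y, φ (x * y) = φ x * φ y) :
    φ (higherOrder α x y) = higherOrder α (φ x) (φ y) := by
  have hpow : ∀ (z : A) (n : ℕ), φ (z ^ n) = φ z ^ n := by
    intro z n
    induction n with
    | zero => rw [pow_zero, pow_zero, hone]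
    | succ n ih => rw [pow_succ, pow_succ, hmul, ih]
  rw [higherOrder, φ.map_tsum (summable_higherOrder hα hR hc hx hy), higherOrder]
  refine tsum_congr fun p => ?_
  rw [map_smul, hmul, hpow, hpow]

end HigherOrder

theorem hasDerivAt_hamiltonian {α : ℕ → ℕ → ℝ} (hα : ∀ l l', l + l' < 5 → α l l' = 0) {R : ℝ}
    (hR : 0 < R) (hc : ConvergesAt α R) {z w : ℂ} (hz : ‖z‖ < R / 4) (hw : ‖w‖ < R / 4) :
    HasDerivAt (fun w : ℂ => hamiltonian α z w) (2 * z ^ 2 * w + higherOrder α z w) w := by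
  have h1 : HasDerivAt (fun w : ℂ => z ^ 2 * w ^ 2) (2 * z ^ 2 * w) w := by
    have := (hasDerivAt_pow 2 w).const_mul (z ^ 2)
    refine this.congr_deriv ?_
    push_cast; ring
  refine h1.add ?_
  refine hasDerivAt_tsum_of_isPreconnected
    -- The derived series is dominated on the whole ball of radius `R/4` by
    -- `norm_higherOrder_term_le` with `r = R/4`.
    (u := fun p : ℕ × ℕ => 4 ^ 5 / R ^ 5 * (R / 4) ^ 4 * (|α p.1 p.2| * R ^ (p.1 + p.2)))
    (t := Metric.ball 0 (R / 4)) (y₀ := 0)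
    (g' := fun p y => (α p.1 p.2 * p.2) • (z ^ p.1 * y ^ (p.2 - 1)))
    (Summable.mul_left _ hc) Metric.isOpen_ball
    (convex_ball _ _).isPreconnected ?_ ?_ (by simp; positivity) ?_ (by simpa using hw)
  · intro p y _
    have := (hasDerivAt_pow p.2 y).const_mul ((α p.1 p.2 : ℂ) * z ^ p.1)
    refine this.congr_deriv ?_
    rw [Complex.real_smul]; push_cast; ring
  · intro p y hy
    exact norm_higherOrder_term_le hα hR le_rfl hz.le (mem_ball_zero_iff.1 hy).le p
  · refine Summable.of_norm_bounded hc fun p => ?_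
    rw [norm_mul, norm_mul, Complex.norm_real, Real.norm_eq_abs, pow_add, mul_assoc]
    refine mul_le_mul_of_nonneg_left ?_ (abs_nonneg _)
    have hz' : ‖z ^ p.1‖ ≤ R ^ p.1 := norm_pow_le_of_le (by linarith) _
    have hw' : ‖(0 : ℂ) ^ p.2‖ ≤ R ^ p.2 := norm_pow_le_of_le (by simpa using hR.le) _
    exact mul_le_mul hz' hw' (norm_nonneg _) (by positivity)

theorem dbarH_eq {α : ℕ → ℕ → ℝ} (hα : ∀ l l', l + l' < 5 → α l l' = 0) {R : ℝ}
    (hR : 0 < R) (hc : ConvergesAt α R) {z : ℂ} (hz : ‖z‖ < R / 4) :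
    dbarH α z = 2 * z ^ 2 * starRingEnd ℂ z + higherOrder α z (starRingEnd ℂ z) :=
  (hasDerivAt_hamiltonian hα hR hc hz (by rwa [RCLike.norm_conj])).deriv

/-! ### Trigonometric series -/

section TrigSeries

variable {ι V : Type*} [NormedAddCommGroup V] [NormedSpace ℝ V]

/-- The wave `e^{i ℓ(z)}`. -/
noncomputable def wave (ℓ : V →L[ℝ] ℝ) (z : V) : ℂ := Complex.exp (Complex.I * (ℓ z : ℂ))

/-- The series `∑ c_k e^{i ℓ_k(z)}`. -/
noncomputable def trigSeries (c : ι → ℂ) (ℓ : ι → V →L[ℝ] ℝ) (z : V) : ℂ :=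
  ∑' k, c k * wave (ℓ k) z

theorem norm_wave (ℓ : V →L[ℝ] ℝ) (z : V) : ‖wave ℓ z‖ = 1 := by
  rw [wave, mul_comm, Complex.norm_exp_ofReal_mul_I]

theorem hasDerivAt_circle (c : ℂ) (r : ℝ) :
    HasDerivAt (fun r : ℝ => c * Complex.exp (Complex.I * r))
      ((Complex.I * c) * Complex.exp (Complex.I * r)) r := by
  have h1 : HasDerivAt (fun r : ℝ => Complex.I * (r : ℂ)) (Complex.I * 1) r :=
    (Complex.ofRealCLM.hasDerivAt (x := r)).const_mul Complex.I
  have := (h1.cexp).const_mul c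
  refine this.congr_deriv ?_
  ring

theorem iteratedDeriv_circle (c : ℂ) (m : ℕ) :
    iteratedDeriv m (fun r : ℝ => c * Complex.exp (Complex.I * r)) =
      fun r : ℝ => (Complex.I ^ m * c) * Complex.exp (Complex.I * r) := by
  induction m with
  | zero => simp
  | succ m ih =>
    rw [iteratedDeriv_succ, ih]
    funext r
    rw [(hasDerivAt_circle _ r).deriv]
    ring

theorem contDiff_circle (c : ℂ) {m : WithTop ℕ∞} :
    ContDiff ℝ m (fun r : ℝ => c * Complex.exp (Complex.I * r)) :=
  contDiff_const.mul ((contDiff_const.mul Complex.ofRealCLM.contDiff).cexp)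

theorem contDiff_mul_wave (c : ℂ) (ℓ : V →L[ℝ] ℝ) {m : WithTop ℕ∞} :
    ContDiff ℝ m fun z => c * wave ℓ z :=
  (contDiff_circle c).comp ℓ.contDiff

/-- A wave is a function of one real variable composed with a linear form, so its derivatives reduce
to those of `r ↦ c e^{ir}`. -/
theorem iteratedFDeriv_mul_wave (c : ℂ) (ℓ : V →L[ℝ] ℝ) (m : ℕ) (z : V) :
    iteratedFDeriv ℝ m (fun z => c * wave ℓ z) z =
      (iteratedFDeriv ℝ m (fun r : ℝ => c * Complex.exp (Complex.I * r))
        (ℓ z)).compContinuousLinearMap fun _ => ℓ :=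
  ContinuousLinearMap.iteratedFDeriv_comp_right ℓ (contDiff_circle c) z (i := m) (n := m) le_rfl

theorem norm_iteratedFDeriv_mul_wave_le (c : ℂ) (ℓ : V →L[ℝ] ℝ) (m : ℕ) (z : V) :
    ‖iteratedFDeriv ℝ m (fun z => c * wave ℓ z) z‖ ≤ ‖c‖ * ‖ℓ‖ ^ m := by
  rw [iteratedFDeriv_mul_wave]
  refine (ContinuousMultilinearMap.norm_compContinuousLinearMap_le _ _).trans ?_
  rw [norm_iteratedFDeriv_eq_norm_iteratedDeriv, iteratedDeriv_circle, Finset.prod_const,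
    Finset.card_univ, Fintype.card_fin, norm_mul, norm_mul, norm_pow, Complex.norm_I, one_pow,
    one_mul, mul_comm Complex.I, Complex.norm_exp_ofReal_mul_I, mul_one]

theorem iteratedFDeriv_two_mul_wave (c : ℂ) (ℓ : V →L[ℝ] ℝ) (z v : V) :
    iteratedFDeriv ℝ 2 (fun z => c * wave ℓ z) z ![v, v] = -(ℓ v : ℂ) ^ 2 * (c * wave ℓ z) := by
  rw [iteratedFDeriv_mul_wave, ContinuousMultilinearMap.compContinuousLinearMap_apply,
    iteratedFDeriv_apply_eq_iteratedDeriv_mul_prod, iteratedDeriv_circle]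
  simp only [Fin.prod_univ_two, Matrix.cons_val_zero, Matrix.cons_val_one, Complex.real_smul,
    Complex.I_sq, wave]
  push_cast
  ring

variable {c : ι → ℂ} {ℓ : ι → V →L[ℝ] ℝ}

theorem summable_wave_bound (h : Summable fun k => ‖c k‖ * (1 + ‖ℓ k‖) ^ 2) {m : ℕ} (hm : m ≤ 2) :
    Summable fun k => ‖c k‖ * ‖ℓ k‖ ^ m := by
  refine Summable.of_nonneg_of_le (fun k => by positivity) (fun k => ?_) h
  refine mul_le_mul_of_nonneg_left ?_ (norm_nonneg _)
  have h1 : (1 : ℝ) ≤ 1 + ‖ℓ k‖ := by linarith [norm_nonneg (ℓ k)]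
  calc ‖ℓ k‖ ^ m ≤ (1 + ‖ℓ k‖) ^ m := pow_le_pow_left₀ (norm_nonneg _) (by linarith) m
    _ ≤ _ := pow_le_pow_right₀ h1 hm

theorem contDiff_trigSeries (h : Summable fun k => ‖c k‖ * (1 + ‖ℓ k‖) ^ 2) :
    ContDiff ℝ 2 (trigSeries c ℓ) := by
  refine contDiff_tsum (N := 2) (v := fun m k => ‖c k‖ * ‖ℓ k‖ ^ m)
    (fun k => contDiff_mul_wave _ _) (fun m hm => summable_wave_bound h (by exact_mod_cast hm)) ?_
  intro m k z _
  exact norm_iteratedFDeriv_mul_wave_le _ _ _ _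

theorem hasSum_iteratedFDeriv_two_trigSeries
    (h : Summable fun k => ‖c k‖ * (1 + ‖ℓ k‖) ^ 2) (z v : V) :
    HasSum (fun k => -(ℓ k v : ℂ) ^ 2 * (c k * wave (ℓ k) z))
      (iteratedFDeriv ℝ 2 (trigSeries c ℓ) z ![v, v]) := by
  have h1 : iteratedFDeriv ℝ 2 (trigSeries c ℓ) z =
      ∑' k, iteratedFDeriv ℝ 2 (fun z => c k * wave (ℓ k) z) z :=
    iteratedFDeriv_tsum_apply (N := 2) (v := fun m k => ‖c k‖ * ‖ℓ k‖ ^ m)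
      (fun k => contDiff_mul_wave _ _)
      (fun m hm => summable_wave_bound h (by exact_mod_cast hm))
      (fun m k z _ => norm_iteratedFDeriv_mul_wave_le _ _ _ _) (k := 2) le_rfl z
  have h2 : Summable fun k => iteratedFDeriv ℝ 2 (fun z => c k * wave (ℓ k) z) z :=
    Summable.of_norm_bounded (summable_wave_bound h le_rfl)
      fun k => norm_iteratedFDeriv_mul_wave_le _ _ _ _
  have h3 := h2.hasSum.mapL (ContinuousMultilinearMap.apply ℝ (fun _ : Fin 2 => V) ℂ ![v, v])
  rw [← h1] at h3
  refine h3.congr_fun fun k => ?_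
  exact (iteratedFDeriv_two_mul_wave _ _ _ _).symm

end TrigSeries

/-- The linear form `x ↦ ∑ ν_i x_i`. -/
noncomputable def dotForm {d : ℕ} (ν : Fin d → ℝ) : EuclideanSpace ℝ (Fin d) →L[ℝ] ℝ :=
  ∑ i, ν i • EuclideanSpace.proj i

theorem dotForm_apply {d : ℕ} (ν : Fin d → ℝ) (x : EuclideanSpace ℝ (Fin d)) :
    dotForm ν x = ∑ i, ν i * x i := by
  simp [dotForm]

theorem norm_dotForm_le {d : ℕ} (ν : Fin d → ℝ) : ‖dotForm ν‖ ≤ ∑ i, |ν i| := by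
  refine (norm_sum_le _ _).trans (Finset.sum_le_sum fun i _ => ?_)
  rw [norm_smul, Real.norm_eq_abs]
  refine mul_le_of_le_one_right (abs_nonneg _) ?_
  refine ContinuousLinearMap.opNorm_le_bound _ zero_le_one fun x => ?_
  rw [one_mul]
  exact EuclideanSpace.norm_eq x ▸ Real.le_sqrt_of_sq_le
    (Finset.single_le_sum (f := fun i => ‖x i‖ ^ 2) (fun i _ => by positivity) (Finset.mem_univ i))

/-- The Laplacian is the sum of second derivatives along the standard orthonormal basis, each of
which may be taken term by term. -/
theorem hasSum_laplacian_trigSeries {ι : Type*} {d : ℕ} {c : ι → ℂ} {ν : ι → Fin d → ℝ}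
    (h : Summable fun k => ‖c k‖ * (1 + ‖dotForm (ν k)‖) ^ 2) (x : EuclideanSpace ℝ (Fin d)) :
    HasSum (fun k => -((∑ i, ν k i ^ 2 : ℝ) : ℂ) * (c k * wave (dotForm (ν k)) x))
      (Laplacian.laplacian (trigSeries c fun k => dotForm (ν k)) x) := by
  have h1 := InnerProductSpace.laplacian_eq_iteratedFDeriv_orthonormalBasis
    (f := trigSeries c fun k => dotForm (ν k)) (EuclideanSpace.basisFun (Fin d) ℝ)
  rw [h1]
  have h2 := hasSum_sum (s := Finset.univ) fun i (_ : i ∈ Finset.univ) =>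
    hasSum_iteratedFDeriv_two_trigSeries h x (EuclideanSpace.basisFun (Fin d) ℝ i)
  refine h2.congr_fun fun k => ?_
  rw [← Finset.sum_mul]
  congr 1
  push_cast
  rw [← Finset.sum_neg_distrib]
  refine Finset.sum_congr rfl fun i _ => ?_
  rw [dotForm_apply]
  simp [PiLp.single_apply]

/-- A series of waves in time is differentiable term by term. -/
theorem hasDerivAt_tsum_wave {ι : Type*} {c : ι → ℂ} {θ : ι → ℝ}
    (h : Summable fun k => ‖c k‖ * (1 + |θ k|)) (t : ℝ) :
    HasDerivAt (fun t : ℝ => ∑' k, c k * Complex.exp (Complex.I * (θ k * t : ℝ)))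
      (∑' k, Complex.I * θ k * (c k * Complex.exp (Complex.I * (θ k * t : ℝ)))) t := by
  have hn : ∀ k (t : ℝ), ‖Complex.exp (Complex.I * (θ k * t : ℝ))‖ = 1 := fun k t => by
    rw [mul_comm, Complex.norm_exp_ofReal_mul_I]
  refine hasDerivAt_tsum (𝕜 := ℝ) (F := ℂ) (u := fun k => ‖c k‖ * (1 + |θ k|)) (y₀ := 0)
    (g := fun k (t : ℝ) => c k * Complex.exp (Complex.I * (θ k * t : ℝ)))
    (g' := fun k (t : ℝ) => Complex.I * θ k * (c k * Complex.exp (Complex.I * (θ k * t : ℝ)))) h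
    (fun k t => ?_) (fun k t => ?_) ?_ t
  · have h0 : HasDerivAt (fun t : ℝ => θ k * t) (θ k) t := by
      simpa using (hasDerivAt_id t).const_mul (θ k)
    refine (HasDerivAt.scomp t (hasDerivAt_circle (c k) (θ k * t)) h0).congr_deriv ?_
    rw [Complex.real_smul]; ring
  · rw [norm_mul, norm_mul, norm_mul, hn, Complex.norm_I, Complex.norm_real, Real.norm_eq_abs]
    nlinarith [norm_nonneg (c k), abs_nonneg (θ k)]
  · refine Summable.of_norm_bounded h fun k => ?_
    rw [norm_mul, hn]
    nlinarith [norm_nonneg (c k), abs_nonneg (θ k), mul_nonneg (norm_nonneg (c k)) (abs_nonneg (θ k))]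

/-! ### The linearization on the nontrivial resonant modes -/

section Resonances

variable {b d : ℕ} {n : Fin b → Fin d → ℤ}

/-- The spatial frequency `∑ k_j n_j`. -/
def momentum (n : Fin b → Fin d → ℤ) (k : Fin b → ℤ) : Fin d → ℤ := ∑ j, k j • n j

theorem momentum_add (k k' : Fin b → ℤ) : momentum n (k + k') = momentum n k + momentum n k' := by
  simp [momentum, add_smul, Finset.sum_add_distrib]

theorem momentum_sub (k k' : Fin b → ℤ) : momentum n (k - k') = momentum n k - momentum n k' := by
  simp [momentum, sub_smul, Finset.sum_sub_distrib]

theorem momentum_neg (k : Fin b → ℤ) : momentum n (-k) = -momentum n k := by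
  simp [momentum]

@[simp] theorem momentum_basisVec (j : Fin b) : momentum n (basisVec j) = n j := by
  simp [momentum, basisVec, Pi.single_apply]

theorem cast_momentum (k : Fin b → ℤ) :
    (fun i => ((momentum n k i : ℤ) : ℝ)) = ∑ j, (k j : ℝ) • realVec n j := by
  ext i; simp [momentum, realVec, Finset.sum_apply]

theorem sqLen_nonneg (v : Fin d → ℤ) : 0 ≤ sqLen v := Finset.sum_nonneg fun _ _ => sq_nonneg _

theorem sqLen_eq_zero {v : Fin d → ℤ} (h : sqLen v = 0) : v = 0 := by
  have := (Finset.sum_eq_zero_iff_of_nonneg fun i _ => sq_nonneg (v i)).1 h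
  ext i
  exact pow_eq_zero_iff (two_ne_zero) |>.1 (this i (Finset.mem_univ i))

theorem sqLen_add (v v' : Fin d → ℤ) : sqLen (v + v') = sqLen v + 2 * (v ⬝ᵥ v') + sqLen v' := by
  simp only [sqLen, dotProduct, Pi.add_apply, Finset.mul_sum, ← Finset.sum_add_distrib]
  exact Finset.sum_congr rfl fun i _ => by ring

theorem sqLen_sub (v v' : Fin d → ℤ) : sqLen (v - v') = sqLen v - 2 * (v ⬝ᵥ v') + sqLen v' := by
  simp only [sqLen, dotProduct, Pi.sub_apply, Finset.mul_sum, ← Finset.sum_add_distrib,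
    ← Finset.sum_sub_distrib]
  exact Finset.sum_congr rfl fun i _ => by ring

theorem momentum_eq_zero (hn : LinearIndependent ℝ (realVec n)) {k : Fin b → ℤ}
    (h : momentum n k = 0) : k = 0 := by
  have h0 : ∑ j, (k j : ℝ) • realVec n j = 0 := by
    rw [← cast_momentum, h]; ext; simp
  ext j
  exact_mod_cast Fintype.linearIndependent_iff.1 hn _ h0 j

theorem basisVec_ne_zero (j : Fin b) : basisVec j ≠ 0 := by
  simp [basisVec]

theorem basisVec_injective : Function.Injective (basisVec (b := b)) := by
  intro i j h
  by_contra hij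
  have := congrFun h i
  rw [basisVec, basisVec, Pi.single_eq_same, Pi.single_eq_of_ne hij] at this
  exact one_ne_zero this

theorem sum_basisVec (j : Fin b) : ∑ i, basisVec j i = 1 := by
  simp [basisVec]

theorem sqLen_ne_zero (hn : LinearIndependent ℝ (realVec n)) (j : Fin b) : sqLen (n j) ≠ 0 := by
  intro h
  refine basisVec_ne_zero j (momentum_eq_zero hn ?_)
  rw [momentum_basisVec, sqLen_eq_zero h]

theorem basisVec_mem (j : Fin b) : basisVec j ∈ resonantModes n := by
  refine ⟨sum_basisVec j, ?_⟩
  change _ = sqLen (momentum n (basisVec j))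
  rw [momentum_basisVec]
  simp [basisVec, Pi.single_apply]

theorem mem_resonantModes_iff {k : Fin b → ℤ} : k ∈ resonantModes n ↔
    ∑ j, k j = 1 ∧ ∑ j, k j * sqLen (n j) = sqLen (momentum n k) := Iff.rfl

/-- Resonant modes lie on a strictly convex quadric, so that no tangential mode is the midpoint of
two other resonant modes. -/
theorem eq_basisVec_of_midpoint (hn : LinearIndependent ℝ (realVec n)) {k k' : Fin b → ℤ}
    (hk : k ∈ resonantModes n) (hk' : k' ∈ resonantModes n) {i : Fin b}
    (h : basisVec i + basisVec i - k = k') : k = basisVec i := by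
  have h1 : momentum n k' = n i + n i - momentum n k := by
    rw [← h, momentum_sub, momentum_add, momentum_basisVec]
  have h2 := (mem_resonantModes_iff.1 hk).2
  have h3 := (mem_resonantModes_iff.1 hk').2
  have h4 := (mem_resonantModes_iff.1 (basisVec_mem (n := n) i)).2
  rw [momentum_basisVec] at h4
  have h5 : ∑ j, k' j * sqLen (n j) = 2 * sqLen (n i) - ∑ j, k j * sqLen (n j) := by
    rw [← h, ← h4, Finset.mul_sum, ← Finset.sum_sub_distrib]
    refine Finset.sum_congr rfl fun j _ => ?_
    simp only [Pi.sub_apply, Pi.add_apply]; ring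
  have h6 : n i + n i - momentum n k = n i - (momentum n k - n i) := by abel
  have h7 : momentum n k = n i + (momentum n k - n i) := by abel
  have e1 : sqLen (momentum n k') = sqLen (n i - (momentum n k - n i)) := by rw [h1, h6]
  have e2 : sqLen (momentum n k) = sqLen (n i + (momentum n k - n i)) := by rw [← h7]
  -- Parallelogram law: with `v = ∑ k_j n_j - n_i`, the sum `|n_i + v|² + |n_i - v|²` equals
  -- `2|n_i|² + 2|v|²`, whereas resonance of both modes makes it `2|n_i|²`.
  rw [sqLen_sub] at e1
  rw [sqLen_add] at e2
  have h8 : sqLen (momentum n k - n i) = 0 := by linarith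
  have h9 : momentum n (k - basisVec i) = 0 := by
    rw [momentum_sub, momentum_basisVec]; exact sqLen_eq_zero h8
  exact sub_eq_zero.1 (momentum_eq_zero hn h9)

theorem ne_basisVec_of_mem {k : Fin b → ℤ} (hk : k ∈ resonantModes₂ n) (i : Fin b) :
    k ≠ basisVec i := fun h => hk.2 ⟨i, h.symm⟩

/-- A resonant mode `k` with `2k = e_i + e_j` is trivial. -/
theorem not_two_mul_eq {k : Fin b → ℤ} (hk : k ∈ resonantModes₂ n) (i j : Fin b) :
    basisVec i + basisVec j - k ≠ k := by
  intro h
  have h1 : ∀ l, basisVec i l + basisVec j l = 2 * k l := fun l => by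
    have := congrFun h l
    simp only [Pi.sub_apply, Pi.add_apply] at this
    linarith
  by_cases hij : i = j
  · subst hij
    refine ne_basisVec_of_mem hk i (funext fun l => ?_)
    have := h1 l
    linarith
  · have := h1 i
    rw [basisVec, basisVec, Pi.single_eq_same, Pi.single_eq_of_ne hij] at this
    omega

/-! ### Nondegeneracy of the linearized resonant equations -/

open MvPolynomial in
/-- The linearization of the equations for the nontrivial resonant modes at the tangential torus,
as a polynomial in the amplitudes. -/
noncomputable def linMatrix (n : Fin b → Fin d → ℤ) :
    Matrix (resonantModes₂ n) (resonantModes₂ n) (MvPolynomial (Fin b) ℤ) :=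
  fun k k' =>
    (if k = k' then ∑ j, C (k.1 j * sqLen (n j)) * (2 * X j ^ 2 - 4 * ∑ l, X l ^ 2) else 0) +
    C (sqLen (momentum n k.1)) *
      (4 * (∑ p : Fin b × Fin b with k'.1 + basisVec p.1 - basisVec p.2 = k.1, X p.1 * X p.2)
        + 2 * ∑ p : Fin b × Fin b with basisVec p.1 + basisVec p.2 - k'.1 = k.1, X p.1 * X p.2)

/-- A nonzero integer vector is a nonzero multiple of one with an odd entry. -/
theorem exists_eq_mul_odd {v : Fin b → ℤ} (hv : v ≠ 0) :
    ∃ (g : ℤ) (m : Fin b → ℤ), g ≠ 0 ∧ (∀ j, v j = g * m j) ∧ ∃ j, (m j : ZMod 2) ≠ 0 := by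
  obtain ⟨j₀, hj₀⟩ := Function.ne_iff.1 hv
  obtain ⟨m, hm, hgcd⟩ := Finset.extract_gcd v ⟨j₀, Finset.mem_univ j₀⟩
  refine ⟨Finset.univ.gcd v, m, ?_, fun j => hm j (Finset.mem_univ j), ?_⟩
  · intro h
    exact hj₀ (by rw [hm j₀ (Finset.mem_univ j₀), h, zero_mul]; rfl)
  · by_contra! h
    have : (2 : ℤ) ∣ Finset.univ.gcd m :=
      Finset.dvd_gcd fun j _ => (ZMod.intCast_zmod_eq_zero_iff_dvd (m j) 2).1 (h j)
    rw [hgcd] at this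
    omega

open MvPolynomial in
/-- The off-diagonal contributions `e_i + e_j - k` occur in pairs. -/
theorem sum_pairs_mod_two (hn : LinearIndependent ℝ (realVec n)) {k k' : Fin b → ℤ}
    (hk : k ∈ resonantModes n) (hk' : k' ∈ resonantModes₂ n) :
    ∑ p : Fin b × Fin b with basisVec p.1 + basisVec p.2 - k' = k,
      (X p.1 * X p.2 : MvPolynomial (Fin b) (ZMod 2)) = 0 := by
  refine Finset.sum_involution (fun p _ => p.swap) ?_ ?_ ?_ ?_
  · intro p _
    rw [Prod.fst_swap, Prod.snd_swap, mul_comm (X p.2), CharTwo.add_self_eq_zero]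
  · intro p hp _ hswap
    -- A pair fixed by the swap would make the tangential mode `e_i` the midpoint of two resonant
    -- modes.
    have h12 : p.2 = p.1 := congrArg Prod.fst hswap
    have hp' := (Finset.mem_filter.1 hp).2
    rw [h12] at hp'
    exact ne_basisVec_of_mem hk' p.1 (eq_basisVec_of_midpoint hn hk'.1 hk hp')
  · intro p hp
    rw [Finset.mem_filter] at hp ⊢
    exact ⟨Finset.mem_univ _, by rw [Prod.fst_swap, Prod.snd_swap, add_comm (basisVec p.2)]; exact hp.2⟩
  · intro p _; exact p.swap_swap

open MvPolynomial in
/-- The linearization is always nondegenerate: after division of each row by its content, it is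
diagonal modulo `2`. -/
theorem det_linMatrix_ne_zero [Fintype (resonantModes₂ n)] [DecidableEq (resonantModes₂ n)]
    (hn : LinearIndependent ℝ (realVec n)) : (linMatrix n).det ≠ 0 := by
  have hv : ∀ k : resonantModes₂ n, (fun j => k.1 j * sqLen (n j)) ≠ 0 := by
    intro k h
    have h0 : k.1 = 0 := funext fun j =>
      (mul_eq_zero.1 (congrFun h j)).resolve_right (sqLen_ne_zero hn j)
    have := k.2.1.1
    rw [h0] at this
    simp at this
  choose g m hg hgm hodd using fun k => exists_eq_mul_odd (hv k)
  -- The resonance relation shows that the content `g k` of the row `k_j |n_j|²` also divides `|∑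
  -- k_j n_j|²`, hence all entries of the row.
  have hS : ∀ k : resonantModes₂ n, sqLen (momentum n k.1) = g k * ∑ j, m k j := by
    intro k
    rw [← (mem_resonantModes_iff.1 k.2.1).2, Finset.mul_sum]
    exact Finset.sum_congr rfl fun j _ => hgm k j
  let M : Matrix (resonantModes₂ n) (resonantModes₂ n) (MvPolynomial (Fin b) ℤ) := fun k k' =>
    if k = k' then ∑ j, C (m k j) * X j ^ 2 else
      C (∑ j, m k j) *
        (2 * (∑ p : Fin b × Fin b with k'.1 + basisVec p.1 - basisVec p.2 = k.1, X p.1 * X p.2)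
          + ∑ p : Fin b × Fin b with basisVec p.1 + basisVec p.2 - k'.1 = k.1, X p.1 * X p.2)
  -- On the diagonal, the contribution `4 ∑ X_l²` of the pairs `i = j` cancels the term `-4 ∑ X_l²`
  -- of the frequency shift, again by the resonance relation. What remains is `2 ∑ k_j |n_j|² X_j²`.
  have hfac : linMatrix n = Matrix.diagonal (fun k => C (2 * g k)) * M := by
    ext1 k k'
    rw [Matrix.diagonal_mul]
    by_cases h : k = k'
    · subst h
      have e1 : ∑ p : Fin b × Fin b with k.1 + basisVec p.1 - basisVec p.2 = k.1,
          (X p.1 * X p.2 : MvPolynomial (Fin b) ℤ) = ∑ j, X j ^ 2 := by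
        rw [Finset.sum_filter, Fintype.sum_prod_type]
        refine Finset.sum_congr rfl fun i _ => ?_
        rw [Finset.sum_eq_single i]
        · rw [if_pos (by simp), sq]
        · intro j _ hj
          refine if_neg fun h => hj ?_
          have h' : basisVec i = basisVec j := by
            have := sub_eq_iff_eq_add.1 h
            exact add_left_cancel this
          exact (basisVec_injective h').symm
        · simp
      have e2 : ∑ p : Fin b × Fin b with basisVec p.1 + basisVec p.2 - k.1 = k.1,
          (X p.1 * X p.2 : MvPolynomial (Fin b) ℤ) = 0 := by
        rw [Finset.filter_false_of_mem fun p _ => not_two_mul_eq k.2 p.1 p.2, Finset.sum_empty]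
      simp only [linMatrix, M, if_true, e1, e2, hS]
      have e3 : ∀ Y : MvPolynomial (Fin b) ℤ,
          ∑ j, C (k.1 j * sqLen (n j)) * (2 * X j ^ 2 - 4 * Y) =
          2 * C (g k) * ∑ j, C (m k j) * X j ^ 2 - 4 * C (g k) * (∑ j, C (m k j)) * Y := by
        intro Y
        rw [Finset.mul_sum, Finset.mul_sum, Finset.sum_mul, ← Finset.sum_sub_distrib]
        refine Finset.sum_congr rfl fun j _ => ?_
        rw [hgm k j, map_mul]; ring
      have e4 : (C 2 : MvPolynomial (Fin b) ℤ) = 2 := rfl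
      rw [e3, map_mul, map_mul, map_sum, e4]
      ring
    · simp only [linMatrix, M, if_neg h, hS, zero_add]
      have e4 : (C 2 : MvPolynomial (Fin b) ℤ) = 2 := rfl
      rw [map_mul, map_mul, e4]
      ring
  -- Modulo `2`, the off-diagonal entries vanish: one part carries a factor `2` and the other
  -- cancels in pairs.
  have hM : (MvPolynomial.map (Int.castRingHom (ZMod 2))).mapMatrix M =
      Matrix.diagonal fun k => ∑ j, C (m k j : ZMod 2) * X j ^ 2 := by
    ext1 k k'
    rw [RingHom.mapMatrix_apply, Matrix.map_apply]
    by_cases h : k = k'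
    · subst h
      simp [M]
    · rw [Matrix.diagonal_apply_ne _ h]
      simp only [M, if_neg h, map_mul, map_add, map_sum, map_X]
      have h20 : (2 : MvPolynomial (Fin b) (ZMod 2)) = 0 := CharTwo.two_eq_zero
      rw [sum_pairs_mod_two hn k.2.1 k'.2, map_ofNat, h20, zero_mul, zero_add, mul_zero]
  have hdetM : M.det ≠ 0 := by
    intro h
    have h1 := (MvPolynomial.map (Int.castRingHom (ZMod 2))).map_det M
    rw [hM, h, map_zero, Matrix.det_diagonal] at h1
    obtain ⟨k, -, hk⟩ := Finset.prod_eq_zero_iff.1 h1.symm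
    obtain ⟨j, hj⟩ := hodd k
    apply hj
    -- The coefficient of `X_j²` in the `k`-th diagonal entry is the odd number `m k j`.
    have h2 := congrArg (coeff (Finsupp.single j 2)) hk
    rw [coeff_sum, coeff_zero, Finset.sum_eq_single j] at h2
    · rwa [coeff_C_mul, coeff_X_pow, if_pos rfl, mul_one] at h2
    · intro i _ hi
      rw [coeff_C_mul, coeff_X_pow, if_neg, mul_zero]
      intro h
      exact hi ((Finsupp.single_left_inj two_ne_zero).1 h)
    · simp
  rw [hfac, Matrix.det_mul, Matrix.det_diagonal]
  refine mul_ne_zero (Finset.prod_ne_zero_iff.2 fun k _ => ?_) hdetM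
  rw [Ne, C_eq_zero]
  exact mul_ne_zero two_ne_zero (hg k)

end Resonances

/-! ### Sublevel sets of polynomials -/

section Sublevel

open MeasureTheory Pointwise

/-- Sublevel sets of a polynomial in one variable, in terms of the leading coefficient. -/
theorem volume_polynomial_sublevel_le (q : Polynomial ℝ) {δ η : ℝ} (hδ : 0 < δ) (hδη : δ ≤ η)
    (hη : η ≤ |q.leadingCoeff|) :
    volume {x : ℝ | |q.eval x| < δ} ≤
      ENNReal.ofReal (2 * q.natDegree * (δ / η) ^ (1 / ((q.natDegree : ℝ) + 1))) := by
  set m := q.natDegree with hm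
  -- At distance at least `t` from the real parts of all complex roots one has `|q| ≥ η t^m ≥ η
  -- t^{m+1} = δ`. The exponent `m + 1` instead of `m` covers constant polynomials as well.
  set t : ℝ := (δ / η) ^ (1 / ((m : ℝ) + 1)) with ht
  have hη0 : 0 < η := hδ.trans_le hδη
  have ht0 : 0 ≤ t := by positivity
  have ht1 : t ≤ 1 := Real.rpow_le_one (by positivity) ((div_le_one hη0).2 hδη) (by positivity)
  have htm : η * t ^ (m + 1) = δ := by
    rw [ht, ← Real.rpow_natCast, ← Real.rpow_mul (by positivity)]
    have : 1 / ((m : ℝ) + 1) * ((m + 1 : ℕ) : ℝ) = 1 := by push_cast; field_simp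
    rw [this, Real.rpow_one]; field_simp
  let Q : Polynomial ℂ := q.map (algebraMap ℝ ℂ)
  have hsplit : Q.Splits := IsAlgClosed.splits Q
  have hcard : Q.roots.card = m := by
    rw [← hsplit.natDegree_eq_card_roots, Polynomial.natDegree_map]
  have heval : ∀ x : ℝ, |q.eval x| = |q.leadingCoeff| * (Q.roots.map fun z => ‖(x : ℂ) - z‖).prod := by
    intro x
    have h1 := hsplit.eval_eq_prod_roots (x : ℂ)
    have h2 : Q.eval (x : ℂ) = ((q.eval x : ℝ) : ℂ) := Polynomial.eval_map_apply (algebraMap ℝ ℂ) x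
    have h3 : Q.leadingCoeff = (q.leadingCoeff : ℂ) :=
      Polynomial.leadingCoeff_map (algebraMap ℝ ℂ)
    rw [h2, h3] at h1
    have h4 := congrArg norm h1
    have h5 : ‖(Multiset.map (fun z => (x : ℂ) - z) Q.roots).prod‖ =
        (Multiset.map (fun z => ‖(x : ℂ) - z‖) Q.roots).prod :=
      (Multiset.prod_hom' Q.roots (normHom : ℂ →*₀ ℝ) _).symm
    rw [norm_mul, Complex.norm_real, Complex.norm_real, Real.norm_eq_abs, Real.norm_eq_abs,
      h5] at h4
    exact h4
  have hsub : {x : ℝ | |q.eval x| < δ} ⊆ ⋃ z ∈ Q.roots.toFinset, Metric.ball z.re t := by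
    intro x hx
    by_contra hcon
    simp only [Set.mem_iUnion, not_exists, Metric.mem_ball, not_lt, Multiset.mem_toFinset] at hcon
    refine absurd (Set.mem_ofPred.1 hx) (not_lt.2 ?_)
    rw [heval x, ← htm]
    have h1 : t ^ m ≤ (Q.roots.map fun z => ‖(x : ℂ) - z‖).prod := by
      rw [← hcard, ← Multiset.prod_replicate, ← Multiset.map_const']
      refine Multiset.prod_map_le_prod_map₀ _ _ (fun z _ => ht0) fun z hz => ?_
      refine (hcon z hz).trans ?_
      rw [Real.dist_eq]
      simpa using Complex.abs_re_le_norm ((x : ℂ) - z)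
    calc η * t ^ (m + 1) ≤ η * t ^ m := by
          refine mul_le_mul_of_nonneg_left ?_ hη0.le
          rw [pow_succ]
          exact mul_le_of_le_one_right (by positivity) ht1
      _ ≤ _ := mul_le_mul hη h1 (by positivity) (abs_nonneg _)
  refine (measure_mono hsub).trans ((measure_biUnion_finset_le _ _).trans ?_)
  simp only [Real.volume_ball, Finset.sum_const, nsmul_eq_mul]
  have h5 : ((Q.roots.toFinset.card : ℕ) : ENNReal) ≤ (m : ENNReal) := by
    exact_mod_cast hcard ▸ Multiset.toFinset_card_le Q.roots
  calc _ ≤ (m : ENNReal) * ENNReal.ofReal (2 * t) := by gcongr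
    _ = ENNReal.ofReal (2 * m * t) := by
        rw [← ENNReal.ofReal_natCast, ← ENNReal.ofReal_mul (by positivity)]
        congr 1; ring

theorem measurable_eval {b : ℕ} (p : MvPolynomial (Fin b) ℝ) :
    Measurable fun y : Fin b → ℝ => MvPolynomial.eval y p :=
  (MvPolynomial.continuous_eval p).measurable

theorem volume_unit_box (b : ℕ) : volume (Set.Icc (1 : Fin b → ℝ) 2) = 1 := by
  rw [Real.volume_Icc_pi]
  norm_num

/-- A nonzero polynomial is small on a small part of the box `[1,2]^b` only. -/
theorem exists_volume_sublevel_le {b : ℕ} (p : MvPolynomial (Fin b) ℝ) (hp : p ≠ 0) :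
    ∃ C c : ℝ, 0 < C ∧ 0 < c ∧ ∀ δ : ℝ, 0 < δ → δ ≤ 1 →
      volume {y | y ∈ Set.Icc (1 : Fin b → ℝ) 2 ∧ |MvPolynomial.eval y p| < δ}
        ≤ ENNReal.ofReal (C * δ ^ c) := by
  induction b with
  | zero =>
    obtain ⟨r, rfl⟩ := MvPolynomial.C_surjective (Fin 0) p
    have hr : r ≠ 0 := fun h => hp (by rw [h, map_zero])
    refine ⟨1 / |r|, 1, by positivity, one_pos, fun δ hδ _ => ?_⟩
    rcases le_or_gt δ |r| with h | h
    · have : {y | y ∈ Set.Icc (1 : Fin 0 → ℝ) 2 ∧ |MvPolynomial.eval y (MvPolynomial.C r)| < δ} = ∅ :=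
        Set.eq_empty_of_forall_notMem fun y hy => by
          have := hy.2
          rw [MvPolynomial.eval_C] at this
          linarith
      rw [this, measure_empty]; exact zero_le
    · refine (measure_mono (t := Set.Icc (1 : Fin 0 → ℝ) 2) fun y hy => hy.1).trans ?_
      rw [volume_unit_box, Real.rpow_one, ← ENNReal.ofReal_one]
      refine ENNReal.ofReal_le_ofReal ?_
      rw [one_div, inv_mul_eq_div, one_le_div (by positivity)]
      exact h.le
  | succ b ih =>
    -- The polynomial is viewed in its first variable; the induction hypothesis controls the set
    -- where its leading coefficient is small.
    set P := MvPolynomial.finSuccEquiv ℝ b p with hP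
    have hP0 : P ≠ 0 := fun h => hp ((MvPolynomial.finSuccEquiv ℝ b).injective (by rw [map_zero]; exact h))
    obtain ⟨C, c, hC, hc, hlead⟩ := ih P.leadingCoeff (Polynomial.leadingCoeff_ne_zero.2 hP0)
    set m := P.natDegree with hm
    refine ⟨C + (2 * m + 1), min (c / 2) (1 / 2 * (1 / ((m : ℝ) + 1))), by positivity,
      by positivity, fun δ hδ hδ1 => ?_⟩
    -- The threshold for the leading coefficient is chosen so that `δ / η = η`.
    set η : ℝ := δ ^ (1 / 2 : ℝ) with hη
    have hη0 : 0 < η := by positivity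
    have hη1 : η ≤ 1 := Real.rpow_le_one hδ.le hδ1 (by norm_num)
    have hδη : δ / η = η := by
      rw [div_eq_iff hη0.ne', hη, ← Real.rpow_add hδ]; norm_num
    have hδη' : δ ≤ η := by
      rw [(div_eq_iff hη0.ne').1 hδη]; exact mul_le_of_le_one_right hη0.le hη1
    let B : Set (Fin b → ℝ) := {y | y ∈ Set.Icc 1 2 ∧ |MvPolynomial.eval y P.leadingCoeff| < η}
    let S : Set (ℝ × (Fin b → ℝ)) := {z | z.1 ∈ Set.Icc 1 2 ∧ z.2 ∈ Set.Icc 1 2 ∧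
      η ≤ |MvPolynomial.eval z.2 P.leadingCoeff| ∧
      |MvPolynomial.eval (Fin.cons z.1 z.2 : Fin (b + 1) → ℝ) p| < δ}
    have hcons : Measurable fun z : ℝ × (Fin b → ℝ) => (Fin.cons z.1 z.2 : Fin (b + 1) → ℝ) := by
      refine measurable_pi_iff.2 fun i => ?_
      refine Fin.cases ?_ (fun i => ?_) i
      · simpa using measurable_fst
      · simpa using! (measurable_pi_apply i).comp measurable_snd
    have hSm : MeasurableSet S := by
      refine (measurable_fst measurableSet_Icc).inter ((measurable_snd measurableSet_Icc).inter
        (MeasurableSet.inter ?_ ?_))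
      · exact measurableSet_le measurable_const ((measurable_eval _).comp measurable_snd).abs
      · exact measurableSet_lt ((measurable_eval _).comp hcons).abs measurable_const
    -- By Fubini it is enough to bound the fibres in the first variable, on which the leading
    -- coefficient is at least `η`.
    have hSvol : volume S ≤ ENNReal.ofReal (2 * m * η ^ (1 / ((m : ℝ) + 1))) := by
      rw [show (volume : Measure (ℝ × (Fin b → ℝ))) = volume.prod volume from rfl,
        Measure.prod_apply_symm hSm]
      have hfib : ∀ y : Fin b → ℝ, volume ((fun x : ℝ => (x, y)) ⁻¹' S) ≤
          (Set.Icc (1 : Fin b → ℝ) 2).indicator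
            (fun _ => ENNReal.ofReal (2 * m * η ^ (1 / ((m : ℝ) + 1)))) y := by
        intro y
        by_cases hy : y ∈ Set.Icc (1 : Fin b → ℝ) 2 ∧ η ≤ |MvPolynomial.eval y P.leadingCoeff|
        · rw [Set.indicator_of_mem hy.1]
          set q := P.map (MvPolynomial.eval y) with hq
          have hne : MvPolynomial.eval y P.leadingCoeff ≠ 0 := by
            intro h; rw [h, abs_zero] at hy; linarith [hy.2]
          have hdeg : q.natDegree = m := Polynomial.natDegree_map_of_leadingCoeff_ne_zero _ hne
          have hlc : q.leadingCoeff = MvPolynomial.eval y P.leadingCoeff :=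
            Polynomial.leadingCoeff_map_of_leadingCoeff_ne_zero _ hne
          have h1 := volume_polynomial_sublevel_le q hδ hδη' (by rw [hlc]; exact hy.2)
          rw [hdeg, hδη] at h1
          refine (measure_mono fun x hx => ?_).trans h1
          have := hx.2.2.2
          rwa [MvPolynomial.eval_eq_eval_mv_eval'] at this
        · have : (fun x : ℝ => (x, y)) ⁻¹' S = ∅ :=
            Set.eq_empty_of_forall_notMem fun x hx => hy ⟨hx.2.1, hx.2.2.1⟩
          rw [this, measure_empty]; exact zero_le
      refine (lintegral_mono hfib).trans ?_
      rw [lintegral_indicator measurableSet_Icc, lintegral_const, Measure.restrict_apply_univ,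
        volume_unit_box, mul_one]
    have hmp := volume_preserving_piFinSuccAbove (fun _ : Fin (b + 1) => ℝ) 0
    have hsub : {y | y ∈ Set.Icc (1 : Fin (b + 1) → ℝ) 2 ∧ |MvPolynomial.eval y p| < δ} ⊆
        MeasurableEquiv.piFinSuccAbove (fun _ : Fin (b + 1) => ℝ) 0 ⁻¹'
          (S ∪ Set.Icc 1 2 ×ˢ B) := by
      intro y hy
      have hz : MeasurableEquiv.piFinSuccAbove (fun _ : Fin (b + 1) => ℝ) 0 y = (y 0, Fin.tail y) := rfl
      rw [Set.mem_preimage, hz]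
      have h0 : y 0 ∈ Set.Icc (1 : ℝ) 2 := ⟨hy.1.1 0, hy.1.2 0⟩
      have h1 : Fin.tail y ∈ Set.Icc (1 : Fin b → ℝ) 2 :=
        ⟨fun i => hy.1.1 i.succ, fun i => hy.1.2 i.succ⟩
      by_cases h2 : η ≤ |MvPolynomial.eval (Fin.tail y) P.leadingCoeff|
      · exact Or.inl ⟨h0, h1, h2, by rw [Fin.cons_self_tail]; exact hy.2⟩
      · exact Or.inr ⟨h0, h1, not_le.1 h2⟩
    refine (measure_mono hsub).trans ?_
    rw [hmp.measure_preimage_equiv]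
    refine (measure_union_le _ _).trans ?_
    have hprod : volume ((Set.Icc 1 2 : Set ℝ) ×ˢ B) ≤ ENNReal.ofReal (C * η ^ c) := by
      rw [show (volume : Measure (ℝ × (Fin b → ℝ))) = volume.prod volume from rfl,
        Measure.prod_prod, Real.volume_Icc]
      norm_num
      exact hlead η hη0 hη1
    refine (add_le_add hSvol hprod).trans ?_
    rw [← ENNReal.ofReal_add (by positivity) (by positivity)]
    refine ENNReal.ofReal_le_ofReal ?_
    have e1 : η ^ (1 / ((m : ℝ) + 1)) ≤ δ ^ min (c / 2) (1 / 2 * (1 / ((m : ℝ) + 1))) := by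
      rw [hη, ← Real.rpow_mul hδ.le]
      exact Real.rpow_le_rpow_of_exponent_ge hδ hδ1 (min_le_right _ _)
    have e2 : η ^ c ≤ δ ^ min (c / 2) (1 / 2 * (1 / ((m : ℝ) + 1))) := by
      rw [hη, ← Real.rpow_mul hδ.le]
      refine Real.rpow_le_rpow_of_exponent_ge hδ hδ1 ((min_le_left _ _).trans_eq (by ring))
    have e3 : 0 ≤ δ ^ min (c / 2) (1 / 2 * (1 / ((m : ℝ) + 1))) := by positivity
    have hm0 : (0 : ℝ) ≤ m := Nat.cast_nonneg m
    nlinarith [mul_le_mul_of_nonneg_left e1 hm0, mul_le_mul_of_nonneg_left e2 hC.le]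

/-- After rescaling, the amplitudes in `[ε,2ε]^b` where a polynomial is small form a small set. -/
theorem exists_volume_rescaled_sublevel_lt {b : ℕ} (p : MvPolynomial (Fin b) ℝ) (hp : p ≠ 0)
    {e : ℝ} (he : 0 < e) :
    ∃ c ε₀ : ℝ, 0 < c ∧ 0 < ε₀ ∧ ∀ ε : ℝ, 0 < ε → ε < ε₀ →
      MeasurableSet {a | a ∈ Set.Icc (fun _ : Fin b => ε) (fun _ => 2 * ε) ∧
        |MvPolynomial.eval (ε⁻¹ • a) p| < ε ^ e} ∧
      volume {a | a ∈ Set.Icc (fun _ : Fin b => ε) (fun _ => 2 * ε) ∧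
        |MvPolynomial.eval (ε⁻¹ • a) p| < ε ^ e} < ENNReal.ofReal (ε ^ ((b : ℝ) + c)) := by
  obtain ⟨C, c, hC, hc, h⟩ := exists_volume_sublevel_le p hp
  -- The sublevel estimate gives the gain `C ε^{ec} = C ε^{c'} ε^{c'}`. One factor `ε^{c'}` absorbs
  -- `C` and makes the inequality strict.
  set c' := e * c / 2 with hc'
  have hc'0 : 0 < c' := by positivity
  refine ⟨c', min 1 ((1 / C) ^ (1 / c')), hc'0, by positivity, fun ε hε hε0 => ?_⟩
  have hε1 : ε ≤ 1 := (hε0.trans_le (min_le_left _ _)).le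
  have hεC : ε ^ c' < 1 / C := by
    have h1 := Real.rpow_lt_rpow hε.le (hε0.trans_le (min_le_right _ _)) hc'0
    rwa [← Real.rpow_mul (by positivity), one_div_mul_cancel hc'0.ne', Real.rpow_one] at h1
  refine ⟨measurableSet_Icc.inter (measurableSet_lt
    ((measurable_eval p).comp (measurable_const_smul _)).abs measurable_const), ?_⟩
  set B := {y | y ∈ Set.Icc (1 : Fin b → ℝ) 2 ∧ |MvPolynomial.eval y p| < ε ^ e} with hB
  have hsub : {a | a ∈ Set.Icc (fun _ : Fin b => ε) (fun _ => 2 * ε) ∧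
      |MvPolynomial.eval (ε⁻¹ • a) p| < ε ^ e} ⊆ ε • B := by
    intro a ha
    refine Set.mem_smul_set.2 ⟨ε⁻¹ • a, ⟨⟨fun j => ?_, fun j => ?_⟩, ha.2⟩, ?_⟩
    · have := ha.1.1 j
      simp only [Pi.one_apply, Pi.smul_apply, smul_eq_mul, inv_mul_eq_div]
      rwa [le_div_iff₀ hε, one_mul]
    · have := ha.1.2 j
      simp only [Pi.ofNat_apply, Pi.smul_apply, smul_eq_mul, inv_mul_eq_div]
      rwa [div_le_iff₀ hε]
    · rw [smul_smul, mul_inv_cancel₀ hε.ne', one_smul]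
  refine (measure_mono hsub).trans_lt ?_
  -- Rescaling to the unit box contributes the factor `ε^b`.
  rw [Measure.addHaar_smul, Module.finrank_fin_fun, abs_of_pos (pow_pos hε b)]
  refine (mul_le_mul_right (h (ε ^ e) (by positivity)
    (Real.rpow_le_one hε.le hε1 he.le)) _).trans_lt ?_
  rw [← ENNReal.ofReal_mul (by positivity)]
  refine (ENNReal.ofReal_lt_ofReal_iff (by positivity)).2 ?_
  rw [Real.rpow_add hε, Real.rpow_natCast]
  refine mul_lt_mul_of_pos_left ?_ (by positivity)
  have h2 : (ε ^ e) ^ c = ε ^ c' * ε ^ c' := by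
    rw [← Real.rpow_mul hε.le, ← Real.rpow_add hε]; congr 1; rw [hc']; ring
  rw [h2, ← mul_assoc]
  refine mul_lt_of_lt_one_left (by positivity) ?_
  rwa [lt_div_iff₀ hC, mul_comm] at hεC

end Sublevel

/-! ### Ellipticity off the resonant modes -/

section Elliptic

variable {b d : ℕ} {n : Fin b → Fin d → ℤ}

/-- The squared length of the spatial frequency, as a real number. -/
noncomputable def symb (n : Fin b → Fin d → ℤ) (k : Fin b → ℤ) : ℝ := (sqLen (momentum n k) : ℝ)

theorem symb_nonneg (k : Fin b → ℤ) : 0 ≤ symb n k := by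
  rw [symb]; exact_mod_cast sqLen_nonneg _

/-- The symbol `k·ω - |∑ k_j n_j|² - ρ` of the linear operator. -/
noncomputable def divisor (n : Fin b → Fin d → ℤ) (ρ : ℝ) (ω : Fin b → ℝ) (k : Fin b → ℤ) : ℝ :=
  ∑ j, (k j : ℝ) * ω j - symb n k - ρ

/-- By linear independence `k ↦ ∑ k_j n_j` is an injective linear map in finite dimension, hence
bounded below. This ellipticity is what removes the small divisors. -/
theorem exists_sum_sq_le_symb (hn : LinearIndependent ℝ (realVec n)) :
    ∃ c : ℝ, 0 < c ∧ ∀ k : Fin b → ℤ, c * ∑ j, (k j : ℝ) ^ 2 ≤ symb n k := by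
  obtain ⟨K, hK, hanti⟩ := LinearMap.exists_antilipschitzWith
    (Fintype.linearCombination ℝ (realVec n))
    (LinearMap.ker_eq_bot.2 (linearIndependent_iff_injective_fintypeLinearCombination.1 hn))
  have hK' : (0 : ℝ) < K := hK
  -- The factor `b + 1` instead of `b` keeps the constant positive for `b = 0`.
  refine ⟨1 / ((b + 1) * K ^ 2), by positivity, fun k => ?_⟩
  set x : Fin b → ℝ := fun j => (k j : ℝ) with hx
  set y : Fin d → ℝ := Fintype.linearCombination ℝ (realVec n) x with hy
  have h1 : ‖x‖ ≤ K * ‖y‖ := by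
    have := hanti.le_mul_dist x 0
    rwa [map_zero, dist_zero_right, dist_zero_right] at this
  have hyk : y = fun i => ((momentum n k i : ℤ) : ℝ) := (cast_momentum k).symm
  have hS : symb n k = ∑ i, y i ^ 2 := by
    rw [symb, sqLen, hyk]; push_cast; rfl
  have h2 : ‖y‖ ^ 2 ≤ symb n k := by
    have : ‖y‖ ≤ Real.sqrt (∑ i, y i ^ 2) := by
      refine (pi_norm_le_iff_of_nonneg (Real.sqrt_nonneg _)).2 fun i => ?_
      rw [Real.norm_eq_abs, ← Real.sqrt_sq_eq_abs]
      exact Real.sqrt_le_sqrt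
        (Finset.single_le_sum (f := fun i => y i ^ 2) (fun i _ => sq_nonneg _) (Finset.mem_univ i))
    rw [hS]
    calc ‖y‖ ^ 2 ≤ Real.sqrt (∑ i, y i ^ 2) ^ 2 := pow_le_pow_left₀ (norm_nonneg _) this 2
      _ = _ := Real.sq_sqrt (Finset.sum_nonneg fun i _ => sq_nonneg _)
  have h3 : ∑ j, (k j : ℝ) ^ 2 ≤ (b + 1) * ‖x‖ ^ 2 := by
    calc ∑ j, (k j : ℝ) ^ 2 ≤ ∑ _j : Fin b, ‖x‖ ^ 2 := Finset.sum_le_sum fun j _ => by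
          rw [← sq_abs]
          exact pow_le_pow_left₀ (abs_nonneg _) (norm_le_pi_norm x j) 2
      _ = b * ‖x‖ ^ 2 := by simp
      _ ≤ _ := by nlinarith [sq_nonneg ‖x‖]
  rw [one_div, inv_mul_le_iff₀ (by positivity)]
  have h4 : ‖x‖ ^ 2 ≤ K ^ 2 * ‖y‖ ^ 2 := by
    rw [← mul_pow]; exact pow_le_pow_left₀ (norm_nonneg _) h1 2
  calc _ ≤ (b + 1) * ‖x‖ ^ 2 := h3
    _ ≤ (b + 1) * (K ^ 2 * ‖y‖ ^ 2) := mul_le_mul_of_nonneg_left h4 (by positivity)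
    _ ≤ (b + 1) * (K ^ 2 * symb n k) := by gcongr
    _ = _ := by ring

theorem abs_le_sq_cast (z : ℤ) : |(z : ℝ)| ≤ (z : ℝ) ^ 2 := by
  have : |z| ≤ z ^ 2 := by rw [Int.abs_eq_natAbs]; exact Int.natAbs_le_self_sq z
  exact_mod_cast this

/-- Integers satisfy `|k_j| ≤ k_j²`. Consequently a change of `ω` perturbs the divisor by at most a
small multiple of the symbol of the Laplacian. -/
theorem exists_sum_abs_le_symb (hn : LinearIndependent ℝ (realVec n)) :
    ∃ C : ℝ, 0 < C ∧ ∀ k : Fin b → ℤ, ∑ j, |(k j : ℝ)| ≤ C * symb n k := by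
  obtain ⟨c, hc, h⟩ := exists_sum_sq_le_symb hn
  refine ⟨1 / c, by positivity, fun k => ?_⟩
  rw [one_div, ← div_eq_inv_mul, le_div_iff₀ hc, mul_comm]
  exact (mul_le_mul_of_nonneg_left (Finset.sum_le_sum fun j _ => abs_le_sq_cast (k j)) hc.le).trans
    (h k)

theorem finite_symb_le (hn : LinearIndependent ℝ (realVec n)) (T : ℝ) :
    {k : Fin b → ℤ | symb n k ≤ T}.Finite := by
  obtain ⟨C, hC, h⟩ := exists_sum_abs_le_symb hn
  refine (Set.finite_Icc (fun _ : Fin b => -⌈C * T⌉) (fun _ => ⌈C * T⌉)).subset fun k hk => ?_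
  have h1 : ∀ j, |k j| ≤ ⌈C * T⌉ := fun j => by
    have h2 : |(k j : ℝ)| ≤ C * T :=
      (Finset.single_le_sum (f := fun j => |(k j : ℝ)|) (fun _ _ => abs_nonneg _)
        (Finset.mem_univ j)).trans ((h k).trans (mul_le_mul_of_nonneg_left hk hC.le))
    have h3 := h2.trans (Int.le_ceil _)
    exact_mod_cast h3
  exact ⟨fun j => (abs_le.1 (h1 j)).1, fun j => (abs_le.1 (h1 j)).2⟩

theorem exists_pos_le_of_finite {ι : Type*} {F : Set ι} (hF : F.Finite) {f : ι → ℝ}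
    (hf : ∀ i ∈ F, 0 < f i) : ∃ c : ℝ, 0 < c ∧ ∀ i ∈ F, c ≤ f i := by
  rcases F.eq_empty_or_nonempty with h | h
  · exact ⟨1, one_pos, by simp [h]⟩
  · obtain ⟨i, hi, hmin⟩ := Set.exists_min_image F f hF h
    exact ⟨f i, hf i hi, hmin⟩

/-- For Diophantine `ρ`, the linear operator is invertible off the resonant modes. -/
theorem divisor_baseFreq_ne_zero {ρ : ℝ} (hρ : IsDiophantine ρ) {k : Fin b → ℤ}
    (hk : k ∉ resonantModes n) : divisor n ρ (baseFreq n ρ) k ≠ 0 := by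
  intro h0
  -- At the unperturbed frequencies the divisor is `mρ - l` with `m = ∑ k_j - 1` and `l = |∑ k_j
  -- n_j|² - ∑ k_j |n_j|²`; the case `m = l = 0` is exactly resonance.
  have h1 : ((∑ j, k j - 1 : ℤ) : ℝ) * ρ -
      ((sqLen (momentum n k) - ∑ j, k j * sqLen (n j) : ℤ) : ℝ) = 0 := by
    rw [← h0]
    simp only [divisor, baseFreq, symb, mul_add, Finset.sum_add_distrib, ← Finset.sum_mul]
    push_cast; ring
  by_cases hm : ∑ j, k j - 1 = 0
  · rw [hm, Int.cast_zero, zero_mul, zero_sub, neg_eq_zero] at h1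
    have h2 : sqLen (momentum n k) - ∑ j, k j * sqLen (n j) = 0 := by exact_mod_cast h1
    exact hk ⟨by linarith, by show _ = sqLen (momentum n k); linarith⟩
  · obtain ⟨γ, τ, hγ, -, h⟩ := hρ
    have h2 := h _ hm (sqLen (momentum n k) - ∑ j, k j * sqLen (n j))
    rw [h1, abs_zero] at h2
    have h3 : (0 : ℝ) < |((∑ j, k j - 1 : ℤ) : ℝ)| := abs_pos.2 (by exact_mod_cast hm)
    have h4 : 0 < γ / |((∑ j, k j - 1 : ℤ) : ℝ)| ^ τ := by positivity
    linarith

/-- For large `k` the quadratic symbol dominates `k·ω + |ρ|`. The remaining nonresonant modes are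
finite in number, so nonvanishing of the divisor gives a uniform bound there. -/
theorem exists_le_abs_divisor (hn : LinearIndependent ℝ (realVec n)) {ρ : ℝ}
    (hρ : IsDiophantine ρ) :
    ∃ c : ℝ, 0 < c ∧ ∀ k ∉ resonantModes n,
      c * (1 + symb n k) ≤ |divisor n ρ (baseFreq n ρ) k| := by
  obtain ⟨c, hc, hS⟩ := exists_sum_sq_le_symb hn
  set ω := baseFreq n ρ
  set B : ℝ := ∑ j, ω j ^ 2 / (2 * c) + |ρ| with hB
  have hB0 : 0 ≤ B := by positivity
  have hlarge : ∀ k, symb n k / 2 - B ≤ |divisor n ρ ω k| := by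
    intro k
    -- Young's inequality: half of the ellipticity absorbs `k·ω`.
    have h1 : ∑ j, (k j : ℝ) * ω j ≤ symb n k / 2 + ∑ j, ω j ^ 2 / (2 * c) := by
      calc ∑ j, (k j : ℝ) * ω j ≤ ∑ j, (c * (k j : ℝ) ^ 2 / 2 + ω j ^ 2 / (2 * c)) := by
            refine Finset.sum_le_sum fun j _ => ?_
            have : c * (k j : ℝ) ^ 2 / 2 + ω j ^ 2 / (2 * c) - k j * ω j
                = (c * k j - ω j) ^ 2 / (2 * c) := by field_simp; ring
            have h2 : 0 ≤ (c * k j - ω j) ^ 2 / (2 * c) := by positivity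
            linarith
        _ = (c * ∑ j, (k j : ℝ) ^ 2) / 2 + ∑ j, ω j ^ 2 / (2 * c) := by
            rw [Finset.sum_add_distrib, Finset.mul_sum, Finset.sum_div]
        _ ≤ _ := by linarith [hS k]
    refine le_trans ?_ (neg_le_abs _)
    rw [divisor]
    linarith [neg_abs_le ρ]
  obtain ⟨c₂, hc₂, h₂⟩ := exists_pos_le_of_finite
    (F := {k | symb n k ≤ 4 * B + 1} \ resonantModes n)
    (f := fun k => |divisor n ρ ω k| / (1 + symb n k))
    ((finite_symb_le hn _).subset Set.sdiff_subset) fun k hk => by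
      have := symb_nonneg (n := n) k
      have := abs_pos.2 (divisor_baseFreq_ne_zero hρ hk.2)
      positivity
  refine ⟨min c₂ (1 / 8), by positivity, fun k hk => ?_⟩
  have h0 := symb_nonneg (n := n) k
  by_cases h : symb n k ≤ 4 * B + 1
  · have := h₂ k ⟨h, hk⟩
    rw [le_div_iff₀ (by positivity)] at this
    exact (mul_le_mul_of_nonneg_right (min_le_left _ _) (by positivity)).trans this
  · refine (mul_le_mul_of_nonneg_right (min_le_right _ _) (by positivity)).trans
      (le_trans ?_ (hlarge k))
    push Not at h
    linarith

open Classical in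
/-- The symbol of the inverse operator, combined with the derivatives in the nonlinearity. -/
noncomputable def invSymbol (n : Fin b → Fin d → ℤ) (ρ : ℝ) (ω : Fin b → ℝ) (k : Fin b → ℤ) : ℝ :=
  if k ∈ resonantModes n then 0 else symb n k / divisor n ρ ω k

/-- The numerator and the divisor are both of order `1 + symb`. Differentiating the quotient in `ω`
produces `|k| symb / divisor²`, still bounded because `|k|` is controlled by `symb`. So the inverse,
even composed with two derivatives, loses nothing. -/
theorem exists_invSymbol_bound (hn : LinearIndependent ℝ (realVec n)) {ρ : ℝ}
    (hρ : IsDiophantine ρ) :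
    ∃ δ C : ℝ, 0 < δ ∧ 0 < C ∧
      ∀ ω : Fin b → ℝ, (∀ j, |ω j - baseFreq n ρ j| ≤ δ) →
        (∀ k ∉ resonantModes n, divisor n ρ ω k ≠ 0) ∧ (∀ k, |invSymbol n ρ ω k| ≤ C) ∧
        ∀ ω' : Fin b → ℝ, (∀ j, |ω' j - baseFreq n ρ j| ≤ δ) → ∀ t, 0 ≤ t → (∀ j, |ω j - ω' j| ≤ t) →
          ∀ k, |invSymbol n ρ ω k - invSymbol n ρ ω' k| ≤ C * t := by
  obtain ⟨c, hc, hdiv⟩ := exists_le_abs_divisor hn hρ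
  obtain ⟨A, hA, habs⟩ := exists_sum_abs_le_symb hn
  have hdiff : ∀ (ω ω' : Fin b → ℝ) (t : ℝ), 0 ≤ t → (∀ j, |ω j - ω' j| ≤ t) → ∀ k,
      |divisor n ρ ω k - divisor n ρ ω' k| ≤ A * t * symb n k := by
    intro ω ω' t ht h k
    have h1 : divisor n ρ ω k - divisor n ρ ω' k = ∑ j, (k j : ℝ) * (ω j - ω' j) := by
      simp only [divisor, mul_sub, Finset.sum_sub_distrib]; ring
    rw [h1]
    calc _ ≤ ∑ j, |(k j : ℝ) * (ω j - ω' j)| := Finset.abs_sum_le_sum_abs _ _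
      _ ≤ ∑ j, |(k j : ℝ)| * t := Finset.sum_le_sum fun j _ => by
          rw [abs_mul]; exact mul_le_mul_of_nonneg_left (h j) (abs_nonneg _)
      _ = (∑ j, |(k j : ℝ)|) * t := by rw [Finset.sum_mul]
      _ ≤ A * symb n k * t := mul_le_mul_of_nonneg_right (habs k) ht
      _ = _ := by ring
  -- Chosen so that moving `ω` by `δ` costs at most half of the lower bound for the divisor.
  set δ := c / (2 * A) with hδ
  have hδ0 : 0 < δ := by positivity
  have hAδ : A * δ = c / 2 := by rw [hδ]; field_simp
  have hlow : ∀ ω : Fin b → ℝ, (∀ j, |ω j - baseFreq n ρ j| ≤ δ) → ∀ k ∉ resonantModes n,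
      c / 2 * (1 + symb n k) ≤ |divisor n ρ ω k| := by
    intro ω hω k hk
    have h1 := hdiff ω _ δ hδ0.le hω k
    have h2 := hdiv k hk
    have h3 := abs_sub_abs_le_abs_sub (divisor n ρ (baseFreq n ρ) k) (divisor n ρ ω k)
    rw [abs_sub_comm] at h3
    rw [hAδ] at h1
    nlinarith
  refine ⟨δ, max (2 / c) (4 * A / c ^ 2), hδ0, by positivity, fun ω hω => ⟨?_, ?_, ?_⟩⟩
  · intro k hk h0
    have := hlow ω hω k hk
    rw [h0, abs_zero] at this
    have h1 := symb_nonneg (n := n) k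
    have : 0 < c / 2 * (1 + symb n k) := by positivity
    linarith
  · intro k
    refine le_trans ?_ (le_max_left _ _)
    rw [invSymbol]
    split_ifs with hk
    · rw [abs_zero]; positivity
    · have h0 := symb_nonneg (n := n) k
      have h1 := hlow ω hω k hk
      have h2 : 0 < c / 2 * (1 + symb n k) := by positivity
      rw [abs_div, abs_of_nonneg h0, div_le_div_iff₀ (by linarith) hc]
      nlinarith
  · intro ω' hω' t ht0 ht k
    rw [invSymbol, invSymbol]
    split_ifs with hk
    · rw [sub_self, abs_zero]; positivity
    · have h0 := symb_nonneg (n := n) k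
      have h1 := hlow ω hω k hk
      have h1' := hlow ω' hω' k hk
      have h2 : 0 < c / 2 * (1 + symb n k) := by positivity
      have h3 := hdiff ω' ω t ht0 (fun j => by rw [abs_sub_comm]; exact ht j) k
      have hD : divisor n ρ ω k ≠ 0 := abs_pos.1 (h2.trans_le h1)
      have hD' : divisor n ρ ω' k ≠ 0 := abs_pos.1 (h2.trans_le h1')
      have h4 : symb n k / divisor n ρ ω k - symb n k / divisor n ρ ω' k =
          symb n k * (divisor n ρ ω' k - divisor n ρ ω k) /
            (divisor n ρ ω k * divisor n ρ ω' k) := by field_simp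
      rw [h4, abs_div, abs_mul, abs_mul, abs_of_nonneg h0]
      have h5 : (c / 2 * (1 + symb n k)) * (c / 2 * (1 + symb n k)) ≤
          |divisor n ρ ω k| * |divisor n ρ ω' k| := mul_le_mul h1 h1' h2.le (abs_nonneg _)
      refine le_trans ?_ (mul_le_mul_of_nonneg_right (le_max_right _ _) ht0)
      calc _ ≤ symb n k * (A * t * symb n k) / ((c / 2 * (1 + symb n k)) * (c / 2 * (1 + symb n k))) := by
            gcongr
        _ ≤ _ := by
            rw [div_le_iff₀ (by positivity)]
            have e : 4 * A / c ^ 2 * t * (c / 2 * (1 + symb n k) * (c / 2 * (1 + symb n k))) =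
                A * t * (1 + symb n k) ^ 2 := by field_simp; ring
            rw [e]
            have : symb n k ^ 2 ≤ (1 + symb n k) ^ 2 := pow_le_pow_left₀ h0 (by linarith) 2
            have := mul_le_mul_of_nonneg_left this (mul_nonneg hA.le ht0)
            linarith

end Elliptic

/-! ### The cubic nonlinearity in a commutative ring -/

section Cubic

variable {A : Type*} [NormedCommRing A]

/-- The cubic term `2 u² v`, where `v` plays the role of `ū`. -/
def cubic (u v : A) : A := 2 * (u * u * v)

/-- The linearization of the cubic term. -/
def cubicLin (u v h k : A) : A := 4 * (u * v * h) + 2 * (u * u * k)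

/-- The terms of order at least two in the increment. -/
def cubicRem (u v h k : A) : A := 4 * (u * h * k) + 2 * (v * h * h) + 2 * (h * h * k)

theorem cubic_add (u v h k : A) :
    cubic (u + h) (v + k) = cubic u v + cubicLin u v h k + cubicRem u v h k := by
  simp only [cubic, cubicLin, cubicRem]; ring

theorem cubicLin_add (u v h k h' k' : A) :
    cubicLin u v (h + h') (k + k') = cubicLin u v h k + cubicLin u v h' k' := by
  simp only [cubicLin]; ring

theorem cubicLin_sub (u v h k h' k' : A) :
    cubicLin u v (h - h') (k - k') = cubicLin u v h k - cubicLin u v h' k' := by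
  simp only [cubicLin]; ring

theorem norm_two_mul_le {x : A} {r : ℝ} (h : ‖x‖ ≤ r) : ‖2 * x‖ ≤ 2 * r := by
  rw [two_mul, two_mul]; exact (norm_add_le _ _).trans (add_le_add h h)

theorem norm_four_mul_le {x : A} {r : ℝ} (h : ‖x‖ ≤ r) : ‖4 * x‖ ≤ 4 * r := by
  have h1 := norm_two_mul_le (norm_two_mul_le h)
  have h2 : (2 : A) * (2 * x) = 4 * x := by ring
  rw [h2] at h1
  linarith

theorem norm_mul_three_le {x y z : A} {a b c : ℝ} (hx : ‖x‖ ≤ a) (hy : ‖y‖ ≤ b) (hz : ‖z‖ ≤ c) :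
    ‖x * y * z‖ ≤ a * b * c := by
  have ha := (norm_nonneg _).trans hx
  have hb := (norm_nonneg _).trans hy
  exact (norm_mul_le _ _).trans (mul_le_mul ((norm_mul_le _ _).trans
    (mul_le_mul hx hy (norm_nonneg _) ha)) hz (norm_nonneg _) (mul_nonneg ha hb))

/-- The difference of two triple products. -/
theorem norm_mul_three_sub_le {x y z x' y' z' : A} {a b c α β γ : ℝ} (hx' : ‖x'‖ ≤ a)
    (hy : ‖y‖ ≤ b) (hy' : ‖y'‖ ≤ b) (hz : ‖z‖ ≤ c) (hxx : ‖x - x'‖ ≤ α)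
    (hyy : ‖y - y'‖ ≤ β) (hzz : ‖z - z'‖ ≤ γ) :
    ‖x * y * z - x' * y' * z'‖ ≤ α * b * c + a * β * c + a * b * γ := by
  have h : x * y * z - x' * y' * z' =
      (x - x') * y * z + x' * (y - y') * z + x' * y' * (z - z') := by ring
  rw [h]
  exact (norm_add₃_le).trans (add_le_add (add_le_add (norm_mul_three_le hxx hy hz)
    (norm_mul_three_le hx' hyy hz)) (norm_mul_three_le hx' hy' hzz))

theorem norm_cubic_le {u v : A} {U : ℝ} (hu : ‖u‖ ≤ U) (hv : ‖v‖ ≤ U) :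
    ‖cubic u v‖ ≤ 2 * U ^ 3 :=
  (norm_two_mul_le (norm_mul_three_le hu hu hv)).trans_eq (by ring)

theorem norm_cubic_sub_le {u v u' v' : A} {U δ : ℝ} (hu : ‖u‖ ≤ U) (hv : ‖v‖ ≤ U) (hu' : ‖u'‖ ≤ U)
    (huδ : ‖u - u'‖ ≤ δ) (hvδ : ‖v - v'‖ ≤ δ) :
    ‖cubic u v - cubic u' v'‖ ≤ 6 * U ^ 2 * δ := by
  rw [cubic, cubic, ← mul_sub]
  exact (norm_two_mul_le (norm_mul_three_sub_le hu' hu hu' hv huδ huδ hvδ)).trans_eq (by ring)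

theorem norm_cubicLin_le {u v h k : A} {U r : ℝ} (hu : ‖u‖ ≤ U) (hv : ‖v‖ ≤ U) (hh : ‖h‖ ≤ r)
    (hk : ‖k‖ ≤ r) : ‖cubicLin u v h k‖ ≤ 6 * U ^ 2 * r :=
  ((norm_add_le _ _).trans (add_le_add (norm_four_mul_le (norm_mul_three_le hu hv hh))
    (norm_two_mul_le (norm_mul_three_le hu hu hk)))).trans_eq (by ring)

theorem norm_cubicRem_le {u v h k : A} {U r : ℝ} (hu : ‖u‖ ≤ U) (hv : ‖v‖ ≤ U) (hh : ‖h‖ ≤ r)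
    (hk : ‖k‖ ≤ r) : ‖cubicRem u v h k‖ ≤ 6 * U * r ^ 2 + 2 * r ^ 3 :=
  (norm_add₃_le.trans (add_le_add (add_le_add (norm_four_mul_le (norm_mul_three_le hu hh hk))
    (norm_two_mul_le (norm_mul_three_le hv hh hh)))
    (norm_two_mul_le (norm_mul_three_le hh hh hk)))).trans_eq (by ring)

theorem norm_cubicRem_sub_le {u v h k h' k' : A} {U r δ : ℝ} (hu : ‖u‖ ≤ U) (hv : ‖v‖ ≤ U)
    (hh : ‖h‖ ≤ r) (hk : ‖k‖ ≤ r) (hh' : ‖h'‖ ≤ r) (hδ : ‖h - h'‖ ≤ δ)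
    (hkδ : ‖k - k'‖ ≤ δ) :
    ‖cubicRem u v h k - cubicRem u v h' k'‖ ≤ (12 * U * r + 6 * r ^ 2) * δ := by
  have e : cubicRem u v h k - cubicRem u v h' k' = 4 * (u * h * k - u * h' * k') +
      2 * (v * h * h - v * h' * h') + 2 * (h * h * k - h' * h' * k') := by
    simp only [cubicRem]; ring
  have h0 : ∀ x : A, ‖x - x‖ ≤ 0 := fun x => by rw [sub_self, norm_zero]
  rw [e]
  exact (norm_add₃_le.trans (add_le_add (add_le_add
    (norm_four_mul_le (norm_mul_three_sub_le hu hh hh' hk (h0 u) hδ hkδ))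
    (norm_two_mul_le (norm_mul_three_sub_le hv hh hh' hh (h0 v) hδ hδ)))
    (norm_two_mul_le (norm_mul_three_sub_le hh' hh hh' hk hδ hδ hkδ)))).trans_eq (by ring)

end Cubic

/-! ### Coefficients of the cubic term at the tangential torus -/

section Coefficients

open Wiener

variable {b d : ℕ} {n : Fin b → Fin d → ℤ} {w : Weight (Fin b → ℤ)}

/-- The tangential torus `∑ a_j δ_{e_j}`. -/
noncomputable def torus (w : Weight (Fin b → ℤ)) (a : Fin b → ℝ) : Wiener w :=
  ∑ j, a j • delta w (basisVec j)

theorem reflect_torus (a : Fin b → ℝ) :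
    reflect (torus w a) = ∑ j, a j • delta w (-basisVec j) := by
  simp [torus, map_sum]

theorem coeff_torus (a : Fin b → ℝ) (k : Fin b → ℤ) :
    coeff k (torus w a) = ∑ j, if k = basisVec j then a j else 0 := by
  classical
  rw [torus, map_sum]
  refine Finset.sum_congr rfl fun j _ => ?_
  rw [map_smul, coeff_delta, smul_eq_mul]
  split_ifs <;> simp

theorem coeff_torus_mul (a : Fin b → ℝ) (x : Wiener w) (k : Fin b → ℤ) :
    coeff k (torus w a * x) = ∑ j, a j * coeff (k - basisVec j) x := by
  rw [torus, Finset.sum_mul, map_sum]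
  refine Finset.sum_congr rfl fun j _ => ?_
  rw [smul_mul_assoc, map_smul, coeff_delta_mul, smul_eq_mul]

theorem coeff_reflect_torus_mul (a : Fin b → ℝ) (x : Wiener w) (k : Fin b → ℤ) :
    coeff k (reflect (torus w a) * x) = ∑ j, a j * coeff (k + basisVec j) x := by
  rw [reflect_torus, Finset.sum_mul, map_sum]
  refine Finset.sum_congr rfl fun j _ => ?_
  rw [smul_mul_assoc, map_smul, coeff_delta_mul, smul_eq_mul, sub_neg_eq_add]

theorem coeff_two_mul (x : Wiener w) (k : Fin b → ℤ) : coeff k (2 * x) = 2 * coeff k x := by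
  rw [two_mul, map_add, two_mul]

theorem coeff_four_mul (x : Wiener w) (k : Fin b → ℤ) : coeff k (4 * x) = 4 * coeff k x := by
  have : (4 : Wiener w) * x = 2 * (2 * x) := by ring
  rw [this, coeff_two_mul, coeff_two_mul]; ring

theorem coeff_cubicLin (a : Fin b → ℝ) (h : Wiener w) (k : Fin b → ℤ) :
    coeff k (cubicLin (torus w a) (reflect (torus w a)) h (reflect h)) =
      4 * ∑ p : Fin b × Fin b, a p.1 * a p.2 * coeff (k - basisVec p.1 + basisVec p.2) h +
      2 * ∑ p : Fin b × Fin b, a p.1 * a p.2 * coeff (basisVec p.1 + basisVec p.2 - k) h := by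
  rw [cubicLin, map_add, coeff_four_mul, coeff_two_mul, mul_assoc, mul_assoc, coeff_torus_mul,
    coeff_torus_mul, Fintype.sum_prod_type, Fintype.sum_prod_type]
  congr 2
  · refine Finset.sum_congr rfl fun i _ => ?_
    rw [coeff_reflect_torus_mul, Finset.mul_sum]
    exact Finset.sum_congr rfl fun j _ => (mul_assoc _ _ _).symm
  · refine Finset.sum_congr rfl fun i _ => ?_
    rw [coeff_torus_mul, Finset.mul_sum]
    refine Finset.sum_congr rfl fun j _ => ?_
    rw [coeff_reflect, mul_assoc,
      show -(k - basisVec i - basisVec j) = basisVec i + basisVec j - k by abel]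

theorem coeff_cubic (a : Fin b → ℝ) (k : Fin b → ℤ) :
    coeff k (cubic (torus w a) (reflect (torus w a))) =
      2 * ∑ i, ∑ j, ∑ l, if basisVec i + basisVec j - k = basisVec l then a i * a j * a l else 0 := by
  rw [cubic, coeff_two_mul, mul_assoc, coeff_torus_mul]
  congr 1
  refine Finset.sum_congr rfl fun i _ => ?_
  rw [coeff_torus_mul, Finset.mul_sum]
  refine Finset.sum_congr rfl fun j _ => ?_
  rw [coeff_reflect, coeff_torus, Finset.mul_sum, Finset.mul_sum]
  refine Finset.sum_congr rfl fun l _ => ?_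
  have : -(k - basisVec i - basisVec j) = basisVec i + basisVec j - k := by abel
  rw [this]
  split_ifs
  · ring
  · simp

theorem basisVec_apply (i j : Fin b) : basisVec i j = if j = i then 1 else 0 := by
  simp [basisVec, Pi.single_apply]

/-- Under the nonperpendicularity condition, no nontrivial mode is produced by a cubic interaction
of tangential modes. -/
theorem add_sub_notMem_resonantModes₂ (hn : LinearIndependent ℝ (realVec n))
    (hperp : ∀ i j l : Fin b, i ≠ j → i ≠ l → j ≠ l → (n i - n j) ⬝ᵥ (n i - n l) ≠ 0)
    (i j l : Fin b) : basisVec i + basisVec j - basisVec l ∉ resonantModes₂ n := by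
  intro h
  have hil : i ≠ l := by
    rintro rfl
    exact ne_basisVec_of_mem h j (by abel)
  have hjl : j ≠ l := by
    rintro rfl
    exact ne_basisVec_of_mem h i (by abel)
  have h1 := (mem_resonantModes_iff.1 h.1).2
  have hs : ∀ m : Fin b, ∑ t, basisVec m t * sqLen (n t) = sqLen (n m) := fun m => by
    simp [basisVec_apply]
  have h2 : ∑ t, (basisVec i + basisVec j - basisVec l) t * sqLen (n t) =
      sqLen (n i) + sqLen (n j) - sqLen (n l) := by
    simp only [Pi.sub_apply, Pi.add_apply, sub_mul, add_mul, Finset.sum_sub_distrib,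
      Finset.sum_add_distrib, hs]
  rw [h2, momentum_sub, momentum_add, momentum_basisVec, momentum_basisVec, momentum_basisVec] at h1
  have e1 : n i + n j - n l = n l + ((n i - n l) + (n j - n l)) := by abel
  have e2 : sqLen (n i) = sqLen (n l + (n i - n l)) := by rw [add_sub_cancel]
  have e3 : sqLen (n j) = sqLen (n l + (n j - n l)) := by rw [add_sub_cancel]
  rw [e1, sqLen_add, sqLen_add (n i - n l), dotProduct_add] at h1
  rw [sqLen_add] at e2 e3
  -- Resonance of `e_i + e_j - e_l` says precisely that there is a right angle at `n_l`. If `i = j`,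
  -- it forces `n_i = n_l`.
  have h3 : (n i - n l) ⬝ᵥ (n j - n l) = 0 := by linarith
  by_cases hij : i = j
  · subst hij
    have h4 : sqLen (n i - n l) = 0 := by
      rw [← h3]; simp only [sqLen, dotProduct, sq]
    have h5 : momentum n (basisVec i - basisVec l) = 0 := by
      rw [momentum_sub, momentum_basisVec, momentum_basisVec]; exact sqLen_eq_zero h4
    exact hil (basisVec_injective (sub_eq_zero.1 (momentum_eq_zero hn h5)))
  · refine hperp l i j hil.symm hjl.symm hij ?_
    rw [← neg_sub (n i), ← neg_sub (n j), neg_dotProduct_neg]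
    exact h3

/-- A forcing of size `ε³` on these modes, divided by the linearization of size `ε²`, would create a
correction as large as the torus itself. The nonperpendicularity condition excludes it. -/
theorem coeff_cubic_of_mem (hn : LinearIndependent ℝ (realVec n))
    (hperp : ∀ i j l : Fin b, i ≠ j → i ≠ l → j ≠ l → (n i - n j) ⬝ᵥ (n i - n l) ≠ 0)
    (a : Fin b → ℝ) {k : Fin b → ℤ} (hk : k ∈ resonantModes₂ n) :
    coeff k (cubic (torus w a) (reflect (torus w a))) = 0 := by
  rw [coeff_cubic]
  refine mul_eq_zero_of_right _ (Finset.sum_eq_zero fun i _ => Finset.sum_eq_zero fun j _ =>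
    Finset.sum_eq_zero fun l _ => if_neg fun h => ?_)
  refine add_sub_notMem_resonantModes₂ hn hperp i j l ?_
  rw [← h, sub_sub_cancel]; exact hk

theorem basisVec_add_sub_eq_iff (i j l m : Fin b) :
    basisVec i + basisVec j - basisVec m = basisVec l ↔ (i = m ∧ j = l) ∨ (j = m ∧ i = l) := by
  constructor
  · intro h
    by_cases him : i = m
    · subst him
      rw [add_sub_cancel_left] at h
      exact Or.inl ⟨rfl, basisVec_injective h⟩
    · by_cases hjm : j = m
      · subst hjm
        rw [add_sub_cancel_right] at h
        exact Or.inr ⟨rfl, basisVec_injective h⟩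
      -- At the coordinate `m` the left side is `-1`, the right side `0` or `1`.
      · have := congrFun h m
        simp only [Pi.sub_apply, Pi.add_apply, basisVec_apply, Ne.symm him, Ne.symm hjm,
          if_false, if_true] at this
        split_ifs at this
        all_goals omega
  · rintro (⟨rfl, rfl⟩ | ⟨rfl, rfl⟩)
    exacts [add_sub_cancel_left _ _, add_sub_cancel_right _ _]

/-- This is the leading frequency shift. The two families `i = m, j = l` and `j = m, i = l` each
give `a_m ∑ a_l²`; they overlap in the single term `a_m³`, which is subtracted once. -/
theorem coeff_cubic_basisVec (a : Fin b → ℝ) (m : Fin b) :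
    coeff (basisVec m) (cubic (torus w a) (reflect (torus w a))) =
      a m * (4 * ∑ l, a l ^ 2 - 2 * a m ^ 2) := by
  rw [coeff_cubic]
  have h1 : ∀ i j l : Fin b,
      (if basisVec i + basisVec j - basisVec m = basisVec l then a i * a j * a l else 0) =
      (if i = m then (if j = l then a i * a j * a l else 0) else 0) +
      (if j = m then (if i = l then a i * a j * a l else 0) else 0) -
      (if i = m then (if j = m then (if l = m then a i * a j * a l else 0) else 0) else 0) := by
    intro i j l
    rw [if_congr (basisVec_add_sub_eq_iff i j l m) rfl rfl]
    by_cases him : i = m <;> by_cases hjm : j = m <;> by_cases hjl : j = l <;>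
      by_cases hil : i = l <;> by_cases hlm : l = m <;> simp_all
  simp only [h1, Finset.sum_add_distrib, Finset.sum_sub_distrib, Finset.sum_ite_eq,
    Finset.sum_ite_eq', Finset.mem_univ, if_true, Finset.sum_ite_irrel, Finset.sum_const_zero]
  simp only [mul_sub, Finset.mul_sum, mul_add]
  rw [← Finset.sum_add_distrib]
  congr 1
  · exact Finset.sum_congr rfl fun l _ => by ring
  · ring

/-- Increments on the nontrivial resonant modes do not move the frequencies at first order, so the
frequency error comes from `remainder` alone. -/
theorem coeff_cubicLin_basisVec (hn : LinearIndependent ℝ (realVec n))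
    (hperp : ∀ i j l : Fin b, i ≠ j → i ≠ l → j ≠ l → (n i - n j) ⬝ᵥ (n i - n l) ≠ 0)
    (a : Fin b → ℝ) {h : Wiener w} (hsupp : ∀ k ∉ resonantModes₂ n, coeff k h = 0) (m : Fin b) :
    coeff (basisVec m) (cubicLin (torus w a) (reflect (torus w a)) h (reflect h)) = 0 := by
  rw [coeff_cubicLin]
  have h1 : ∀ p : Fin b × Fin b, coeff (basisVec m - basisVec p.1 + basisVec p.2) h = 0 := by
    intro p
    refine hsupp _ ?_
    have := add_sub_notMem_resonantModes₂ hn hperp m p.2 p.1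
    rwa [show basisVec m - basisVec p.1 + basisVec p.2 = basisVec m + basisVec p.2 - basisVec p.1
      by abel]
  have h2 : ∀ p : Fin b × Fin b, coeff (basisVec p.1 + basisVec p.2 - basisVec m) h = 0 :=
    fun p => hsupp _ (add_sub_notMem_resonantModes₂ hn hperp p.1 p.2 m)
  simp [h1, h2]

/-- The linearization matrix at the amplitudes `a`. -/
noncomputable def linMatrixAt (n : Fin b → Fin d → ℤ) (a : Fin b → ℝ) :
    Matrix (resonantModes₂ n) (resonantModes₂ n) ℝ :=
  (linMatrix n).map (MvPolynomial.aeval a)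

theorem linMatrixAt_apply (a : Fin b → ℝ) (k k' : resonantModes₂ n) :
    linMatrixAt n a k k' =
      (if k = k' then ∑ j, (k.1 j * sqLen (n j) : ℝ) * (2 * a j ^ 2 - 4 * ∑ l, a l ^ 2) else 0) +
      symb n k.1 *
      (4 * (∑ p : Fin b × Fin b with k'.1 + basisVec p.1 - basisVec p.2 = k.1, a p.1 * a p.2)
        + 2 * ∑ p : Fin b × Fin b with basisVec p.1 + basisVec p.2 - k'.1 = k.1, a p.1 * a p.2) := by
  rw [linMatrixAt, Matrix.map_apply, linMatrix, map_add]
  congr 1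
  · split_ifs
    · simp
    · simp
  · simp [symb]

/-- The action of the linearization matrix. -/
theorem linMatrixAt_mulVec [Fintype (resonantModes₂ n)] (a : Fin b → ℝ) {h : Wiener w}
    (hsupp : ∀ k ∉ resonantModes₂ n, coeff k h = 0) (k : resonantModes₂ n) :
    (linMatrixAt n a).mulVec (fun k' => coeff k'.1 h) k =
      (∑ j, (k.1 j * sqLen (n j) : ℝ) * (2 * a j ^ 2 - 4 * ∑ l, a l ^ 2)) * coeff k.1 h +
      symb n k.1 *
        coeff k.1 (cubicLin (torus w a) (reflect (torus w a)) h (reflect h)) := by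
  classical
  -- For fixed `k`, each pair `(i,j)` selects exactly one mode `k'`; if that mode lies outside the
  -- index set, the coefficient of `h` vanishes there. Hence the sums over `k'` and over pairs
  -- agree.
  have key : ∀ (f : Fin b × Fin b → Fin b → ℤ) (P : (Fin b → ℤ) → Fin b × Fin b → Prop)
      [∀ k' p, Decidable (P k' p)] (_ : ∀ k' p, P k' p ↔ k' = f p),
      ∑ k' : resonantModes₂ n, (∑ p : Fin b × Fin b with P k'.1 p, a p.1 * a p.2) * coeff k'.1 h =
        ∑ p : Fin b × Fin b, a p.1 * a p.2 * coeff (f p) h := by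
    intro f P _ hP
    simp only [Finset.sum_filter, Finset.sum_mul]
    rw [Finset.sum_comm]
    refine Finset.sum_congr rfl fun p _ => ?_
    by_cases hp : f p ∈ resonantModes₂ n
    · rw [Finset.sum_eq_single ⟨f p, hp⟩]
      · rw [if_pos ((hP _ _).2 rfl)]
      · intro k' _ hk'
        rw [if_neg, zero_mul]
        intro h'
        exact hk' (Subtype.ext ((hP _ _).1 h'))
      · simp
    · rw [hsupp _ hp, mul_zero]
      refine Finset.sum_eq_zero fun k' _ => ?_
      rw [if_neg, zero_mul]
      intro h'
      exact hp ((hP _ _).1 h' ▸ k'.2)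
  rw [Matrix.mulVec, dotProduct, coeff_cubicLin]
  rw [← key (fun p => k.1 - basisVec p.1 + basisVec p.2)
      (fun k' p => k' + basisVec p.1 - basisVec p.2 = k.1) (fun k' p => by
        constructor
        · intro h; rw [← h]; abel
        · intro h; rw [h]; abel),
    ← key (fun p => basisVec p.1 + basisVec p.2 - k.1)
      (fun k' p => basisVec p.1 + basisVec p.2 - k' = k.1) (fun k' p => by
        constructor
        · intro h; rw [← h]; abel
        · intro h; rw [h]; abel)]
  simp only [linMatrixAt_apply, add_mul, Finset.sum_add_distrib, ite_mul, zero_mul,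
    Finset.sum_ite_eq, Finset.mem_univ, if_true, mul_add, Finset.mul_sum]
  congr 1
  congr 1 <;> refine Finset.sum_congr rfl fun k' _ => ?_ <;> simp only [← Finset.mul_sum] <;> ring

end Coefficients

/-! ### Inversion of the linearization -/

section Inverse

variable {b d : ℕ} {n : Fin b → Fin d → ℤ}

/-- The determinant of the linearization, as a real polynomial in the amplitudes. -/
noncomputable def linDet (n : Fin b → Fin d → ℤ) [Fintype (resonantModes₂ n)]
    [DecidableEq (resonantModes₂ n)] : MvPolynomial (Fin b) ℝ :=
  MvPolynomial.map (Int.castRingHom ℝ) (linMatrix n).det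

variable [Fintype (resonantModes₂ n)] [DecidableEq (resonantModes₂ n)]

theorem linDet_ne_zero (hn : LinearIndependent ℝ (realVec n)) : linDet n ≠ 0 := by
  rw [linDet, Ne, map_eq_zero_iff _ (MvPolynomial.map_injective _ Int.cast_injective)]
  exact det_linMatrix_ne_zero hn

theorem eval_linDet (y : Fin b → ℝ) :
    MvPolynomial.eval y (linDet n) = (linMatrixAt n y).det := by
  rw [linDet, MvPolynomial.eval_map, linMatrixAt]
  exact (MvPolynomial.aeval y : MvPolynomial (Fin b) ℤ →ₐ[ℤ] ℝ).toRingHom.map_det (linMatrix n)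

-- Homogeneity of degree two in the amplitudes reduces the inversion on `[ε,2ε]^b` to the fixed
-- compact box `[1,2]^b`.
omit [Fintype (resonantModes₂ n)] [DecidableEq (resonantModes₂ n)] in
theorem linMatrixAt_smul (ε : ℝ) (y : Fin b → ℝ) :
    linMatrixAt n (ε • y) = ε ^ 2 • linMatrixAt n y := by
  classical
  ext k k'
  rw [Matrix.smul_apply, linMatrixAt_apply, linMatrixAt_apply]
  have h1 : ∀ s : Finset (Fin b × Fin b), ∑ p ∈ s, (ε • y) p.1 * (ε • y) p.2 =
      ε ^ 2 * ∑ p ∈ s, y p.1 * y p.2 := fun s => by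
    rw [Finset.mul_sum]
    exact Finset.sum_congr rfl fun p _ => by simp only [Pi.smul_apply, smul_eq_mul]; ring
  have h2 : ∑ l, (ε • y) l ^ 2 = ε ^ 2 * ∑ l, y l ^ 2 := by
    rw [Finset.mul_sum]
    exact Finset.sum_congr rfl fun p _ => by simp only [Pi.smul_apply, smul_eq_mul]; ring
  have h3 : ∑ j, (k.1 j * sqLen (n j) : ℝ) * (2 * (ε • y) j ^ 2 - 4 * ∑ l, (ε • y) l ^ 2) =
      ε ^ 2 * ∑ j, (k.1 j * sqLen (n j) : ℝ) * (2 * y j ^ 2 - 4 * ∑ l, y l ^ 2) := by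
    rw [h2]
    generalize ∑ l, y l ^ 2 = Y
    rw [Finset.mul_sum]
    exact Finset.sum_congr rfl fun p _ => by simp only [Pi.smul_apply, smul_eq_mul]; ring
  rw [h1, h1, h3, smul_eq_mul]
  split_ifs <;> ring

/-- Quantitative inversion of the linearization. -/
theorem exists_linMatrixAt_inverse (n : Fin b → Fin d → ℤ) [Fintype (resonantModes₂ n)]
    [DecidableEq (resonantModes₂ n)] :
    ∃ C : ℝ, 0 < C ∧ ∀ (ε : ℝ) (a : Fin b → ℝ) (η : ℝ), 0 < ε → 0 < η →
      a ∈ Set.Icc (fun _ : Fin b => ε) (fun _ => 2 * ε) →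
      η ≤ |MvPolynomial.eval (ε⁻¹ • a) (linDet n)| →
      ∃ B : Matrix (resonantModes₂ n) (resonantModes₂ n) ℝ,
        linMatrixAt n a * B = 1 ∧ ∀ k k', |B k k'| ≤ C / (ε ^ 2 * η) := by
  -- Cramer's rule: the adjugate has polynomial entries, bounded on the compact box, so only the
  -- determinant needs a lower bound.
  have hadj : ∀ k k', ∃ c : ℝ, ∀ y ∈ Set.Icc (1 : Fin b → ℝ) 2,
      |(linMatrixAt n y).adjugate k k'| ≤ c := by
    intro k k'
    have h1 : ∀ y : Fin b → ℝ, (linMatrixAt n y).adjugate k k' =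
        MvPolynomial.eval y (MvPolynomial.map (Int.castRingHom ℝ) ((linMatrix n).adjugate k k')) := by
      intro y
      have h := (MvPolynomial.aeval y : MvPolynomial (Fin b) ℤ →ₐ[ℤ] ℝ).toRingHom.map_adjugate
        (linMatrix n)
      have h2 := congrFun (congrFun h k) k'
      rw [MvPolynomial.eval_map]
      exact h2.symm
    obtain ⟨c, hc⟩ := (isCompact_Icc (a := (1 : Fin b → ℝ)) (b := 2)).exists_bound_of_continuousOn
      (f := fun y => (linMatrixAt n y).adjugate k k')
      (by simp only [h1]; exact (MvPolynomial.continuous_eval _).continuousOn)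
    exact ⟨c, fun y hy => hc y hy⟩
  choose c hc using hadj
  refine ⟨1 + ∑ k, ∑ k', |c k k'|, by positivity, fun ε a η hε hη ha hdet => ?_⟩
  set y := ε⁻¹ • a with hy
  have hay : a = ε • y := by rw [hy, smul_smul, mul_inv_cancel₀ hε.ne', one_smul]
  have hyI : y ∈ Set.Icc (1 : Fin b → ℝ) 2 := by
    refine ⟨fun j => ?_, fun j => ?_⟩
    · have := ha.1 j
      simp only [hy, Pi.one_apply, Pi.smul_apply, smul_eq_mul, inv_mul_eq_div]
      rwa [le_div_iff₀ hε, one_mul]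
    · have := ha.2 j
      simp only [hy, Pi.ofNat_apply, Pi.smul_apply, smul_eq_mul, inv_mul_eq_div]
      rwa [div_le_iff₀ hε]
  rw [eval_linDet] at hdet
  set D := (linMatrixAt n y).det with hD
  have hD0 : D ≠ 0 := abs_pos.1 (hη.trans_le hdet)
  refine ⟨((ε ^ 2)⁻¹ * D⁻¹) • (linMatrixAt n y).adjugate, ?_, fun k k' => ?_⟩
  · rw [hay, linMatrixAt_smul, Matrix.smul_mul, Matrix.mul_smul, Matrix.mul_adjugate, smul_smul,
      smul_smul, ← hD]
    have : ε ^ 2 * ((ε ^ 2)⁻¹ * D⁻¹) * D = 1 := by field_simp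
    rw [this, one_smul]
  · have h1 : |c k k'| ≤ 1 + ∑ k, ∑ k', |c k k'| := by
      have e1 := Finset.single_le_sum (f := fun k' => |c k k'|) (fun _ _ => abs_nonneg _)
        (Finset.mem_univ k')
      have e2 := Finset.single_le_sum (f := fun k => ∑ k', |c k k'|)
        (fun _ _ => Finset.sum_nonneg fun _ _ => abs_nonneg _) (Finset.mem_univ k)
      linarith
    rw [Matrix.smul_apply, smul_eq_mul, abs_mul, abs_mul, abs_inv, abs_inv,
      abs_of_pos (pow_pos hε 2), ← mul_inv, inv_mul_eq_div]
    exact div_le_div₀ (by positivity) (((hc k k' y hyI).trans (le_abs_self _)).trans h1)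
      (by positivity) (by gcongr)

end Inverse

/-! ### Estimates for the nonlinearity near the tangential torus -/

section Estimates

open Wiener

variable {b d : ℕ} {n : Fin b → Fin d → ℤ} {w : Weight (Fin b → ℤ)}

open Classical in
theorem abs_indicator_le (s : Set (Fin b → ℤ)) (k : Fin b → ℤ) :
    |s.indicator (fun _ => (1 : ℝ)) k| ≤ 1 := by
  by_cases h : k ∈ s <;> simp [h]

/-- The projection to a set of modes. -/
noncomputable def proj (s : Set (Fin b → ℤ)) : Wiener w →L[ℝ] Wiener w :=
  multiplier (s.indicator fun _ => 1) 1 (abs_indicator_le s)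

theorem norm_proj_le (s : Set (Fin b → ℤ)) (x : Wiener w) : ‖proj s x‖ ≤ ‖x‖ :=
  (norm_multiplier_apply_le _ x).trans_eq (one_mul _)

theorem coeff_proj_of_mem {s : Set (Fin b → ℤ)} {k : Fin b → ℤ} (hk : k ∈ s) (x : Wiener w) :
    coeff k (proj s x) = coeff k x := by
  rw [proj, coeff_multiplier, Set.indicator_of_mem hk, one_mul]

theorem coeff_proj_of_notMem {s : Set (Fin b → ℤ)} {k : Fin b → ℤ} (hk : k ∉ s) (x : Wiener w) :
    coeff k (proj s x) = 0 := by
  rw [proj, coeff_multiplier, Set.indicator_of_notMem hk, zero_mul]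

/-- The nonlinearity `∂H/∂ū` on the level of Fourier coefficients. -/
noncomputable def nonlin (α : ℕ → ℕ → ℝ) (x : Wiener w) : Wiener w :=
  cubic x (reflect x) + higherOrder α x (reflect x)

/-- The increment encoded by `y`, where the nonresonant part is scaled by `ε`. -/
noncomputable def incr (n : Fin b → Fin d → ℤ) (ε : ℝ) : Wiener w →L[ℝ] Wiener w :=
  -- With the factor `ε`, the nonresonant part enters the resonant equations with Lipschitz constant
  -- `ε² · ε = η^12`. Without it the constant would be `η^8`, too large for an inverse of size
  -- `η^{-9}`. The tangential coefficients are left untouched.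
  proj (resonantModes₂ n) + ε • proj (resonantModes n)ᶜ

theorem incr_apply (ε : ℝ) (y : Wiener w) :
    incr n ε y = proj (resonantModes₂ n) y + ε • proj (resonantModes n)ᶜ y := rfl

theorem norm_smul_proj_le {ε : ℝ} (hε : 0 ≤ ε) (s : Set (Fin b → ℤ)) (y : Wiener w) :
    ‖ε • proj s y‖ ≤ ε * ‖y‖ := by
  rw [norm_smul, Real.norm_of_nonneg hε]
  exact mul_le_mul_of_nonneg_left (norm_proj_le _ _) hε

theorem norm_incr_le {ε : ℝ} (hε : 0 ≤ ε) (hε1 : ε ≤ 1) (y : Wiener w) :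
    ‖incr n ε y‖ ≤ 2 * ‖y‖ := by
  rw [incr_apply, two_mul]
  refine (norm_add_le _ _).trans (add_le_add (norm_proj_le _ _) ?_)
  exact (norm_smul_proj_le hε _ y).trans (mul_le_of_le_one_left (norm_nonneg _) hε1)

/-- The part of the nonlinearity that is perturbative on the resonant modes. -/
noncomputable def remainder (n : Fin b → Fin d → ℤ) (α : ℕ → ℕ → ℝ) (a : Fin b → ℝ) (ε : ℝ)
    (y : Wiener w) : Wiener w :=
  cubicLin (torus w a) (reflect (torus w a)) (ε • proj (resonantModes n)ᶜ y)
      (reflect (ε • proj (resonantModes n)ᶜ y)) +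
    cubicRem (torus w a) (reflect (torus w a)) (incr n ε y) (reflect (incr n ε y)) +
    higherOrder α (torus w a + incr n ε y) (reflect (torus w a + incr n ε y))

/-- The second summand is the part of the nonlinearity inverted by `linMatrix`; everything collected
in `remainder` is treated as a perturbation. -/
theorem nonlin_torus_add (α : ℕ → ℕ → ℝ) (a : Fin b → ℝ) (ε : ℝ) (y : Wiener w) :
    nonlin α (torus w a + incr n ε y) =
      cubic (torus w a) (reflect (torus w a)) +
      cubicLin (torus w a) (reflect (torus w a)) (proj (resonantModes₂ n) y)
        (reflect (proj (resonantModes₂ n) y)) + remainder n α a ε y := by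
  rw [nonlin, remainder, map_add reflect (torus w a), cubic_add]
  conv_lhs => rw [incr_apply, map_add reflect (proj _ y), cubicLin_add]
  rw [incr_apply]
  simp only [map_add]
  abel

theorem norm_torus_le {ε : ℝ} {a : Fin b → ℝ}
    (ha : a ∈ Set.Icc (fun _ : Fin b => ε) (fun _ => 2 * ε)) (hε : 0 ≤ ε) :
    ‖torus w a‖ ≤ (2 * ∑ j, w (basisVec j)) * ε := by
  rw [torus, Finset.mul_sum, Finset.sum_mul]
  refine (norm_sum_le _ _).trans (Finset.sum_le_sum fun j _ => ?_)
  have h1 : |a j| ≤ 2 * ε := by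
    rw [abs_of_nonneg (hε.trans (ha.1 j))]; exact ha.2 j
  rw [norm_smul, norm_delta, Real.norm_eq_abs]
  calc _ ≤ 2 * ε * w (basisVec j) := mul_le_mul_of_nonneg_right h1 (w.pos _).le
    _ = _ := by ring

theorem norm_reflect_sub_le (x x' : Wiener w) : ‖reflect x - reflect x'‖ ≤ ‖x - x'‖ := by
  rw [← map_sub]; exact norm_reflect_le _

theorem hoConst_nonneg (α : ℕ → ℕ → ℝ) {R : ℝ} (hR : 0 < R) : 0 ≤ hoConst α R :=
  mul_nonneg (by positivity) (tsum_nonneg fun _ => by positivity)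

/-- Bounds for the nonlinearity near the torus, in terms of `η = ε^{1/4}`. -/
theorem exists_nonlin_bounds (n : Fin b → Fin d → ℤ) (w : Weight (Fin b → ℤ)) {α : ℕ → ℕ → ℝ}
    (hα : ∀ l l', l + l' < 5 → α l l' = 0) {R : ℝ} (hR : 0 < R) (hc : ConvergesAt α R) :
    ∃ C η₀ : ℝ, 0 < C ∧ 0 < η₀ ∧ η₀ ≤ 1 ∧ ∀ η : ℝ, 0 < η → η < η₀ → ∀ a : Fin b → ℝ,
      a ∈ Set.Icc (fun _ : Fin b => η ^ 4) (fun _ => 2 * η ^ 4) →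
      ∀ y : Wiener w, ‖y‖ ≤ η ^ 6 →
        ‖torus w a + incr n (η ^ 4) y‖ < R / 4 ∧
        ‖nonlin α (torus w a + incr n (η ^ 4) y)‖ ≤ C * η ^ 12 ∧
        ‖remainder n α a (η ^ 4) y‖ ≤ C * η ^ 16 ∧
        ∀ y' : Wiener w, ‖y'‖ ≤ η ^ 6 →
          ‖nonlin α (torus w a + incr n (η ^ 4) y) -
            nonlin α (torus w a + incr n (η ^ 4) y')‖ ≤ C * η ^ 8 * ‖y - y'‖ ∧
          ‖remainder n α a (η ^ 4) y - remainder n α a (η ^ 4) y'‖ ≤ C * η ^ 10 * ‖y - y'‖ := by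
  set M : ℝ := 2 * ∑ j, w (basisVec j) with hM
  have hM0 : 0 ≤ M := mul_nonneg zero_le_two (Finset.sum_nonneg fun j _ => (w.pos _).le)
  set L : ℝ := M + 2 with hL
  have hL0 : 0 < L := by linarith
  set G := hoConst α R with hG
  have hG0 : 0 ≤ G := hoConst_nonneg α hR
  set CF := 2 * L ^ 3 + G * L ^ 4 with hCF
  set CF' := 6 * L ^ 2 * 2 + G * L ^ 3 * 2 with hCF'
  set CR := 6 * M ^ 2 + (24 * M + 16) + G * L ^ 4 with hCR
  set CR' := 6 * M ^ 2 + (24 * M + 24) * 2 + G * L ^ 3 * 2 with hCR'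
  have hCF0 : 0 ≤ CF := by positivity
  have hCF'0 : 0 ≤ CF' := by positivity
  have hCR0 : 0 ≤ CR := by positivity
  have hCR'0 : 0 ≤ CR' := by positivity
  -- The bound `η < R / (4 * L)` keeps the torus and its increment, of size at most `L η^4`, inside
  -- the domain of the series.
  refine ⟨1 + CF + CF' + CR + CR', min 1 (R / (4 * L)), by positivity, by positivity,
    min_le_left _ _, fun η hη hη0 a ha y hy => ?_⟩
  have hη1 : η ≤ 1 := (hη0.trans_le (min_le_left _ _)).le
  have hpow : ∀ i j : ℕ, i ≤ j → η ^ j ≤ η ^ i := fun i j h => pow_le_pow_of_le_one hη.le hη1 h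
  have h4 : 0 ≤ η ^ 4 := by positivity
  have h41 : η ^ 4 ≤ 1 := by simpa using hpow 0 4 (by norm_num)
  have hLR : L * η ^ 4 < R / 4 := by
    have h1 : η ^ 4 ≤ η := by simpa using hpow 1 4 (by norm_num)
    have h2 := h1.trans_lt (hη0.trans_le (min_le_right _ _))
    rw [lt_div_iff₀ (by positivity)] at h2
    linarith
  set u := torus w a
  have hu : ‖u‖ ≤ M * η ^ 4 := norm_torus_le ha h4
  have hv : ‖reflect u‖ ≤ M * η ^ 4 := (norm_reflect_le u).trans hu
  have hh : ∀ y : Wiener w, ‖y‖ ≤ η ^ 6 → ‖incr n (η ^ 4) y‖ ≤ 2 * η ^ 6 := fun y hy =>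
    (norm_incr_le h4 h41 y).trans (by linarith)
  have hk : ∀ y : Wiener w, ‖y‖ ≤ η ^ 6 → ‖reflect (incr n (η ^ 4) y)‖ ≤ 2 * η ^ 6 := fun y hy =>
    (norm_reflect_le _).trans (hh y hy)
  have hx : ∀ y : Wiener w, ‖y‖ ≤ η ^ 6 → ‖u + incr n (η ^ 4) y‖ ≤ L * η ^ 4 := fun y hy => by
    refine (norm_add_le _ _).trans ((add_le_add hu (hh y hy)).trans ?_)
    have := hpow 4 6 (by norm_num)
    rw [hL]; nlinarith
  have hx' : ∀ y : Wiener w, ‖y‖ ≤ η ^ 6 → ‖reflect (u + incr n (η ^ 4) y)‖ ≤ L * η ^ 4 :=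
    fun y hy => (norm_reflect_le _).trans (hx y hy)
  have hp : ∀ y : Wiener w,
      ‖(η ^ 4) • proj (resonantModes n)ᶜ y‖ ≤ η ^ 4 * ‖y‖ := fun y => norm_smul_proj_le h4 _ y
  have hq : ∀ y : Wiener w,
      ‖reflect ((η ^ 4) • proj (resonantModes n)ᶜ y)‖ ≤ η ^ 4 * ‖y‖ := fun y =>
    (norm_reflect_le _).trans (hp y)
  refine ⟨(hx y hy).trans_lt hLR, ?_, ?_, fun y' hy' => ?_⟩
  · have b1 := norm_cubic_le (hx y hy) (hx' y hy)
    have b2 := norm_higherOrder_le hα hR hc hLR.le (hx y hy) (hx' y hy)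
    refine ((norm_add_le _ _).trans (add_le_add b1 b2)).trans ?_
    have e : 2 * (L * η ^ 4) ^ 3 + G * (L * η ^ 4) ^ 4 = 2 * L ^ 3 * η ^ 12 + G * L ^ 4 * η ^ 16 := by
      ring
    rw [e]
    have : G * L ^ 4 * η ^ 16 ≤ G * L ^ 4 * η ^ 12 := by
      have := hpow 12 16 (by norm_num); gcongr
    calc _ ≤ CF * η ^ 12 := by rw [hCF]; linarith
      _ ≤ _ := by gcongr; linarith
  · have b1 := norm_cubicLin_le hu hv ((hp y).trans (mul_le_mul_of_nonneg_left hy h4))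
      ((hq y).trans (mul_le_mul_of_nonneg_left hy h4))
    have b2 := norm_cubicRem_le hu hv (hh y hy) (hk y hy)
    have b3 := norm_higherOrder_le hα hR hc hLR.le (hx y hy) (hx' y hy)
    refine (norm_add₃_le.trans (add_le_add (add_le_add b1 b2) b3)).trans ?_
    -- The exponent `16` is dictated by the quadratic terms `η^4 (η^6)²` and by the quartic terms
    -- `(η^4)^4`.
    have e : 6 * (M * η ^ 4) ^ 2 * (η ^ 4 * η ^ 6) + (6 * (M * η ^ 4) * (2 * η ^ 6) ^ 2 +
        2 * (2 * η ^ 6) ^ 3) + G * (L * η ^ 4) ^ 4 =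
        6 * M ^ 2 * η ^ 18 + (24 * M * η ^ 16 + 16 * η ^ 18) + G * L ^ 4 * η ^ 16 := by ring
    rw [e]
    have h1 := hpow 16 18 (by norm_num)
    have h2 : 6 * M ^ 2 * η ^ 18 ≤ 6 * M ^ 2 * η ^ 16 := by gcongr
    calc _ ≤ CR * η ^ 16 := by rw [hCR]; linarith
      _ ≤ _ := by gcongr; linarith
  · have hδ : ‖incr n (η ^ 4) y - incr n (η ^ 4) y'‖ ≤ 2 * ‖y - y'‖ := by
      rw [← map_sub]; exact norm_incr_le h4 h41 _
    have hδk : ‖reflect (incr n (η ^ 4) y) - reflect (incr n (η ^ 4) y')‖ ≤ 2 * ‖y - y'‖ :=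
      (norm_reflect_sub_le _ _).trans hδ
    have hδx : ‖(u + incr n (η ^ 4) y) - (u + incr n (η ^ 4) y')‖ ≤ 2 * ‖y - y'‖ := by
      rwa [add_sub_add_left_eq_sub]
    have hδx' := (norm_reflect_sub_le (u + incr n (η ^ 4) y) (u + incr n (η ^ 4) y')).trans hδx
    have b3 := norm_higherOrder_sub_le hα hR hc hLR.le (hx y hy) (hx y' hy') (hx' y hy) (hx' y' hy')
      hδx hδx'
    have hn0 := norm_nonneg (y - y')
    constructor
    · have b1 := norm_cubic_sub_le (hx y hy) (hx' y hy) (hx y' hy') hδx hδx'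
      rw [nonlin, nonlin, add_sub_add_comm]
      refine ((norm_add_le _ _).trans (add_le_add b1 b3)).trans ?_
      have e : 6 * (L * η ^ 4) ^ 2 * (2 * ‖y - y'‖) + G * (L * η ^ 4) ^ 3 * (2 * ‖y - y'‖) =
          (6 * L ^ 2 * 2 * η ^ 8 + G * L ^ 3 * 2 * η ^ 12) * ‖y - y'‖ := by ring
      rw [e]
      refine mul_le_mul_of_nonneg_right ?_ hn0
      have h1 := hpow 8 12 (by norm_num)
      have h2 : G * L ^ 3 * 2 * η ^ 12 ≤ G * L ^ 3 * 2 * η ^ 8 := by gcongr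
      calc _ ≤ CF' * η ^ 8 := by rw [hCF']; linarith
        _ ≤ _ := by gcongr; linarith
    · have b1 : ‖cubicLin u (reflect u) ((η ^ 4) • proj (resonantModes n)ᶜ y)
            (reflect ((η ^ 4) • proj (resonantModes n)ᶜ y)) -
          cubicLin u (reflect u) ((η ^ 4) • proj (resonantModes n)ᶜ y')
            (reflect ((η ^ 4) • proj (resonantModes n)ᶜ y'))‖ ≤
          6 * (M * η ^ 4) ^ 2 * (η ^ 4 * ‖y - y'‖) := by
        rw [← cubicLin_sub, ← map_sub, ← smul_sub, ← map_sub]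
        exact norm_cubicLin_le hu hv (hp _) (hq _)
      have b2 := norm_cubicRem_sub_le hu hv (hh y hy) (hk y hy) (hh y' hy') hδ hδk
      rw [remainder, remainder, add_sub_add_comm, add_sub_add_comm]
      refine (norm_add₃_le.trans (add_le_add (add_le_add b1 b2) b3)).trans ?_
      -- The exponent `10` comes from the quadratic terms, of Lipschitz constant `η^4 · η^6`.
      have e : 6 * (M * η ^ 4) ^ 2 * (η ^ 4 * ‖y - y'‖) +
          (12 * (M * η ^ 4) * (2 * η ^ 6) + 6 * (2 * η ^ 6) ^ 2) * (2 * ‖y - y'‖) +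
          G * (L * η ^ 4) ^ 3 * (2 * ‖y - y'‖) =
          (6 * M ^ 2 * η ^ 12 + (24 * M * η ^ 10 + 24 * η ^ 12) * 2 + G * L ^ 3 * 2 * η ^ 12) *
            ‖y - y'‖ := by ring
      rw [e]
      refine mul_le_mul_of_nonneg_right ?_ hn0
      have h1 := hpow 10 12 (by norm_num)
      have h2 : G * L ^ 3 * 2 * η ^ 12 ≤ G * L ^ 3 * 2 * η ^ 10 := by gcongr
      have h3 : 6 * M ^ 2 * η ^ 12 ≤ 6 * M ^ 2 * η ^ 10 := by gcongr
      calc _ ≤ CR' * η ^ 10 := by rw [hCR']; linarith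
        _ ≤ _ := by gcongr; linarith

end Estimates

/-! ### The fixed point problem -/

/-- The contraction principle on a closed ball around the origin. -/
theorem exists_fixedPoint_of_contracting_ball {A : Type*} [NormedAddCommGroup A] [CompleteSpace A]
    (Φ : A → A) {r : ℝ} (hr : 0 ≤ r) (hmap : ∀ y, ‖y‖ ≤ r → ‖Φ y‖ ≤ r)
    (hlip : ∀ y y', ‖y‖ ≤ r → ‖y'‖ ≤ r → ‖Φ y - Φ y'‖ ≤ 1 / 2 * ‖y - y'‖) :
    ∃ y, ‖y‖ ≤ r ∧ Φ y = y := by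
  have hmaps : Set.MapsTo Φ (Metric.closedBall 0 r) (Metric.closedBall 0 r) := by
    intro y hy
    rw [mem_closedBall_zero_iff] at hy ⊢
    exact hmap y hy
  have hcontr : ContractingWith (1 / 2) (hmaps.restrict Φ _ _) := by
    refine ⟨by rw [← NNReal.coe_lt_coe]; norm_num, LipschitzWith.of_dist_le_mul fun y y' => ?_⟩
    rw [Subtype.dist_eq, Subtype.dist_eq, dist_eq_norm, dist_eq_norm]
    have := hlip y.1 y'.1 (mem_closedBall_zero_iff.1 y.2) (mem_closedBall_zero_iff.1 y'.2)
    simpa using this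
  obtain ⟨y, hy, hfix, -⟩ := hcontr.exists_fixedPoint' (x := 0)
    Metric.isClosed_closedBall.isComplete hmaps (Metric.mem_closedBall_self hr) (edist_ne_top _ _)
  exact ⟨y, mem_closedBall_zero_iff.1 hy, hfix⟩

section FixedPoint

open Wiener

variable {b d : ℕ} {n : Fin b → Fin d → ℤ} {w : Weight (Fin b → ℤ)}

/-- The frequency determined by the equations for the tangential modes. -/
noncomputable def freq (n : Fin b → Fin d → ℤ) (ρ : ℝ) (α : ℕ → ℕ → ℝ) (a : Fin b → ℝ) (ε : ℝ)
    (y : Wiener w) (j : Fin b) : ℝ :=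
  baseFreq n ρ j -
    (sqLen (n j) : ℝ) * coeff (basisVec j) (nonlin α (torus w a + incr n ε y)) / a j

/-- The first approximation of the frequency. -/
noncomputable def freqApprox (n : Fin b → Fin d → ℤ) (ρ : ℝ) (a : Fin b → ℝ) (j : Fin b) : ℝ :=
  baseFreq n ρ j - (sqLen (n j) : ℝ) * (4 * ∑ l, a l ^ 2 - 2 * a j ^ 2)

/-- The cubic term of the torus produces exactly `freqApprox` and the first order resonant
contribution vanishes. Dividing a remainder of size `ε⁴` by `a_j` leaves an error of size `ε³`. -/
theorem freq_sub_freqApprox (hn : LinearIndependent ℝ (realVec n))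
    (hperp : ∀ i j l : Fin b, i ≠ j → i ≠ l → j ≠ l → (n i - n j) ⬝ᵥ (n i - n l) ≠ 0)
    (ρ : ℝ) (α : ℕ → ℕ → ℝ) {a : Fin b → ℝ} (ε : ℝ) (y : Wiener w) {j : Fin b} (haj : a j ≠ 0) :
    freq n ρ α a ε y j - freqApprox n ρ a j =
      -((sqLen (n j) : ℝ) * coeff (basisVec j) (remainder n α a ε y) / a j) := by
  rw [freq, freqApprox, nonlin_torus_add, map_add, map_add, coeff_cubic_basisVec,
    coeff_cubicLin_basisVec hn hperp a fun k hk => coeff_proj_of_notMem hk y]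
  field_simp
  ring

/-- The lower order part of the equations for the nontrivial resonant modes. -/
noncomputable def resVec (n : Fin b → Fin d → ℤ) (ρ : ℝ) (α : ℕ → ℕ → ℝ) (a : Fin b → ℝ) (ε : ℝ)
    (y : Wiener w) (k : resonantModes₂ n) : ℝ :=
  (∑ j, (k.1 j : ℝ) * (freq n ρ α a ε y j - freqApprox n ρ a j)) * coeff k.1 y +
    symb n k.1 * coeff k.1 (remainder n α a ε y)

open Classical in
/-- The inverse of the linear part off the resonant modes, composed with the derivatives of the
nonlinearity. -/
noncomputable def invOp (w : Weight (Fin b → ℤ)) (n : Fin b → Fin d → ℤ) (ρ C : ℝ)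
    (ω : Fin b → ℝ) : Wiener w →L[ℝ] Wiener w :=
  -- The default value `0` only makes the operator total in `ω`; the frequencies that occur stay
  -- where the bound holds.
  if h : ∀ k, |invSymbol n ρ ω k| ≤ C then multiplier (invSymbol n ρ ω) C h else 0

theorem coeff_invOp {ρ C : ℝ} {ω : Fin b → ℝ} (h : ∀ k, |invSymbol n ρ ω k| ≤ C)
    (k : Fin b → ℤ) (x : Wiener w) :
    coeff k (invOp w n ρ C ω x) = invSymbol n ρ ω k * coeff k x := by
  rw [invOp, dif_pos h, coeff_multiplier]

theorem norm_invOp_le {ρ C : ℝ} {ω : Fin b → ℝ} (h : ∀ k, |invSymbol n ρ ω k| ≤ C)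
    (x : Wiener w) : ‖invOp w n ρ C ω x‖ ≤ C * ‖x‖ := by
  rw [invOp, dif_pos h]
  exact norm_multiplier_apply_le h x

theorem norm_invOp_sub_le {ρ C t : ℝ} {ω ω' : Fin b → ℝ} (h : ∀ k, |invSymbol n ρ ω k| ≤ C)
    (h' : ∀ k, |invSymbol n ρ ω' k| ≤ C)
    (hd : ∀ k, |invSymbol n ρ ω k - invSymbol n ρ ω' k| ≤ t) (x : Wiener w) :
    ‖invOp w n ρ C ω x - invOp w n ρ C ω' x‖ ≤ t * ‖x‖ := by
  have : invOp w n ρ C ω x - invOp w n ρ C ω' x =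
      multiplier (fun k => invSymbol n ρ ω k - invSymbol n ρ ω' k) t hd x := by
    refine ext_coeff fun k => ?_
    rw [map_sub, coeff_invOp h, coeff_invOp h', coeff_multiplier]
    ring
  rw [this]
  exact norm_multiplier_apply_le hd x

variable [Fintype (resonantModes₂ n)]

/-- The element with given coefficients at the nontrivial resonant modes. -/
noncomputable def ofResonant (w : Weight (Fin b → ℤ)) (v : resonantModes₂ n → ℝ) : Wiener w :=
  ∑ k, v k • delta w k.1

theorem ofResonant_sub (v v' : resonantModes₂ n → ℝ) :
    ofResonant w (v - v') = ofResonant w v - ofResonant w v' := by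
  simp [ofResonant, sub_smul]

theorem norm_ofResonant_le {v : resonantModes₂ n → ℝ} {t : ℝ} (h : ∀ k, |v k| ≤ t) :
    ‖ofResonant w v‖ ≤ (∑ k : resonantModes₂ n, w k.1) * t := by
  rw [ofResonant, Finset.sum_mul]
  refine (norm_sum_le _ _).trans (Finset.sum_le_sum fun k _ => ?_)
  rw [norm_smul, norm_delta, Real.norm_eq_abs, mul_comm]
  exact mul_le_mul_of_nonneg_left (h k) (w.pos _).le

theorem coeff_ofResonant_of_mem (v : resonantModes₂ n → ℝ) (k : resonantModes₂ n) :
    coeff k.1 (ofResonant w v) = v k := by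
  classical
  rw [ofResonant, map_sum, Finset.sum_eq_single k]
  · rw [map_smul, coeff_delta, if_pos rfl, smul_eq_mul, mul_one]
  · intro k' _ hk'
    rw [map_smul, coeff_delta, if_neg fun h => hk' (Subtype.ext h.symm), smul_zero]
  · simp

theorem coeff_ofResonant_of_notMem (v : resonantModes₂ n → ℝ) {k : Fin b → ℤ}
    (hk : k ∉ resonantModes₂ n) : coeff k (ofResonant w v) = 0 := by
  classical
  rw [ofResonant, map_sum]
  refine Finset.sum_eq_zero fun k' _ => ?_
  rw [map_smul, coeff_delta, if_neg (fun h : k = k'.1 => hk (h ▸ k'.2)), smul_zero]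

/-- The map whose fixed points give solutions. -/
noncomputable def fixMap (n : Fin b → Fin d → ℤ) [Fintype (resonantModes₂ n)] (ρ : ℝ)
    (α : ℕ → ℕ → ℝ) (C : ℝ) (a : Fin b → ℝ) (ε : ℝ)
    (B : Matrix (resonantModes₂ n) (resonantModes₂ n) ℝ) (y : Wiener w) : Wiener w :=
  -- The factor `ε⁻¹` compensates the scaling of the nonresonant part in `incr`.
  -(ε⁻¹ • invOp w n ρ C (freq n ρ α a ε y) (nonlin α (torus w a + incr n ε y))) -
    ofResonant w (B.mulVec (resVec n ρ α a ε y))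

theorem abs_mulVec_le {B : Matrix (resonantModes₂ n) (resonantModes₂ n) ℝ}
    {v : resonantModes₂ n → ℝ} {s t : ℝ} (hB : ∀ k k', |B k k'| ≤ s) (hv : ∀ k, |v k| ≤ t)
    (hs : 0 ≤ s) (k : resonantModes₂ n) :
    |B.mulVec v k| ≤ Fintype.card (resonantModes₂ n) * (s * t) := by
  rw [Matrix.mulVec, dotProduct]
  refine (Finset.abs_sum_le_sum_abs _ _).trans ?_
  refine (Finset.sum_le_sum (g := fun _ => s * t) fun k' _ => ?_).trans_eq (by simp)
  rw [abs_mul]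
  exact mul_le_mul (hB k k') (hv k') (abs_nonneg _) hs

theorem coeff_torus_basisVec (a : Fin b → ℝ) (j : Fin b) :
    coeff (basisVec j) (torus w a) = a j := by
  rw [coeff_torus, Finset.sum_eq_single j]
  · simp
  · intro i _ hi
    rw [if_neg fun h => hi (basisVec_injective h).symm]
  · simp

theorem coeff_torus_of_ne (a : Fin b → ℝ) {k : Fin b → ℤ} (hk : ∀ j, k ≠ basisVec j) :
    coeff k (torus w a) = 0 := by
  rw [coeff_torus]
  exact Finset.sum_eq_zero fun j _ => if_neg (hk j)

-- At a resonant mode `ρ` and the squared lengths cancel, so the divisor is a pure frequency shift,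
-- of size `ε²`.
omit [Fintype (resonantModes₂ n)] in
theorem divisor_of_mem (ρ : ℝ) (ω : Fin b → ℝ) {k : Fin b → ℤ} (hk : k ∈ resonantModes n) :
    divisor n ρ ω k = ∑ j, (k j : ℝ) * (ω j - baseFreq n ρ j) := by
  have h1 : ((∑ j, k j : ℤ) : ℝ) = 1 := by exact_mod_cast hk.1
  have h2 : ((∑ j, k j * sqLen (n j) : ℤ) : ℝ) = symb n k := by
    rw [symb, (mem_resonantModes_iff.1 hk).2]
  push_cast at h1 h2
  simp only [divisor, baseFreq, mul_sub, mul_add, Finset.sum_sub_distrib, Finset.sum_add_distrib,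
    ← Finset.sum_mul, h1, h2]
  ring

omit [Fintype (resonantModes₂ n)] in
theorem symb_basisVec (j : Fin b) : symb n (basisVec j) = (sqLen (n j) : ℝ) := by
  rw [symb, momentum_basisVec]

/-- A fixed point solves the equations for all Fourier coefficients. -/
theorem equation_of_fixedPoint (hn : LinearIndependent ℝ (realVec n))
    (hperp : ∀ i j l : Fin b, i ≠ j → i ≠ l → j ≠ l → (n i - n j) ⬝ᵥ (n i - n l) ≠ 0)
    [DecidableEq (resonantModes₂ n)] {ρ C ε : ℝ} {α : ℕ → ℕ → ℝ} {a : Fin b → ℝ}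
    {B : Matrix (resonantModes₂ n) (resonantModes₂ n) ℝ} (hε : ε ≠ 0) (ha : ∀ j, a j ≠ 0)
    (hB : linMatrixAt n a * B = 1) {y : Wiener w} (hfix : fixMap n ρ α C a ε B y = y)
    (hdiv : ∀ k ∉ resonantModes n, divisor n ρ (freq n ρ α a ε y) k ≠ 0)
    (hbd : ∀ k, |invSymbol n ρ (freq n ρ α a ε y) k| ≤ C) :
    (∀ j, coeff (basisVec j) (torus w a + incr n ε y) = a j) ∧
    ∀ k, divisor n ρ (freq n ρ α a ε y) k * coeff k (torus w a + incr n ε y) +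
      symb n k * coeff k (nonlin α (torus w a + incr n ε y)) = 0 := by
  have htan : ∀ j, coeff (basisVec j) (torus w a + incr n ε y) = a j := by
    intro j
    have h2 : basisVec j ∉ resonantModes₂ n := fun h => h.2 ⟨j, rfl⟩
    have h3 : basisVec j ∉ (resonantModes n)ᶜ := fun h => h (basisVec_mem j)
    rw [map_add, coeff_torus_basisVec, incr_apply, map_add, map_smul, coeff_proj_of_notMem h2,
      coeff_proj_of_notMem h3, smul_zero, add_zero, add_zero]
  have hcoeff : ∀ k, coeff k y = -(ε⁻¹ * (invSymbol n ρ (freq n ρ α a ε y) k *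
      coeff k (nonlin α (torus w a + incr n ε y)))) -
      coeff k (ofResonant w (B.mulVec (resVec n ρ α a ε y))) := by
    intro k
    conv_lhs => rw [← hfix]
    rw [fixMap, map_sub, map_neg, map_smul, coeff_invOp hbd, smul_eq_mul]
  refine ⟨htan, fun k => ?_⟩
  by_cases hk : k ∈ resonantModes n
  · by_cases hk2 : k ∈ Set.range basisVec
    · obtain ⟨j, rfl⟩ := hk2
      -- At a tangential mode the equation is the definition of `freq`.
      rw [htan, divisor_of_mem ρ _ hk, symb_basisVec]
      have : ∑ i, (basisVec j i : ℝ) * (freq n ρ α a ε y i - baseFreq n ρ i) =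
          freq n ρ α a ε y j - baseFreq n ρ j := by
        simp [basisVec_apply]
      rw [this, freq]
      have := ha j
      field_simp
      ring
    · have hk3 : k ∈ resonantModes₂ n := ⟨hk, hk2⟩
      have hsupp : ∀ k ∉ resonantModes₂ n, coeff k (proj (resonantModes₂ n) y) = 0 :=
        fun k hk => coeff_proj_of_notMem hk y
      have hq : ∀ k : resonantModes₂ n, coeff k.1 (proj (resonantModes₂ n) y) =
          -(B.mulVec (resVec n ρ α a ε y)) k := by
        intro k
        rw [coeff_proj_of_mem k.2, hcoeff, invSymbol, if_pos k.2.1, coeff_ofResonant_of_mem]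
        ring
      have h1 := linMatrixAt_mulVec (n := n) a hsupp ⟨k, hk3⟩
      have h2 : (fun k' : resonantModes₂ n => coeff k'.1 (proj (resonantModes₂ n) y)) =
          -(B.mulVec (resVec n ρ α a ε y)) := funext hq
      rw [h2, Matrix.mulVec_neg, Matrix.mulVec_mulVec, hB, Matrix.one_mulVec, Pi.neg_apply] at h1
      rw [divisor_of_mem ρ _ hk, nonlin_torus_add, map_add, map_add, map_add,
        coeff_cubic_of_mem hn hperp a hk3, coeff_torus_of_ne a (ne_basisVec_of_mem hk3), incr_apply,
        map_add, map_smul, coeff_proj_of_notMem (s := (resonantModes n)ᶜ) (fun h => h hk)]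
      rw [resVec] at h1
      dsimp only at h1
      rw [← coeff_proj_of_mem (s := resonantModes₂ n) hk3 y] at h1
      -- The approximate shift belongs to the diagonal of the linearization; the deviation from it
      -- was put into `resVec`.
      have h3 : ∑ j, (k j : ℝ) * (freq n ρ α a ε y j - baseFreq n ρ j) =
          ∑ j, (k j : ℝ) * (freq n ρ α a ε y j - freqApprox n ρ a j) +
          ∑ j, (k j * sqLen (n j) : ℝ) * (2 * a j ^ 2 - 4 * ∑ l, a l ^ 2) := by
        rw [← Finset.sum_add_distrib]
        refine Finset.sum_congr rfl fun j _ => ?_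
        rw [freqApprox]; ring
      rw [h3, smul_zero]
      linarith
  · have hk2 : k ∉ resonantModes₂ n := fun h => hk h.1
    have hk4 : ∀ j, k ≠ basisVec j := fun j h => hk (h ▸ basisVec_mem j)
    have hk5 : k ∈ (resonantModes n)ᶜ := hk
    have hx : coeff k (torus w a + incr n ε y) = ε * coeff k y := by
      rw [map_add, coeff_torus_of_ne a hk4, incr_apply, map_add, map_smul, coeff_proj_of_notMem hk2,
        coeff_proj_of_mem hk5, smul_eq_mul, zero_add, zero_add]
    -- Off the resonant modes the fixed point relation is the equation divided by the divisor.
    rw [hx, hcoeff k, coeff_ofResonant_of_notMem _ hk2, invSymbol, if_neg hk]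
    have := hdiv k hk
    field_simp
    ring

set_option maxHeartbeats 2000000 in
/-- Existence of a solution of the equations for the Fourier coefficients, in terms of
`η = ε^{1/4}` and of an approximate size of the inverse `B` of the linearization. -/
theorem exists_fourier_solution (hn : LinearIndependent ℝ (realVec n))
    (hperp : ∀ i j l : Fin b, i ≠ j → i ≠ l → j ≠ l → (n i - n j) ⬝ᵥ (n i - n l) ≠ 0)
    [DecidableEq (resonantModes₂ n)] (w : Weight (Fin b → ℤ)) {ρ : ℝ} (hρ : IsDiophantine ρ)
    {α : ℕ → ℕ → ℝ} (hα : ∀ l l', l + l' < 5 → α l l' = 0) {R : ℝ} (hR : 0 < R)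
    (hc : ConvergesAt α R) {CB : ℝ} (hCB : 0 < CB) :
    ∃ C η₀ : ℝ, 0 < C ∧ 0 < η₀ ∧ η₀ ≤ 1 ∧ ∀ η : ℝ, 0 < η → η < η₀ → ∀ a : Fin b → ℝ,
      a ∈ Set.Icc (fun _ : Fin b => η ^ 4) (fun _ => 2 * η ^ 4) →
      ∀ B : Matrix (resonantModes₂ n) (resonantModes₂ n) ℝ, linMatrixAt n a * B = 1 →
      (∀ k k', |B k k'| ≤ CB / ((η ^ 4) ^ 2 * η)) →
      ∃ (x : Wiener w) (ω : Fin b → ℝ), ‖x‖ < R / 4 ∧ ‖x - torus w a‖ ≤ 2 * η ^ 6 ∧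
        (∀ j, coeff (basisVec j) x = a j) ∧
        (∀ k, divisor n ρ ω k * coeff k x + symb n k * coeff k (nonlin α x) = 0) ∧
        ∀ j, |ω j - freqApprox n ρ a j| ≤ C * (η ^ 4) ^ 3 := by
  obtain ⟨C₁, η₁, hC₁, hη₁, hη₁', hnl⟩ := exists_nonlin_bounds n w hα hR hc
  obtain ⟨δ₀, C₂, hδ₀, hC₂, hinv⟩ := exists_invSymbol_bound hn hρ
  set N : ℝ := ∑ j, (sqLen (n j) : ℝ) with hN
  have hN0 : ∀ j, (0 : ℝ) ≤ sqLen (n j) := fun j => by exact_mod_cast sqLen_nonneg _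
  have hNj : ∀ j, (sqLen (n j) : ℝ) ≤ N := fun j =>
    Finset.single_le_sum (f := fun j => (sqLen (n j) : ℝ)) (fun j _ => hN0 j) (Finset.mem_univ j)
  have hNpos : 0 ≤ N := Finset.sum_nonneg fun j _ => hN0 j
  set D : ℝ := ∑ k : resonantModes₂ n, (∑ j, |(k.1 j : ℝ)| + symb n k.1) with hD
  have hDterm : ∀ k : resonantModes₂ n, 0 ≤ ∑ j, |(k.1 j : ℝ)| + symb n k.1 := fun k =>
    add_nonneg (Finset.sum_nonneg fun _ _ => abs_nonneg _) (symb_nonneg _)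
  have hDk : ∀ k : resonantModes₂ n, ∑ j, |(k.1 j : ℝ)| + symb n k.1 ≤ D := fun k =>
    Finset.single_le_sum (f := fun k : resonantModes₂ n => ∑ j, |(k.1 j : ℝ)| + symb n k.1)
      (fun k _ => hDterm k) (Finset.mem_univ k)
  have hD1 : ∀ k : resonantModes₂ n, ∑ j, |(k.1 j : ℝ)| ≤ D := fun k => by
    linarith [hDk k, symb_nonneg (n := n) k.1]
  have hD2 : ∀ k : resonantModes₂ n, symb n k.1 ≤ D := fun k => by
    have : 0 ≤ ∑ j, |(k.1 j : ℝ)| := Finset.sum_nonneg fun _ _ => abs_nonneg _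
    linarith [hDk k]
  have hD0 : 0 ≤ D := Finset.sum_nonneg fun k _ => hDterm k
  set W : ℝ := ∑ k : resonantModes₂ n, w k.1 with hW
  have hW0 : 0 ≤ W := Finset.sum_nonneg fun k _ => (w.pos _).le
  set m : ℝ := (Fintype.card (resonantModes₂ n) : ℝ) with hm
  have hm0 : 0 ≤ m := Nat.cast_nonneg _
  set Cω : ℝ := N * C₁ with hCω
  have hCω0 : 0 ≤ Cω := by positivity
  set C₃ : ℝ := D * (Cω + C₁) with hC₃
  set C₃' : ℝ := D * (2 * Cω + C₁) with hC₃'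
  have hC₃0 : 0 ≤ C₃ := by positivity
  have hC₃'0 : 0 ≤ C₃' := by positivity
  -- `T η ≤ 1/2` will give both the self-map property and the contraction property.
  set T : ℝ := C₂ * C₁ + C₂ * Cω * C₁ + W * (m * (CB * C₃)) + W * (m * (CB * C₃')) + 1 with hT
  have hT0 : 0 < T := by positivity
  -- `S η ≤ δ₀` keeps every frequency close enough to the unperturbed one for the bounds on
  -- `invSymbol`.
  set S : ℝ := Cω + N * (16 * b + 8) + 1 with hS
  have hS0 : 0 < S := by positivity
  refine ⟨Cω + 1, min η₁ (min (1 / (2 * T)) (δ₀ / S)), by positivity, by positivity,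
    (min_le_left _ _).trans hη₁', fun η hη hη0 a ha B hB hBbd => ?_⟩
  have hηlt : η < η₁ := hη0.trans_le (min_le_left _ _)
  have hη1 : η ≤ 1 := hηlt.le.trans hη₁'
  have hTη : T * η ≤ 1 / 2 := by
    have h1 := (hη0.trans_le ((min_le_right _ _).trans (min_le_left _ _))).le
    rw [le_div_iff₀ (by positivity)] at h1
    linarith
  have hSη : S * η ≤ δ₀ := by
    have h1 := (hη0.trans_le ((min_le_right _ _).trans (min_le_right _ _))).le
    rw [le_div_iff₀ (by positivity)] at h1
    linarith
  have hpow : ∀ i j : ℕ, i ≤ j → η ^ j ≤ η ^ i := fun i j h => pow_le_pow_of_le_one hη.le hη1 h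
  have hnl' := hnl η hη hηlt a ha
  have hapos : ∀ j, 0 < a j := fun j => lt_of_lt_of_le (by positivity) (ha.1 j)
  have hane : ∀ j, a j ≠ 0 := fun j => (hapos j).ne'
  have hε0 : (η ^ 4) ≠ 0 := by positivity
  -- frequencies
  have hfreqdiv : ∀ (c t : ℝ) (j : Fin b), 0 ≤ t → |c| ≤ t →
      |(sqLen (n j) : ℝ) * c / a j| ≤ N * t / η ^ 4 := by
    intro c t j ht hct
    rw [abs_div, abs_mul, abs_of_nonneg (hN0 j), abs_of_pos (hapos j)]
    exact div_le_div₀ (by positivity) (mul_le_mul (hNj j) hct (abs_nonneg _) hNpos)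
      (by positivity) (ha.1 j)
  have hfreq : ∀ y : Wiener w, ‖y‖ ≤ η ^ 6 → ∀ j,
      |freq n ρ α a (η ^ 4) y j - freqApprox n ρ a j| ≤ Cω * η ^ 12 := by
    intro y hy j
    -- The remainder of size `η^16`, divided by `a_j ≥ η^4`.
    rw [freq_sub_freqApprox hn hperp ρ α _ y (hane j), abs_neg]
    refine (hfreqdiv _ _ j (by positivity)
      ((abs_coeff_le _ _).trans (hnl' y hy).2.2.1)).trans_eq ?_
    rw [hCω]; field_simp
  have hfreqlip : ∀ y y' : Wiener w, ‖y‖ ≤ η ^ 6 → ‖y'‖ ≤ η ^ 6 → ∀ j,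
      |freq n ρ α a (η ^ 4) y j - freq n ρ α a (η ^ 4) y' j| ≤ Cω * η ^ 6 * ‖y - y'‖ := by
    intro y y' hy hy' j
    have e : freq n ρ α a (η ^ 4) y j - freq n ρ α a (η ^ 4) y' j =
        -((sqLen (n j) : ℝ) * coeff (basisVec j)
          (remainder n α a (η ^ 4) y - remainder n α a (η ^ 4) y') / a j) := by
      have h1 := freq_sub_freqApprox hn hperp ρ α (η ^ 4) y (hane j)
      have h2 := freq_sub_freqApprox hn hperp ρ α (η ^ 4) y' (hane j)
      rw [map_sub, mul_sub, sub_div]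
      linarith
    rw [e, abs_neg]
    refine (hfreqdiv _ _ j (by positivity)
      ((abs_coeff_le _ _).trans ((hnl' y hy).2.2.2 y' hy').2)).trans_eq ?_
    rw [hCω]; field_simp
  have happrox : ∀ j, |freqApprox n ρ a j - baseFreq n ρ j| ≤ N * (16 * b + 8) * η ^ 8 := by
    intro j
    have hsq : ∀ l, a l ^ 2 ≤ 4 * η ^ 8 := fun l => by
      calc a l ^ 2 ≤ (2 * η ^ 4) ^ 2 := pow_le_pow_left₀ (hapos l).le (ha.2 l) 2
        _ = _ := by ring
    have hsum : ∑ l, a l ^ 2 ≤ b * (4 * η ^ 8) :=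
      (Finset.sum_le_sum fun l _ => hsq l).trans_eq (by simp)
    have hsum0 : 0 ≤ ∑ l, a l ^ 2 := Finset.sum_nonneg fun l _ => sq_nonneg _
    have e : freqApprox n ρ a j - baseFreq n ρ j =
        -((sqLen (n j) : ℝ) * (4 * ∑ l, a l ^ 2 - 2 * a j ^ 2)) := by rw [freqApprox]; ring
    rw [e, abs_neg, abs_mul, abs_of_nonneg (hN0 j), mul_assoc]
    refine mul_le_mul (hNj j) ?_ (abs_nonneg _) hNpos
    rw [abs_le]
    have := hsq j
    have := sq_nonneg (a j)
    have hb8 : 0 ≤ (b : ℝ) * η ^ 8 := by positivity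
    have h8 : 0 ≤ η ^ 8 := by positivity
    constructor <;> linarith
  have hclose : ∀ y : Wiener w, ‖y‖ ≤ η ^ 6 → ∀ j,
      |freq n ρ α a (η ^ 4) y j - baseFreq n ρ j| ≤ δ₀ := by
    intro y hy j
    have h1 := abs_sub_le (freq n ρ α a (η ^ 4) y j) (freqApprox n ρ a j) (baseFreq n ρ j)
    have h2 := hfreq y hy j
    have h3 := happrox j
    have h4 : η ^ 12 ≤ η := by simpa using hpow 1 12 (by norm_num)
    have h5 : η ^ 8 ≤ η := by simpa using hpow 1 8 (by norm_num)
    have h6 := mul_le_mul_of_nonneg_left h4 hCω0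
    have h7 := mul_le_mul_of_nonneg_left h5 (show 0 ≤ N * (16 * b + 8) by positivity)
    have h8 : S * η = Cω * η + N * (16 * b + 8) * η + η := by rw [hS]; ring
    linarith
  have hsymb : ∀ y : Wiener w, ‖y‖ ≤ η ^ 6 → ∀ k, |invSymbol n ρ (freq n ρ α a (η ^ 4) y) k| ≤ C₂ :=
    fun y hy => (hinv _ (hclose y hy)).2.1
  -- the resonant part
  have hkdot : ∀ (k : resonantModes₂ n) (v : Fin b → ℝ) (t : ℝ), 0 ≤ t → (∀ j, |v j| ≤ t) →
      |∑ j, (k.1 j : ℝ) * v j| ≤ D * t := by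
    intro k v t ht hv
    calc _ ≤ ∑ j, |(k.1 j : ℝ) * v j| := Finset.abs_sum_le_sum_abs _ _
      _ ≤ ∑ j, |(k.1 j : ℝ)| * t := Finset.sum_le_sum fun j _ => by
          rw [abs_mul]; exact mul_le_mul_of_nonneg_left (hv j) (abs_nonneg _)
      _ = (∑ j, |(k.1 j : ℝ)|) * t := by rw [Finset.sum_mul]
      _ ≤ D * t := mul_le_mul_of_nonneg_right (hD1 k) ht
  have hres : ∀ y : Wiener w, ‖y‖ ≤ η ^ 6 → ∀ k, |resVec n ρ α a (η ^ 4) y k| ≤ C₃ * η ^ 16 := by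
    intro y hy k
    have h1 := hkdot k _ _ (by positivity) (hfreq y hy)
    have h2 := (abs_coeff_le k.1 y).trans hy
    have h3 := (abs_coeff_le k.1 _).trans (hnl' y hy).2.2.1
    rw [resVec]
    refine (abs_add_le _ _).trans ?_
    rw [abs_mul, abs_mul, abs_of_nonneg (symb_nonneg _)]
    refine (add_le_add (mul_le_mul h1 h2 (abs_nonneg _) (by positivity))
      (mul_le_mul (hD2 k) h3 (abs_nonneg _) hD0)).trans ?_
    have h4 := mul_le_mul_of_nonneg_left (hpow 16 18 (by norm_num)) (mul_nonneg hD0 hCω0)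
    have e : D * (Cω * η ^ 12) * η ^ 6 + D * (C₁ * η ^ 16) =
        D * Cω * η ^ 18 + D * C₁ * η ^ 16 := by ring
    rw [e, hC₃]; linarith
  have hreslip : ∀ y y' : Wiener w, ‖y‖ ≤ η ^ 6 → ‖y'‖ ≤ η ^ 6 → ∀ k,
      |(resVec n ρ α a (η ^ 4) y - resVec n ρ α a (η ^ 4) y') k| ≤
        C₃' * η ^ 10 * ‖y - y'‖ := by
    intro y y' hy hy' k
    have hn0 := norm_nonneg (y - y')
    have h1 := hkdot k _ _ (by positivity) (hfreq y hy)
    have h2 := abs_coeff_le k.1 (y - y')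
    have h3 := hkdot k _ _ (by positivity) (hfreqlip y y' hy hy')
    have h4 := (abs_coeff_le k.1 y').trans hy'
    have h5 := (abs_coeff_le k.1 _).trans ((hnl' y hy).2.2.2 y' hy').2
    have e : (resVec n ρ α a (η ^ 4) y - resVec n ρ α a (η ^ 4) y') k =
        (∑ j, (k.1 j : ℝ) * (freq n ρ α a (η ^ 4) y j - freqApprox n ρ a j)) *
          coeff k.1 (y - y') +
        (∑ j, (k.1 j : ℝ) * (freq n ρ α a (η ^ 4) y j - freq n ρ α a (η ^ 4) y' j)) *
          coeff k.1 y' +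
        symb n k.1 * coeff k.1 (remainder n α a (η ^ 4) y - remainder n α a (η ^ 4) y') := by
      simp only [Pi.sub_apply, resVec, map_sub, mul_sub, Finset.sum_sub_distrib]
      ring
    rw [e]
    refine (abs_add_three _ _ _).trans ?_
    rw [abs_mul, abs_mul, abs_mul, abs_of_nonneg (symb_nonneg _)]
    refine (add_le_add (add_le_add (mul_le_mul h1 h2 (abs_nonneg _) (by positivity))
      (mul_le_mul h3 h4 (abs_nonneg _) (by positivity)))
      (mul_le_mul (hD2 k) h5 (abs_nonneg _) hD0)).trans ?_
    have e2 : D * (Cω * η ^ 12) * ‖y - y'‖ + D * (Cω * η ^ 6 * ‖y - y'‖) * η ^ 6 +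
        D * (C₁ * η ^ 10 * ‖y - y'‖) =
        (2 * (D * Cω) * η ^ 12 + D * C₁ * η ^ 10) * ‖y - y'‖ := by ring
    rw [e2]
    refine mul_le_mul_of_nonneg_right ?_ hn0
    have h6 := mul_le_mul_of_nonneg_left (hpow 10 12 (by norm_num)) (mul_nonneg hD0 hCω0)
    rw [hC₃']; linarith
  have hBpos : 0 ≤ CB / ((η ^ 4) ^ 2 * η) := by positivity
  -- the fixed point
  obtain ⟨y, hy, hfix⟩ := exists_fixedPoint_of_contracting_ball
    (fixMap n ρ α C₂ a (η ^ 4) B : Wiener w → Wiener w) (r := η ^ 6) (by positivity)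
    (fun y hy => by
      have h1 := norm_invOp_le (w := w) (hsymb y hy) (nonlin α (torus w a + incr n (η ^ 4) y))
      have h2 := norm_ofResonant_le (w := w) (abs_mulVec_le hBbd (hres y hy) hBpos)
      have h3 := mul_le_mul_of_nonneg_left (hnl' y hy).2.1 hC₂.le
      rw [fixMap]
      refine (norm_sub_le _ _).trans ?_
      rw [norm_neg, norm_smul, norm_inv, Real.norm_of_nonneg (by positivity : (0 : ℝ) ≤ η ^ 4)]
      refine (add_le_add (mul_le_mul_of_nonneg_left (h1.trans h3) (by positivity)) h2).trans ?_
      -- The nonresonant part is of size `η^{-4} η^12`, the resonant part of size `η^{-9} η^16`;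
      -- both gain at least one factor `η` over the radius `η^6`.
      have e : (η ^ 4)⁻¹ * (C₂ * (C₁ * η ^ 12)) +
          W * (m * (CB / ((η ^ 4) ^ 2 * η) * (C₃ * η ^ 16))) =
          (C₂ * C₁) * η ^ 8 + (W * (m * (CB * C₃))) * η ^ 7 := by field_simp
      rw [e]
      have h4 := mul_le_mul_of_nonneg_left (hpow 7 8 (by norm_num)) (mul_nonneg hC₂.le hC₁.le)
      calc _ ≤ (C₂ * C₁ + W * (m * (CB * C₃))) * η ^ 7 := by linarith
        _ ≤ T * η ^ 7 := by
            refine mul_le_mul_of_nonneg_right ?_ (by positivity)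
            have : 0 ≤ C₂ * Cω * C₁ := by positivity
            have : 0 ≤ W * (m * (CB * C₃')) := by positivity
            rw [hT]; linarith
        _ = (T * η) * η ^ 6 := by ring
        _ ≤ 1 * η ^ 6 := by gcongr; linarith
        _ = _ := one_mul _)
    (fun y y' hy hy' => by
      have hn0 := norm_nonneg (y - y')
      have hs := hsymb y hy
      have hs' := hsymb y' hy'
      have hd := (hinv _ (hclose y hy)).2.2 _ (hclose y' hy') (Cω * η ^ 6 * ‖y - y'‖)
        (by positivity) (hfreqlip y y' hy hy')
      set F := nonlin α (torus w a + incr n (η ^ 4) y)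
      set F' := nonlin α (torus w a + incr n (η ^ 4) y')
      set O := invOp w n ρ C₂ (freq n ρ α a (η ^ 4) y)
      set O' := invOp w n ρ C₂ (freq n ρ α a (η ^ 4) y')
      -- The operator itself depends on `y` through the frequency, so the difference is split into
      -- `O (F - F')` and `(O - O') F'`.
      have e : fixMap n ρ α C₂ a (η ^ 4) B y - fixMap n ρ α C₂ a (η ^ 4) B y' =
          -((η ^ 4)⁻¹ • (O (F - F') + (O F' - O' F'))) -
          ofResonant w (B.mulVec (resVec n ρ α a (η ^ 4) y - resVec n ρ α a (η ^ 4) y')) := by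
        rw [Matrix.mulVec_sub, ofResonant_sub, map_sub, fixMap, fixMap]
        module
      rw [e]
      have h1 : ‖O (F - F')‖ ≤ C₂ * (C₁ * η ^ 8 * ‖y - y'‖) :=
        (norm_invOp_le hs _).trans
          (mul_le_mul_of_nonneg_left ((hnl' y hy).2.2.2 y' hy').1 hC₂.le)
      have h2 : ‖O F' - O' F'‖ ≤ C₂ * (Cω * η ^ 6 * ‖y - y'‖) * (C₁ * η ^ 12) :=
        (norm_invOp_sub_le hs hs' hd F').trans
          (mul_le_mul_of_nonneg_left (hnl' y' hy').2.1 (by positivity))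
      have h3 := norm_ofResonant_le (w := w) (abs_mulVec_le hBbd (hreslip y y' hy hy') hBpos)
      refine (norm_sub_le _ _).trans ?_
      rw [norm_neg, norm_smul, norm_inv, Real.norm_of_nonneg (by positivity : (0 : ℝ) ≤ η ^ 4)]
      refine (add_le_add (mul_le_mul_of_nonneg_left
        ((norm_add_le _ _).trans (add_le_add h1 h2)) (by positivity)) h3).trans ?_
      -- The critical term is the resonant one, `η^{-9} η^10 = η`.
      have e2 : (η ^ 4)⁻¹ * (C₂ * (C₁ * η ^ 8 * ‖y - y'‖) +
          C₂ * (Cω * η ^ 6 * ‖y - y'‖) * (C₁ * η ^ 12)) +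
          W * (m * (CB / ((η ^ 4) ^ 2 * η) * (C₃' * η ^ 10 * ‖y - y'‖))) =
          ((C₂ * C₁) * η ^ 4 + (C₂ * Cω * C₁) * η ^ 14 + (W * (m * (CB * C₃'))) * η) *
            ‖y - y'‖ := by field_simp
      rw [e2]
      refine mul_le_mul_of_nonneg_right ?_ hn0
      have h4 : η ^ 4 ≤ η := by simpa using hpow 1 4 (by norm_num)
      have h5 : η ^ 14 ≤ η := by simpa using hpow 1 14 (by norm_num)
      have h6 := mul_le_mul_of_nonneg_left h4 (show 0 ≤ C₂ * C₁ by positivity)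
      have h7 := mul_le_mul_of_nonneg_left h5 (show 0 ≤ C₂ * Cω * C₁ by positivity)
      have h8 : 0 ≤ W * (m * (CB * C₃)) * η := by positivity
      have h9 : T * η = C₂ * C₁ * η + C₂ * Cω * C₁ * η + W * (m * (CB * C₃)) * η +
          W * (m * (CB * C₃')) * η + η := by rw [hT]; ring
      linarith)
  obtain ⟨htan, heq⟩ := equation_of_fixedPoint hn hperp hε0 hane hB hfix
    (hinv _ (hclose y hy)).1 (hsymb y hy)
  refine ⟨torus w a + incr n (η ^ 4) y, freq n ρ α a (η ^ 4) y, (hnl' y hy).1, ?_, htan, heq,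
    fun j => ?_⟩
  · rw [add_sub_cancel_left]
    refine (norm_incr_le (by positivity) (by simpa using hpow 0 4 (by norm_num)) y).trans ?_
    linarith
  · refine (hfreq y hy j).trans ?_
    have e : (η ^ 4) ^ 3 = η ^ 12 := by ring
    rw [e]
    exact mul_le_mul_of_nonneg_right (by linarith) (by positivity)

end FixedPoint

/-! ### The exponential weight -/

section ExpWeight

variable {b d : ℕ}

/-- The `ℓ¹` length of an integer vector. -/
noncomputable def absSum (k : Fin b → ℤ) : ℝ := ∑ j, |(k j : ℝ)|

theorem absSum_nonneg (k : Fin b → ℤ) : 0 ≤ absSum k := Finset.sum_nonneg fun _ _ => abs_nonneg _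

theorem absSum_add_le (j k : Fin b → ℤ) : absSum (j + k) ≤ absSum j + absSum k := by
  rw [absSum, absSum, absSum, ← Finset.sum_add_distrib]
  refine Finset.sum_le_sum fun i _ => ?_
  rw [Pi.add_apply, Int.cast_add]
  exact abs_add_le _ _

/-- The weight `e^{μ |k|_1}`. -/
noncomputable def expWeight {μ : ℝ} (hμ : 0 ≤ μ) : Weight (Fin b → ℤ) where
  toFun k := Real.exp (μ * absSum k)
  one_le k := Real.one_le_exp (mul_nonneg hμ (absSum_nonneg k))
  map_zero := by simp [absSum]
  map_neg k := by simp [absSum]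
  map_add_le j k := by
    rw [← Real.exp_add, ← mul_add]
    exact Real.exp_le_exp.2 (mul_le_mul_of_nonneg_left (absSum_add_le j k) hμ)

theorem expWeight_apply {μ : ℝ} (hμ : 0 ≤ μ) (k : Fin b → ℤ) :
    expWeight hμ k = Real.exp (μ * absSum k) := rfl

theorem sq_one_add_le_exp {μ L y : ℝ} (hμ : 0 < μ) (hL : 0 ≤ L) (hy : 0 ≤ y) :
    (1 + L * y) ^ 2 ≤ (1 + 2 * L / μ) ^ 2 * Real.exp (μ * y) := by
  have h1 : 1 + L * y ≤ (1 + 2 * L / μ) * Real.exp (μ * y / 2) := by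
    have h2 := Real.add_one_le_exp (μ * y / 2)
    have h3 : (1 + 2 * L / μ) * (μ * y / 2 + 1) = 1 + L * y + (2 * L / μ + μ * y / 2) := by
      field_simp; ring
    have h4 : 0 ≤ 2 * L / μ + μ * y / 2 := by positivity
    calc 1 + L * y ≤ (1 + 2 * L / μ) * (μ * y / 2 + 1) := by rw [h3]; linarith
      _ ≤ _ := mul_le_mul_of_nonneg_left h2 (by positivity)
  calc (1 + L * y) ^ 2 ≤ ((1 + 2 * L / μ) * Real.exp (μ * y / 2)) ^ 2 :=
        pow_le_pow_left₀ (by positivity) h1 2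
    _ = _ := by
        rw [mul_pow, ← Real.exp_nat_mul]; congr 2; push_cast; ring

theorem exists_rpow_le_exp (s : ℝ) (hs : 0 ≤ s) :
    ∃ C : ℝ, 0 < C ∧ ∀ y : ℝ, 0 ≤ y → y ^ s ≤ C * Real.exp y := by
  refine ⟨(⌈s⌉₊.factorial : ℝ) * Real.exp 1, by positivity, fun y hy => ?_⟩
  have h1 := Real.pow_div_factorial_le_exp (1 + y) (by positivity) ⌈s⌉₊
  rw [div_le_iff₀ (by positivity), Real.exp_add] at h1
  calc y ^ s ≤ (1 + y) ^ s := Real.rpow_le_rpow hy (by linarith) hs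
    _ ≤ (1 + y) ^ (⌈s⌉₊ : ℝ) := Real.rpow_le_rpow_of_exponent_le (by linarith) (Nat.le_ceil s)
    _ = (1 + y) ^ ⌈s⌉₊ := Real.rpow_natCast _ _
    _ ≤ _ := by linarith

variable {n : Fin b → Fin d → ℤ}

theorem exists_sum_abs_momentum_le (n : Fin b → Fin d → ℤ) :
    ∃ L : ℝ, 0 ≤ L ∧ ∀ k, ∑ i, |(momentum n k i : ℝ)| ≤ L * absSum k := by
  refine ⟨∑ i, ∑ j, |(n j i : ℝ)|, by positivity, fun k => ?_⟩
  rw [Finset.sum_mul]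
  refine Finset.sum_le_sum fun i _ => ?_
  have h1 : (momentum n k i : ℝ) = ∑ j, (k j : ℝ) * n j i := by
    simp [momentum, Finset.sum_apply]
  rw [h1]
  refine (Finset.abs_sum_le_sum_abs _ _).trans ?_
  rw [Finset.sum_mul]
  refine Finset.sum_le_sum fun j _ => ?_
  rw [abs_mul, mul_comm]
  exact mul_le_mul_of_nonneg_left (Finset.single_le_sum (f := fun j => |(k j : ℝ)|)
    (fun _ _ => abs_nonneg _) (Finset.mem_univ j)) (abs_nonneg _)

theorem sqLen_le_sq_sum {m : ℕ} (v : Fin m → ℤ) : (sqLen v : ℝ) ≤ (∑ i, |(v i : ℝ)|) ^ 2 := by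
  have : (sqLen v : ℝ) = ∑ i, |(v i : ℝ)| ^ 2 := by
    rw [sqLen]; push_cast; exact Finset.sum_congr rfl fun i _ => (sq_abs _).symm
  rw [this]
  exact Finset.sum_sq_le_sq_sum_of_nonneg fun i _ => abs_nonneg _

/-- The weights in the definition of persistence are dominated by an exponential weight. -/
theorem exists_weight_le (n : Fin b → Fin d → ℤ) {s σ : ℝ} (hs : 0 ≤ s) (hσ : 0 < σ) :
    ∃ (μ C : ℝ) (hμ : 0 < μ), 0 < C ∧ ∀ k : Fin b → ℤ,
      freqNorm (momentum n k, k) ^ s * Real.exp (σ * freqNorm (momentum n k, k)) ≤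
        C * expWeight hμ.le k := by
  obtain ⟨L, hL, hmom⟩ := exists_sum_abs_momentum_le n
  obtain ⟨C, hC, hexp⟩ := exists_rpow_le_exp s hs
  -- The norm of `(n,k)` on the graph is at most `(L + 1)|k|_1`, and the power of order `s` is
  -- absorbed by raising `σ` to `σ + 1`.
  refine ⟨(σ + 1) * (L + 1), C, by positivity, hC, fun k => ?_⟩
  set f := freqNorm (momentum n k, k) with hf
  have hf0 : 0 ≤ f := Real.sqrt_nonneg _
  have hfle : f ≤ (L + 1) * absSum k := by
    have h0 := absSum_nonneg k
    refine Real.sqrt_le_iff.2 ⟨by positivity, ?_⟩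
    have h1 := sqLen_le_sq_sum (momentum n k)
    have h2 := sqLen_le_sq_sum k
    have h3 : (∑ i, |(momentum n k i : ℝ)|) ^ 2 ≤ (L * absSum k) ^ 2 :=
      pow_le_pow_left₀ (Finset.sum_nonneg fun _ _ => abs_nonneg _) (hmom k) 2
    push_cast
    change _ ≤ (absSum k) ^ 2 at h2
    have h4 : 0 ≤ L * absSum k * absSum k := by positivity
    nlinarith
  rw [expWeight_apply]
  calc f ^ s * Real.exp (σ * f) ≤ C * Real.exp f * Real.exp (σ * f) :=
        mul_le_mul_of_nonneg_right (hexp f hf0) (Real.exp_pos _).le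
    _ = C * Real.exp ((σ + 1) * f) := by rw [mul_assoc, ← Real.exp_add]; congr 2; ring
    _ ≤ _ := by
        refine mul_le_mul_of_nonneg_left (Real.exp_le_exp.2 ?_) hC.le
        rw [mul_assoc]
        exact mul_le_mul_of_nonneg_left hfle (by linarith)

end ExpWeight

/-! ### From Fourier coefficients to solutions -/

section Solution

open Wiener

variable {b d : ℕ} {n : Fin b → Fin d → ℤ}

/-- The phase `(∑ k_j n_j)·x + (k·ω) t`. -/
noncomputable def phase (n : Fin b → Fin d → ℤ) (ω : Fin b → ℝ) (k : Fin b → ℤ) :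
    EuclideanSpace ℝ (Fin d) × ℝ →L[ℝ] ℝ :=
  (dotForm fun i => (momentum n k i : ℝ)).comp (ContinuousLinearMap.fst ℝ _ _) +
    (∑ j, (k j : ℝ) * ω j) • ContinuousLinearMap.snd ℝ _ _

theorem phase_apply (ω : Fin b → ℝ) (k : Fin b → ℤ) (z : EuclideanSpace ℝ (Fin d) × ℝ) :
    phase n ω k z = ∑ i, (momentum n k i : ℝ) * z.1 i + (∑ j, (k j : ℝ) * ω j) * z.2 := by
  simp [phase, dotForm_apply]

theorem phase_add (ω : Fin b → ℝ) (k k' : Fin b → ℤ) (z : EuclideanSpace ℝ (Fin d) × ℝ) :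
    phase n ω (k + k') z = phase n ω k z + phase n ω k' z := by
  simp only [phase_apply, momentum_add, Pi.add_apply, Int.cast_add, add_mul,
    Finset.sum_add_distrib]
  ring

theorem phase_neg (ω : Fin b → ℝ) (k : Fin b → ℤ) (z : EuclideanSpace ℝ (Fin d) × ℝ) :
    phase n ω (-k) z = -phase n ω k z := by
  simp only [phase_apply, momentum_neg, Pi.neg_apply, Int.cast_neg, neg_mul,
    Finset.sum_neg_distrib]
  ring

/-- The character of `ℤ^b` given by evaluation at a point of space-time. -/
noncomputable def char (n : Fin b → Fin d → ℤ) (ω : Fin b → ℝ)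
    (z : EuclideanSpace ℝ (Fin d) × ℝ) (k : Fin b → ℤ) : ℂ := wave (phase n ω k) z

theorem norm_char (ω : Fin b → ℝ) (z : EuclideanSpace ℝ (Fin d) × ℝ) (k : Fin b → ℤ) :
    ‖char n ω z k‖ = 1 := norm_wave _ _

theorem char_add (ω : Fin b → ℝ) (z : EuclideanSpace ℝ (Fin d) × ℝ) (k k' : Fin b → ℤ) :
    char n ω z (k + k') = char n ω z k * char n ω z k' := by
  rw [char, char, char, wave, wave, wave, ← Complex.exp_add, phase_add]
  push_cast
  ring_nf

theorem char_zero (ω : Fin b → ℝ) (z : EuclideanSpace ℝ (Fin d) × ℝ) : char n ω z 0 = 1 := by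
  have : phase n ω 0 z = 0 := by simp [phase_apply, momentum]
  rw [char, wave, this]; simp

theorem char_neg (ω : Fin b → ℝ) (z : EuclideanSpace ℝ (Fin d) × ℝ) (k : Fin b → ℤ) :
    char n ω z (-k) = starRingEnd ℂ (char n ω z k) := by
  rw [char, char, wave, wave, phase_neg, ← Complex.exp_conj]
  simp

variable {w : Weight (Fin b → ℤ)}

/-- The function on space-time with given Fourier coefficients. -/
noncomputable def field (n : Fin b → Fin d → ℤ) (ω : Fin b → ℝ) (x : Wiener w)
    (z : EuclideanSpace ℝ (Fin d) × ℝ) : ℂ := evalChar (char n ω z) (norm_char ω z) x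

theorem hasSum_field (ω : Fin b → ℝ) (x : Wiener w) (z : EuclideanSpace ℝ (Fin d) × ℝ) :
    HasSum (fun k => (coeff k x : ℂ) * char n ω z k) (field n ω x z) :=
  evalChar_hasSum _ x

theorem field_eq_trigSeries (ω : Fin b → ℝ) (x : Wiener w) :
    field n ω x = trigSeries (fun k => (coeff k x : ℂ)) (phase n ω) :=
  funext fun z => (hasSum_field ω x z).tsum_eq.symm

/-- Evaluation at a point is a continuous homomorphism that turns `reflect` into conjugation, and
`‖x‖ < R / 4` bounds the function uniformly by `R / 4`, where the derivative of `H` is given by its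
series. -/
theorem field_nonlin {α : ℕ → ℕ → ℝ} (hα : ∀ l l', l + l' < 5 → α l l' = 0) {R : ℝ}
    (hR : 0 < R) (hc : ConvergesAt α R) (ω : Fin b → ℝ) {x : Wiener w} (hx : ‖x‖ < R / 4)
    (z : EuclideanSpace ℝ (Fin d) × ℝ) :
    field n ω (nonlin α x) z = dbarH α (field n ω x z) := by
  have hmul := evalChar_mul (w := w) (norm_char (n := n) ω z) (char_add ω z)
  have hone := evalChar_one (w := w) (norm_char (n := n) ω z) (char_zero ω z)
  have hrefl := evalChar_reflect (w := w) (norm_char (n := n) ω z) (char_neg ω z) x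
  have hle : ‖field n ω x z‖ < R / 4 := (norm_evalChar_le _ x).trans_lt hx
  rw [dbarH_eq hα hR hc hle]
  change evalChar _ (norm_char ω z) _ = _
  rw [nonlin, map_add, map_higherOrder hα hR hc hx.le ((norm_reflect_le x).trans hx.le) _ hone hmul,
    hrefl, cubic, two_mul, map_add, hmul, hmul, hrefl]
  change _ + higherOrder α (field n ω x z) _ = _
  congr 1
  change field n ω x z * field n ω x z * starRingEnd ℂ (field n ω x z) +
    field n ω x z * field n ω x z * starRingEnd ℂ (field n ω x z) = _
  ring

/-- A submultiplicative weight growing faster than the squares of the phases. -/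
def Dominates (w : Weight (Fin b → ℤ)) : Prop :=
  ∀ L : ℝ, 0 ≤ L → ∃ C : ℝ, ∀ k, (1 + L * absSum k) ^ 2 ≤ C * w k

theorem dominates_expWeight {μ : ℝ} (hμ : 0 < μ) : Dominates (b := b) (expWeight hμ.le) :=
  fun L hL => ⟨(1 + 2 * L / μ) ^ 2, fun k => sq_one_add_le_exp hμ hL (absSum_nonneg k)⟩

/-- Two derivatives cost at most `(1 + L|k|_1)²`, which the weight dominates. This is the source of
the classical regularity. -/
theorem summable_of_dominates (hw : Dominates w) (x : Wiener w) {L : ℝ} (hL : 0 ≤ L)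
    {c : (Fin b → ℤ) → ℂ} {g : (Fin b → ℤ) → ℝ} (hc : ∀ k, ‖c k‖ = |coeff k x|)
    (hg0 : ∀ k, 0 ≤ g k) (hg : ∀ k, g k ≤ L * absSum k) :
    Summable fun k => ‖c k‖ * (1 + g k) ^ 2 := by
  obtain ⟨C, hC⟩ := hw L hL
  refine Summable.of_nonneg_of_le (fun k => by positivity) (fun k => ?_)
    ((hasSum_norm x).summable.mul_left C)
  rw [hc]
  have h1 : (1 + g k) ^ 2 ≤ (1 + L * absSum k) ^ 2 :=
    pow_le_pow_left₀ (by linarith [hg0 k]) (by linarith [hg k]) 2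
  calc |coeff k x| * (1 + g k) ^ 2 ≤ |coeff k x| * (C * w k) :=
        mul_le_mul_of_nonneg_left (h1.trans (hC k)) (abs_nonneg _)
    _ = _ := by ring

theorem exists_abs_freq_le (ω : Fin b → ℝ) :
    ∃ L : ℝ, 0 ≤ L ∧ ∀ k : Fin b → ℤ, |∑ j, (k j : ℝ) * ω j| ≤ L * absSum k := by
  refine ⟨∑ j, |ω j|, by positivity, fun k => (Finset.abs_sum_le_sum_abs _ _).trans ?_⟩
  rw [absSum, Finset.mul_sum]
  refine Finset.sum_le_sum fun j _ => ?_
  rw [abs_mul, mul_comm]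
  exact mul_le_mul_of_nonneg_right (Finset.single_le_sum (f := fun j => |ω j|)
    (fun _ _ => abs_nonneg _) (Finset.mem_univ j)) (abs_nonneg _)

theorem exists_norm_phase_le (n : Fin b → Fin d → ℤ) (ω : Fin b → ℝ) :
    ∃ L : ℝ, 0 ≤ L ∧ ∀ k, ‖phase n ω k‖ ≤ L * absSum k := by
  obtain ⟨L₁, hL₁, h₁⟩ := exists_sum_abs_momentum_le n
  obtain ⟨L₂, hL₂, h₂⟩ := exists_abs_freq_le ω
  refine ⟨L₁ + L₂, by positivity, fun k => ?_⟩
  rw [phase, add_mul]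
  refine (norm_add_le _ _).trans (add_le_add ?_ ?_)
  · refine (ContinuousLinearMap.opNorm_comp_le _ _).trans ?_
    refine (mul_le_of_le_one_right (norm_nonneg _) (ContinuousLinearMap.norm_fst_le ..)).trans ?_
    exact (norm_dotForm_le _).trans (h₁ k)
  · rw [norm_smul, Real.norm_eq_abs]
    exact (mul_le_of_le_one_right (abs_nonneg _) (ContinuousLinearMap.norm_snd_le ..)).trans (h₂ k)

theorem contDiff_field (hw : Dominates w) (ω : Fin b → ℝ) (x : Wiener w) :
    ContDiff ℝ 2 (field n ω x) := by
  obtain ⟨L, hL, h⟩ := exists_norm_phase_le n ω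
  rw [field_eq_trigSeries]
  exact contDiff_trigSeries (summable_of_dominates hw x hL
    (fun k => by rw [Complex.norm_real, Real.norm_eq_abs]) (fun _ => norm_nonneg _) h)

theorem char_eq_mul (ω : Fin b → ℝ) (x : EuclideanSpace ℝ (Fin d)) (t : ℝ) (k : Fin b → ℤ) :
    char n ω (x, t) k = wave (dotForm fun i => (momentum n k i : ℝ)) x *
      Complex.exp (Complex.I * ((∑ j, (k j : ℝ) * ω j) * t : ℝ)) := by
  rw [char, wave, wave, ← Complex.exp_add, phase_apply, dotForm_apply]
  push_cast
  ring_nf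

theorem hasSum_laplacian_field (hw : Dominates w) (ω : Fin b → ℝ) (x : Wiener w)
    (y : EuclideanSpace ℝ (Fin d)) (t : ℝ) :
    HasSum (fun k => -(symb n k : ℂ) * ((coeff k x : ℂ) * char n ω (y, t) k))
      (Laplacian.laplacian (fun y => field n ω x (y, t)) y) := by
  obtain ⟨L, hL, h⟩ := exists_sum_abs_momentum_le n
  have hexp : ∀ k : Fin b → ℤ,
      ‖Complex.exp (Complex.I * ((∑ j, (k j : ℝ) * ω j) * t : ℝ))‖ = 1 := fun k => by
    rw [mul_comm, Complex.norm_exp_ofReal_mul_I]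
  have hfun : (fun y => field n ω x (y, t)) = trigSeries
      (fun k => (coeff k x : ℂ) * Complex.exp (Complex.I * ((∑ j, (k j : ℝ) * ω j) * t : ℝ)))
      (fun k => dotForm fun i => (momentum n k i : ℝ)) := by
    funext y
    rw [← (hasSum_field ω x (y, t)).tsum_eq, trigSeries]
    exact tsum_congr fun k => by rw [char_eq_mul]; ring
  rw [hfun]
  have h1 := hasSum_laplacian_trigSeries (ν := fun k i => (momentum n k i : ℝ))
    (c := fun k => (coeff k x : ℂ) * Complex.exp (Complex.I * ((∑ j, (k j : ℝ) * ω j) * t : ℝ)))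
    (summable_of_dominates hw x hL
      (fun k => by rw [norm_mul, hexp, mul_one, Complex.norm_real, Real.norm_eq_abs])
      (fun _ => norm_nonneg _) fun k => (norm_dotForm_le _).trans (h k)) y
  refine h1.congr_fun fun k => ?_
  rw [char_eq_mul]
  have : (∑ i, (momentum n k i : ℝ) ^ 2 : ℝ) = symb n k := by
    rw [symb, sqLen]; push_cast; rfl
  rw [this]
  ring

theorem hasSum_deriv_field (hw : Dominates w) (ω : Fin b → ℝ) (x : Wiener w)
    (y : EuclideanSpace ℝ (Fin d)) (t : ℝ) :
    HasSum (fun k => Complex.I * ((∑ j, (k j : ℝ) * ω j : ℝ) : ℂ) *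
        ((coeff k x : ℂ) * char n ω (y, t) k))
      (deriv (fun τ => field n ω x (y, τ)) t) := by
  obtain ⟨L, hL, h⟩ := exists_abs_freq_le ω
  set c : (Fin b → ℤ) → ℂ := fun k =>
    (coeff k x : ℂ) * wave (dotForm fun i => (momentum n k i : ℝ)) y with hc
  have hnorm : ∀ k, ‖c k‖ = |coeff k x| := fun k => by
    rw [hc, norm_mul, norm_wave, mul_one, Complex.norm_real, Real.norm_eq_abs]
  have hs2 := summable_of_dominates hw x hL hnorm (g := fun k => |∑ j, (k j : ℝ) * ω j|)
    (fun _ => abs_nonneg _) h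
  have hs1 : Summable fun k => ‖c k‖ * (1 + |∑ j, (k j : ℝ) * ω j|) := by
    refine Summable.of_nonneg_of_le (fun k => by positivity) (fun k => ?_) hs2
    refine mul_le_mul_of_nonneg_left ?_ (norm_nonneg _)
    nlinarith [abs_nonneg (∑ j, (k j : ℝ) * ω j)]
  have hfun : (fun τ => field n ω x (y, τ)) = fun τ : ℝ =>
      ∑' k, c k * Complex.exp (Complex.I * ((∑ j, (k j : ℝ) * ω j) * τ : ℝ)) := by
    funext τ
    rw [← (hasSum_field ω x (y, τ)).tsum_eq]
    exact tsum_congr fun k => by rw [char_eq_mul, hc]; ring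
  have hterm : ∀ k, Complex.I * ((∑ j, (k j : ℝ) * ω j : ℝ) : ℂ) *
      (c k * Complex.exp (Complex.I * ((∑ j, (k j : ℝ) * ω j) * t : ℝ))) =
      Complex.I * ((∑ j, (k j : ℝ) * ω j : ℝ) : ℂ) * ((coeff k x : ℂ) * char n ω (y, t) k) :=
    fun k => by rw [char_eq_mul, hc]; ring
  rw [hfun, (hasDerivAt_tsum_wave hs1 t).deriv]
  simp only [hterm]
  refine Summable.hasSum (Summable.of_norm_bounded hs1 fun k => ?_)
  rw [norm_mul, norm_mul, norm_mul, norm_char, Complex.norm_I, Complex.norm_real, Complex.norm_real,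
    Real.norm_eq_abs, Real.norm_eq_abs, hnorm]
  nlinarith [abs_nonneg (coeff k x), abs_nonneg (∑ j, (k j : ℝ) * ω j)]

/-- Fourier coefficients solving the algebraic equations give a classical solution. -/
theorem isSolution_field {ρ : ℝ} {α : ℕ → ℕ → ℝ} (hα : ∀ l l', l + l' < 5 → α l l' = 0) {R : ℝ}
    (hR : 0 < R) (hc : ConvergesAt α R) (hw : Dominates w) (ω : Fin b → ℝ) {x : Wiener w}
    (hx : ‖x‖ < R / 4)
    (heq : ∀ k, divisor n ρ ω k * coeff k x + symb n k * coeff k (nonlin α x) = 0) :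
    IsSolution ρ α fun y t => field n ω x (y, t) where
  contDiff := contDiff_field hw ω x
  periodic y t m := by
    have hchar : ∀ k, char n ω (y + WithLp.toLp 2 fun i => 2 * Real.pi * (m i : ℝ), t) k =
        char n ω (y, t) k := by
      intro k
      -- The spatial frequencies are integer vectors, so a lattice translation changes the phase by
      -- an integer multiple of `2π`.
      have h1 : phase n ω k (y + WithLp.toLp 2 fun i => 2 * Real.pi * (m i : ℝ), t) =
          phase n ω k (y, t) + 2 * Real.pi * ((∑ i, momentum n k i * m i : ℤ) : ℝ) := by
        simp only [phase_apply, PiLp.add_apply, mul_add, Finset.sum_add_distrib]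
        push_cast
        rw [Finset.mul_sum]
        have : ∀ i, (momentum n k i : ℝ) * (2 * Real.pi * (m i : ℝ)) =
            2 * Real.pi * ((momentum n k i : ℝ) * m i) := fun i => by ring
        simp only [this]
        ring
      rw [char, char, wave, wave, h1]
      have h2 : Complex.I * ((phase n ω k (y, t) +
          2 * Real.pi * ((∑ i, momentum n k i * m i : ℤ) : ℝ) : ℝ) : ℂ) =
          Complex.I * (phase n ω k (y, t) : ℂ) +
            ((∑ i, momentum n k i * m i : ℤ) : ℂ) * (2 * Real.pi * Complex.I) := by
        push_cast; ring
      rw [h2, Complex.exp_add, Complex.exp_int_mul_two_pi_mul_I, mul_one]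
    refine (hasSum_field ω x _).unique ?_
    simp only [hchar]
    exact hasSum_field ω x (y, t)
  mem_disc y t := ⟨R, ((norm_evalChar_le _ x).trans_lt hx).trans (by linarith), hc⟩
  equation y t := by
    have h1 := (hasSum_deriv_field (n := n) hw ω x y t).mul_left Complex.I
    have h2 := hasSum_laplacian_field (n := n) hw ω x y t
    have h3 := (hasSum_field (n := n) ω x (y, t)).mul_left (ρ : ℂ)
    have h4 := hasSum_laplacian_field (n := n) hw ω (nonlin α x) y t
    have h5 := ((h1.sub h2).add h3).add h4
    have h6 : (fun y => field n ω (nonlin α x) (y, t)) =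
        fun y => dbarH α (field n ω x (y, t)) :=
      funext fun y => field_nonlin hα hR hc ω hx (y, t)
    rw [h6] at h5
    -- Every term of the series for the left side of the equation is `-e^{iφ_k}` times the algebraic
    -- equation at `k`, hence zero.
    refine h5.unique ?_
    refine hasSum_zero.congr_fun fun k => ?_
    have h7 : ((divisor n ρ ω k * coeff k x + symb n k * coeff k (nonlin α x) : ℝ) : ℂ) = 0 := by
      rw [heq, Complex.ofReal_zero]
    rw [divisor] at h7
    push_cast at h7 ⊢
    linear_combination (-char n ω (y, t) k) * h7 +
      ((∑ j, (k j : ℂ) * (ω j : ℂ)) * (coeff k x : ℂ) * char n ω (y, t) k) * Complex.I_sq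

end Solution

/-! ### Persistence -/

section Persistence

open Wiener

variable {b d : ℕ} {n : Fin b → Fin d → ℤ} {w : Weight (Fin b → ℤ)}

/-- Fourier coefficients on `ℤ^d × ℤ^b`, supported on the graph of the momentum map. -/
noncomputable def graphCoeff (n : Fin b → Fin d → ℤ) (x : Wiener w)
    (p : (Fin d → ℤ) × (Fin b → ℤ)) : ℂ :=
  if p.1 = momentum n p.2 then (coeff p.2 x : ℂ) else 0

/-- Passage between series over `ℤ^b` and series over `ℤ^d × ℤ^b` with coefficients supported on the
graph. -/
theorem hasSum_graph {E : Type*} [AddCommMonoid E] [TopologicalSpace E]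
    {f : (Fin d → ℤ) × (Fin b → ℤ) → E} (hf : ∀ p, p.1 ≠ momentum n p.2 → f p = 0) {S : E}
    (h : HasSum (fun k => f (momentum n k, k)) S) : HasSum f S := by
  have hinj : Function.Injective fun k : Fin b → ℤ => (momentum n k, k) :=
    fun _ _ h => (Prod.ext_iff.1 h).2
  refine (hinj.hasSum_iff ?_).1 h
  rintro ⟨m, k⟩ hp
  exact hf _ fun hm => hp ⟨k, Prod.ext hm.symm rfl⟩

theorem hasSum_graphCoeff (ω : Fin b → ℝ) (x : Wiener w) (y : EuclideanSpace ℝ (Fin d)) (t : ℝ) :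
    HasSum (fun p : (Fin d → ℤ) × (Fin b → ℤ) => graphCoeff n x p *
        Complex.exp (Complex.I *
          (((∑ i, (p.1 i : ℝ) * y i) + (∑ j, (p.2 j : ℝ) * ω j) * t : ℝ) : ℂ)))
      (field n ω x (y, t)) := by
  refine hasSum_graph (n := n) (fun p hp => by rw [graphCoeff, if_neg hp, zero_mul]) ?_
  refine (hasSum_field ω x (y, t)).congr_fun fun k => ?_
  rw [graphCoeff, if_pos rfl, char, wave, phase_apply]

theorem weightedTerm_graphCoeff_le {s σ C : ℝ}
    (hC : ∀ k : Fin b → ℤ, freqNorm (momentum n k, k) ^ s *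
      Real.exp (σ * freqNorm (momentum n k, k)) ≤ C * w k)
    (a : Fin b → ℝ) (x : Wiener w) {k : Fin b → ℤ} (hk : ∀ j, k ≠ basisVec j) :
    weightedTerm s σ (graphCoeff n x) (momentum n k, k) ≤
      (C * (|coeff k (x - torus w a)| * w k)) ^ 2 := by
  set f := freqNorm (momentum n k, k) with hf
  have hf0 : 0 ≤ f := Real.sqrt_nonneg _
  have h1 : coeff k (x - torus w a) = coeff k x := by
    rw [map_sub, coeff_torus_of_ne a hk, sub_zero]
  have h2 : f ^ (2 * s) = (f ^ s) ^ 2 := by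
    rw [mul_comm, Real.rpow_mul hf0, ← Real.rpow_natCast]; norm_num
  have h3 : Real.exp (2 * σ * f) = Real.exp (σ * f) ^ 2 := by
    rw [← Real.exp_nat_mul]; congr 1; push_cast; ring
  rw [weightedTerm, graphCoeff, if_pos rfl, Complex.norm_real, Real.norm_eq_abs, ← hf, h1, h2, h3,
    ← mul_pow, ← mul_pow]
  refine pow_le_pow_left₀ (by positivity) ?_ 2
  rw [mul_assoc]
  calc _ ≤ |coeff k x| * (C * w k) := mul_le_mul_of_nonneg_left (hC k) (abs_nonneg _)
    _ = _ := by ring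

/-- The weighted norm of the Fourier coefficients away from the torus. -/
theorem weightedNorm_graphCoeff_le {s σ C : ℝ} (hC0 : 0 ≤ C)
    (hC : ∀ k : Fin b → ℤ, freqNorm (momentum n k, k) ^ s *
      Real.exp (σ * freqNorm (momentum n k, k)) ≤ C * w k)
    (a : Fin b → ℝ) (x : Wiener w) :
    Summable (fun p : {p : (Fin d → ℤ) × (Fin b → ℤ) // ∀ j, p ≠ (n j, basisVec j)} =>
      weightedTerm s σ (graphCoeff n x) p.1) ∧
    Real.sqrt (∑' p : {p : (Fin d → ℤ) × (Fin b → ℤ) // ∀ j, p ≠ (n j, basisVec j)},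
      weightedTerm s σ (graphCoeff n x) p.1) ≤ C * ‖x - torus w a‖ := by
  set g : (Fin b → ℤ) → ℝ := fun k => C * (|coeff k (x - torus w a)| * w k) with hg
  set G := C * ‖x - torus w a‖ with hG
  have hg0 : ∀ k, 0 ≤ g k := fun k => mul_nonneg hC0 (mul_nonneg (abs_nonneg _) (w.pos k).le)
  have hG0 : 0 ≤ G := mul_nonneg hC0 (norm_nonneg _)
  have hgsum : HasSum g G := (hasSum_norm (x - torus w a)).mul_left C
  -- The weighted `ℓ²` norm is bounded by the weighted `ℓ¹` norm, because each term is at most the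
  -- total sum.
  have hle : ∀ k, g k ^ 2 ≤ G * g k := fun k => by
    rw [sq]
    exact mul_le_mul_of_nonneg_right (le_hasSum hgsum k fun j _ => hg0 j) (hg0 k)
  have hsq : Summable fun k => g k ^ 2 :=
    Summable.of_nonneg_of_le (fun k => sq_nonneg _) hle (hgsum.mul_left G).summable
  have hsq_le : ∑' k, g k ^ 2 ≤ G ^ 2 := by
    refine (hsq.tsum_le_tsum hle (hgsum.mul_left G).summable).trans ?_
    rw [(hgsum.mul_left G).tsum_eq, sq]
  classical
  set F : (Fin d → ℤ) × (Fin b → ℤ) → ℝ :=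
    fun p => if p.1 = momentum n p.2 then g p.2 ^ 2 else 0 with hF
  have hF0 : ∀ p, 0 ≤ F p := fun p => by
    simp only [hF]; split_ifs
    exacts [sq_nonneg _, le_rfl]
  have hFsum : HasSum F (∑' k, g k ^ 2) :=
    hasSum_graph (n := n) (fun p hp => by rw [hF]; exact if_neg hp)
      (hsq.hasSum.congr_fun fun k => by rw [hF]; exact if_pos rfl)
  have hterm : ∀ p : {p : (Fin d → ℤ) × (Fin b → ℤ) // ∀ j, p ≠ (n j, basisVec j)},
      weightedTerm s σ (graphCoeff n x) p.1 ≤ F p.1 := by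
    rintro ⟨⟨m, k⟩, hp⟩
    by_cases hm : m = momentum n k
    · subst hm
      refine (weightedTerm_graphCoeff_le hC a x fun j hj => hp j ?_).trans_eq
        (by rw [hF]; exact (if_pos rfl).symm)
      rw [hj, momentum_basisVec]
    · rw [weightedTerm, graphCoeff, if_neg hm, hF]
      simp [hm]
  have hterm0 : ∀ p : {p : (Fin d → ℤ) × (Fin b → ℤ) // ∀ j, p ≠ (n j, basisVec j)},
      0 ≤ weightedTerm s σ (graphCoeff n x) p.1 := fun p =>
    mul_nonneg (mul_nonneg (sq_nonneg _) (Real.rpow_nonneg (Real.sqrt_nonneg _) _))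
      (Real.exp_pos _).le
  have hFsub : Summable fun p : {p : (Fin d → ℤ) × (Fin b → ℤ) // ∀ j, p ≠ (n j, basisVec j)} =>
    F p.1 := hFsum.summable.comp_injective Subtype.val_injective
  have hsum := Summable.of_nonneg_of_le hterm0 hterm hFsub
  refine ⟨hsum, ?_⟩
  rw [Real.sqrt_le_left hG0]
  refine ((hsum.tsum_le_tsum hterm hFsub).trans ?_).trans hsq_le
  rw [← hFsum.tsum_eq]
  exact hFsub.tsum_le_tsum_of_inj Subtype.val Subtype.val_injective (fun p _ => hF0 p)
    (fun _ => le_rfl) hFsum.summable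

theorem euclNorm_le_sum (v : Fin b → ℝ) : euclNorm v ≤ ∑ j, |v j| := by
  have h := Finset.sum_sq_le_sq_sum_of_nonneg (s := Finset.univ) (f := fun j => |v j|)
    fun i _ => abs_nonneg _
  simp only [sq_abs] at h
  exact Real.sqrt_le_iff.2 ⟨Finset.sum_nonneg fun _ _ => abs_nonneg _, h⟩

theorem euclNorm_sq (v : Fin b → ℝ) : euclNorm v ^ 2 = ∑ j, v j ^ 2 :=
  Real.sq_sqrt (Finset.sum_nonneg fun _ _ => sq_nonneg _)

theorem abs_le_euclNorm (v : Fin b → ℝ) (j : Fin b) : |v j| ≤ euclNorm v :=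
  Real.abs_le_sqrt (Finset.single_le_sum (f := fun j => v j ^ 2) (fun _ _ => sq_nonneg _)
    (Finset.mem_univ j))

theorem cast_sqLen_nonneg {m : ℕ} (v : Fin m → ℤ) : 0 ≤ (sqLen v : ℝ) :=
  Int.cast_nonneg (Finset.sum_nonneg fun _ _ => sq_nonneg _)

theorem abs_freqApprox_sub_baseFreq_le (n : Fin b → Fin d → ℤ) (ρ : ℝ) (a : Fin b → ℝ)
    (j : Fin b) : |freqApprox n ρ a j - baseFreq n ρ j| ≤ 4 * sqLen (n j) * euclNorm a ^ 2 := by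
  have h1 : freqApprox n ρ a j - baseFreq n ρ j =
      -((sqLen (n j) : ℝ) * (4 * euclNorm a ^ 2 - 2 * a j ^ 2)) := by
    rw [freqApprox, euclNorm_sq]; ring
  have h2 : a j ^ 2 ≤ euclNorm a ^ 2 := by
    rw [← sq_abs (a j)]
    exact pow_le_pow_left₀ (abs_nonneg _) (abs_le_euclNorm a j) 2
  have h3 : |4 * euclNorm a ^ 2 - 2 * a j ^ 2| ≤ 4 * euclNorm a ^ 2 :=
    abs_le.2 ⟨by nlinarith [sq_nonneg (a j)], by nlinarith [sq_nonneg (a j)]⟩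
  rw [h1, abs_neg, abs_mul, abs_of_nonneg (cast_sqLen_nonneg _)]
  exact (mul_le_mul_of_nonneg_left h3 (cast_sqLen_nonneg (n j))).trans_eq (by ring)

/-- The frequencies stay at distance `O(|a|²)` from the unperturbed ones. -/
theorem euclNorm_sub_baseFreq_le (n : Fin b → Fin d → ℤ) (ρ : ℝ) {a ω : Fin b → ℝ} {C : ℝ}
    (hC : 0 ≤ C) (ha : euclNorm a ≤ 1)
    (h : ∀ j, |ω j - freqApprox n ρ a j| ≤ C * euclNorm a ^ 3) :
    euclNorm (fun j => ω j - baseFreq n ρ j) ≤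
      (∑ j, (4 * (sqLen (n j) : ℝ) + C)) * euclNorm a ^ 2 := by
  refine (euclNorm_le_sum _).trans ?_
  rw [Finset.sum_mul]
  refine Finset.sum_le_sum fun j _ => ?_
  have h0 : 0 ≤ euclNorm a := Real.sqrt_nonneg _
  have h1 : C * euclNorm a ^ 3 ≤ C * euclNorm a ^ 2 :=
    mul_le_mul_of_nonneg_left (pow_le_pow_of_le_one h0 ha (by norm_num)) hC
  calc |ω j - baseFreq n ρ j| ≤ |ω j - freqApprox n ρ a j| +
        |freqApprox n ρ a j - baseFreq n ρ j| := abs_sub_le _ _ _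
    _ ≤ C * euclNorm a ^ 2 + 4 * sqLen (n j) * euclNorm a ^ 2 :=
        add_le_add ((h j).trans h1) (abs_freqApprox_sub_baseFreq_le n ρ a j)
    _ = _ := by ring

end Persistence

end QLS

/-! ### Conclusion: excluded amplitudes and choice of constants -/

open QLS in
/-- Persistence of the tori of the linear equation. The amplitudes to be excluded are those where
the determinant `linDet n` of the linearized resonant equations is small; that determinant never
vanishes identically (`det_linMatrix_ne_zero`), so that `hdet` does not enter the proof. -/
theorem theorem1p3 {b d : ℕ} (hb : 1 ≤ b) (n : Fin b → Fin d → ℤ)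
    (hn : LinearIndependent ℝ (QLS.realVec n))
    (hperp : ∀ i j l : Fin b, i ≠ j → i ≠ l → j ≠ l →
      (n i - n j) ⬝ᵥ (n i - n l) ≠ 0)
    (hdet : QLS.resonanceDet n hn ≠ 0) :
    ∃ c κ : ℝ, 0 < c ∧ 0 < κ ∧
      ∀ ρ : ℝ, QLS.IsDiophantine ρ →
      ∀ α : ℕ → ℕ → ℝ, QLS.Admissible α →
      ∀ s σ : ℝ, (b : ℝ) / 2 < s → 0 < σ →
      ∃ C ε₀ : ℝ, 0 < C ∧ 0 < ε₀ ∧ ∀ ε : ℝ, 0 < ε → ε < ε₀ →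
        ∃ I : Set (Fin b → ℝ),
          I ⊆ Set.Icc (fun _ => ε) (fun _ => 2 * ε) ∧
          MeasurableSet I ∧
          MeasureTheory.volume I < ENNReal.ofReal (ε ^ ((b : ℝ) + c)) ∧
          ∀ a ∈ Set.Icc (fun _ : Fin b => ε) (fun _ => 2 * ε) \ I,
            ∃ ω : Fin b → ℝ,
              QLS.Persists n ρ α s σ κ C a ω ∧
              ∀ j, |ω j - (QLS.baseFreq n ρ j -
                (QLS.sqLen (n j) : ℝ) * (4 * ∑ l, a l ^ 2 - 2 * a j ^ 2))|
                  ≤ C * QLS.euclNorm a ^ 3 := by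
  classical
  let : Fintype (resonantModes₂ n) := (resonantModes₂_finite hn).fintype
  -- The threshold for the determinant is `ε^{1/4} = η`, so the inverse is of size `1 / (ε² η) =
  -- η^{-9}`.
  obtain ⟨c, ε₁, hc, hε₁, hvol⟩ := exists_volume_rescaled_sublevel_lt (linDet n)
    (linDet_ne_zero hn) (e := 1 / 4) (by norm_num)
  obtain ⟨CB, hCB, hinv⟩ := exists_linMatrixAt_inverse n
  refine ⟨c, 1 / 4, hc, by norm_num, fun ρ hρ α hα s σ hs hσ => ?_⟩
  obtain ⟨R, hR, hconv⟩ := hα.analytic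
  have hs0 : 0 ≤ s := le_trans (by positivity) hs.le
  obtain ⟨μ, Cw, hμ, hCw, hweight⟩ := exists_weight_le n hs0 hσ
  obtain ⟨C, η₀, hC, hη₀, -, hsol⟩ :=
    exists_fourier_solution hn hperp (expWeight hμ.le) hρ hα.order hR hconv hCB
  set D : ℝ := ∑ j, (4 * (sqLen (n j) : ℝ) + C) with hD
  have hD0 : 0 ≤ D := Finset.sum_nonneg fun j _ => by
    have := cast_sqLen_nonneg (n j); positivity
  -- The conditions on `ε` serve, in turn, the measure estimate, the contraction, `|a| ≤ 1` (through
  -- `2bε ≤ 1`), and `2 Cw η < 1`.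
  refine ⟨C + D, min (min ε₁ (η₀ ^ 4)) (min (1 / (2 * b)) ((1 / (2 * Cw)) ^ 4)), by positivity,
    by positivity, fun ε hε hlt => ?_⟩
  obtain ⟨⟨hlt₁, hlt₂⟩, hlt₃, hlt₄⟩ : (ε < ε₁ ∧ ε < η₀ ^ 4) ∧ ε < 1 / (2 * b) ∧
      ε < (1 / (2 * Cw)) ^ 4 := by simpa only [lt_min_iff] using hlt
  obtain ⟨hmeas, hsmall⟩ := hvol ε hε hlt₁
  refine ⟨_, fun a ha => ha.1, hmeas, hsmall, fun a ⟨ha, hnot⟩ => ?_⟩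
  set η : ℝ := ε ^ (1 / 4 : ℝ) with hη
  have hη0 : 0 < η := Real.rpow_pos_of_pos hε _
  have hη4 : η ^ 4 = ε := by
    rw [hη, ← Real.rpow_natCast, ← Real.rpow_mul hε.le]; norm_num
  have hηη₀ : η < η₀ := lt_of_pow_lt_pow_left₀ 4 hη₀.le (hη4.trans_lt hlt₂)
  have hηCw : η < 1 / (2 * Cw) := lt_of_pow_lt_pow_left₀ 4 (by positivity) (hη4.trans_lt hlt₄)
  have hdet' : η ≤ |MvPolynomial.eval (ε⁻¹ • a) (linDet n)| :=
    not_lt.1 fun h => hnot ⟨ha, h⟩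
  obtain ⟨B, hB, hBle⟩ := hinv ε a η hε hη0 ha hdet'
  obtain ⟨x, ω, hxR, hxa, hcoeff, heq, hω⟩ := hsol η hη0 hηη₀ a (by rwa [hη4]) B hB
    (by rwa [hη4])
  have hεa : ε ≤ euclNorm a :=
    ((ha.1 ⟨0, hb⟩).trans (le_abs_self _)).trans (abs_le_euclNorm a ⟨0, hb⟩)
  have ha1 : euclNorm a ≤ 1 := by
    refine (euclNorm_le_sum a).trans ?_
    have h1 : ∀ j, |a j| ≤ 2 * ε := fun j => by
      rw [abs_of_nonneg (hε.le.trans (ha.1 j))]; exact ha.2 j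
    refine (Finset.sum_le_sum fun j _ => h1 j).trans ?_
    have hb' : (0 : ℝ) < 2 * b := by positivity
    rw [lt_div_iff₀ hb'] at hlt₃
    simp only [Finset.sum_const, Finset.card_univ, Fintype.card_fin, nsmul_eq_mul]
    linarith
  have hω' : ∀ j, |ω j - freqApprox n ρ a j| ≤ C * euclNorm a ^ 3 := fun j =>
    (hω j).trans (mul_le_mul_of_nonneg_left
      (by rw [hη4]; exact pow_le_pow_left₀ hε.le hεa 3) hC.le)
  have ha0 : 0 ≤ euclNorm a := hε.le.trans hεa
  obtain ⟨hsum, hnorm⟩ := weightedNorm_graphCoeff_le hCw.le hweight a x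
  refine ⟨ω, ⟨fun y t => field n ω x (y, t), graphCoeff n x,
    isSolution_field hα.order hR hconv (dominates_expWeight hμ) ω hxR heq,
    hasSum_graphCoeff ω x, fun j => ?_, hsum, ?_, ?_⟩, fun j => ?_⟩
  · rw [graphCoeff, if_pos (momentum_basisVec j).symm, hcoeff]
  -- Here `η^5 = ε^{1+κ}` with `κ = 1/4`, while the coefficients off the torus have norm at most `2
  -- Cw η^6`; the spare factor `η` absorbs the constant.
  · have h1 : η ^ 5 ≤ euclNorm a ^ (1 + 1 / 4 : ℝ) := by
      refine le_trans (le_of_eq ?_) (Real.rpow_le_rpow hε.le hεa (by norm_num))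
      rw [hη, ← Real.rpow_natCast, ← Real.rpow_mul hε.le]; norm_num
    refine lt_of_lt_of_le ?_ h1
    rw [lt_div_iff₀ (by positivity)] at hηCw
    calc _ ≤ Cw * (2 * η ^ 6) := hnorm.trans (mul_le_mul_of_nonneg_left hxa hCw.le)
      _ = η * (2 * Cw) * η ^ 5 := by ring
      _ < η ^ 5 := mul_lt_of_lt_one_left (by positivity) hηCw
  · refine (euclNorm_sub_baseFreq_le n ρ hC.le ha1 hω').trans ?_
    exact mul_le_mul_of_nonneg_right (by linarith) (by positivity)
  · exact (hω' j).trans (mul_le_mul_of_nonneg_right (by linarith) (by positivity))
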